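/- Let $K$ be a field, let $n\ge 1$, and let $\tilde A_n$ be the cyclic quiver with vertices $1,\dots,n$ (read modulo $n$) and one arrow $i\to i+1$ for each vertex $i$ (a loop if $n=1$). Let $J\subset K\tilde A_n$ be the ideal generated by the arrows, and let $\mathcal E_n$ be the category of finite-dimensional left $K\tilde A_n$-modules $M$ with $J^N M=0$ for some $N$. Let $S_i$ be the simple module at the vertex $i$. All subcategories are full and closed under isomorphism. A torsion pair on a category $\mathcal C$ of modules is a pair $(\mathcal T,\mathcal F)$ of subcategories of $\mathcal C$ such that $\operatorname{Hom}(X,Y)=0$ for all $X\in\mathcal T$, $Y\in\mathcal F$, and every $X\in\mathcal C$ lies in an exact sequence $0\to X'\to X\to X''\to 0$ with $X'\in\mathcal T$, $X''\in\mathcal F$. For a set $\Delta$ of vertices, let $\operatorname{Coray}(\Delta)$ (respectively $\operatorname{Ray}(\Delta)$) be the category of all $M\in\mathcal E_n$ whose top $M/\operatorname{rad}M$ (respectively socle) lies in $\operatorname{add}\bigoplus_{i\in\Delta}S_i$. For $\Delta\neq\emptyset$, let $\Lambda_\Delta$ be the path algebra of the full subquiver of $\tilde A_n$ on the vertices not in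 $\Delta$, a finite-dimensional algebra (zero if $\Delta$ contains all vertices). Regard the finitely generated left $\Lambda_\Delta$-modules as the modules in $\mathcal E_n$ on which the trivial paths at the vertices of $\Delta$ act as zero. A finitely generated $\Lambda_\Delta$-module $T$ is tilting if it has projective dimension at most $1$, $\operatorname{Ext}^1(T,T)=0$, and there is an exact sequence $0\to\Lambda_\Delta\to T_0\to T_1\to0$ with $T_0,T_1\in\operatorname{add}T$; it induces the torsion pair $(\operatorname{Gen}T,\{X:\operatorname{Hom}(T,X)=0\})$ on $\Lambda_\Delta\text{-mod}$. A finitely generated $\Lambda_\Delta$-module $U$ is cotilting if it has injective dimension at most $1$, $\operatorname{Ext}^1(U,U)=0$, and there is an exact sequence $0\to U_1\to U_0\to \operatorname{Hom}_K(\Lambda_\Delta,K)\to0$ with $U_0,U_1\in\operatorname{add}U$; it induces the torsion pair $(\{X:\operatorname{Hom}(X,U)=0\},\operatorname{Cogen}U)$ on $\Lambda_\Delta\text{-mod}$. Here $\operatorname{Gen}T$ and $\operatorname{Cogen}U$ consist of the quotients of finite direct sums of copies of $T$ and of the submodules of finite direct sums of copies of $U$. Write $\mathcal A\oplus\mathcal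 B$ for the category of modules isomorphic to $A\oplus B$ with $A\in\mathcal A$, $B\in\mathcal B$. **Theorem.** The following are torsion pairs on $\mathcal E_n$, and every torsion pair on $\mathcal E_n$ occurs exactly once among them: 1. $(\operatorname{Coray}(\Delta)\oplus\mathcal T',\ \mathcal F')$, where $\Delta$ is a non-empty set of vertices and $(\mathcal T',\mathcal F')$ is a torsion pair on $\Lambda_\Delta\text{-mod}$ induced by a cotilting module; 2. $(\mathcal T',\ \mathcal F'\oplus\operatorname{Ray}(\Delta))$, where $\Delta$ is a non-empty set of vertices and $(\mathcal T',\mathcal F')$ is a torsion pair on $\Lambda_\Delta\text{-mod}$ induced by a tilting module. That is, every torsion pair on $\mathcal E_n$ is of exactly one of the two kinds, and it determines $\Delta$, $\mathcal T'$ and $\mathcal F'$ uniquely. Moreover the sums are direct: in $\operatorname{Coray}(\Delta)\oplus\mathcal T'$ and in $\mathcal F'\oplus\operatorname{Ray}(\Delta)$ the two summands of a module are unique up to isomorphism. -/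

import Mathlib

open CategoryTheory

universe u

/-! ### Modules over a ring, torsion pairs, tilting and cotilting modules -/

section Modules

variable {R : Type u} [Ring R]

/-- There is an exact sequence `0 → X → Y → Z → 0`. -/
def ExistsShortExact (X Y Z : ModuleCat.{u} R) : Prop :=
  ∃ (f : X →ₗ[R] Y) (g : Y →ₗ[R] Z),
    Function.Injective f ∧ Function.Exact f g ∧ Function.Surjective g

/-- `R-mod`: the finitely generated left `R`-modules. -/
def finGen (R : Type u) [Ring R] : ObjectProperty (ModuleCat.{u} R) :=
  fun M => Module.Finite R M

/-- A torsion pair `(T, F)` on a full subcategory `C` of the category of modules.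
Subcategories are full and closed under isomorphism. -/
structure IsTorsionPair (C T F : ObjectProperty (ModuleCat.{u} R)) : Prop where
  torsion_iso : T.IsClosedUnderIsomorphisms
  free_iso : F.IsClosedUnderIsomorphisms
  torsion_le : T ≤ C
  free_le : F ≤ C
  hom_zero : ∀ X Y : ModuleCat.{u} R, T X → F Y → ∀ f : X →ₗ[R] Y, f = 0
  exists_exact : ∀ X, C X → ∃ X' X'', T X' ∧ F X'' ∧ ExistsShortExact X' X X''

/-- `add X`: the direct summands of the finite direct sums `X ⊕ ⋯ ⊕ X`. -/
def addOf (X : ModuleCat.{u} R) : ObjectProperty (ModuleCat.{u} R) :=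
  fun M => ∃ (k : ℕ) (i : M →ₗ[R] (Fin k → X)) (p : (Fin k → X) →ₗ[R] M),
    p ∘ₗ i = LinearMap.id

/-- `Gen X`: the quotients of the finite direct sums `X ⊕ ⋯ ⊕ X`. -/
def genOf (X : ModuleCat.{u} R) : ObjectProperty (ModuleCat.{u} R) :=
  fun M => ∃ (k : ℕ) (p : (Fin k → X) →ₗ[R] M), Function.Surjective p

/-- `Cogen X`: the submodules of the finite direct sums `X ⊕ ⋯ ⊕ X`. -/
def cogenOf (X : ModuleCat.{u} R) : ObjectProperty (ModuleCat.{u} R) :=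
  fun M => ∃ (k : ℕ) (i : M →ₗ[R] (Fin k → X)), Function.Injective i

/-- (Classical) tilting modules: finitely generated `T` of projective dimension at most one
with `Ext¹(T, T) = 0` and an exact sequence `0 → R → T₀ → T₁ → 0` with `T₀, T₁ ∈ add T`. -/
structure IsTilting (T : ModuleCat.{u} R) : Prop where
  finite : Module.Finite R T
  projDim : HasProjectiveDimensionLE T 1
  ext_self : Subsingleton (Abelian.Ext T T 1)
  resolution : ∃ T₀ T₁ : ModuleCat.{u} R,
    addOf T T₀ ∧ addOf T T₁ ∧ ExistsShortExact (ModuleCat.of R R) T₀ T₁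

/-- The torsion pair `(T', F')` on `R-mod` is induced by a tilting module `T`:
`T' = Gen T` and `F' = {X | Hom(T, X) = 0}`. -/
def IsTiltingInduced (T' F' : ObjectProperty (ModuleCat.{u} R)) : Prop :=
  ∃ T : ModuleCat.{u} R, IsTilting T ∧
    (∀ X, T' X ↔ genOf T X) ∧
    (∀ X, F' X ↔ finGen R X ∧ ∀ f : T →ₗ[R] X, f = 0)

/-- The `K`-dual `D Λ = Hom_K(Λ, K)` of the right regular module of a `K`-algebra `Λ`. It is a
left `Λ`-module by `(b • f) x = f (x * b)`. -/
def DualRegular (K Λ : Type u) [Field K] [Ring Λ] [Algebra K Λ] : Type u :=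
  Λ →ₗ[K] K

namespace DualRegular

variable (K Λ : Type u) [Field K] [Ring Λ] [Algebra K Λ]

noncomputable instance : AddCommGroup (DualRegular K Λ) :=
  inferInstanceAs (AddCommGroup (Λ →ₗ[K] K))

noncomputable instance : Module Λ (DualRegular K Λ) where
  smul b f := LinearMap.comp (show Λ →ₗ[K] K from f) (LinearMap.mulRight K b)
  one_smul f := LinearMap.ext fun x => congrArg (show Λ →ₗ[K] K from f) (mul_one x)
  mul_smul b c f := LinearMap.ext fun x =>
    congrArg (show Λ →ₗ[K] K from f) (mul_assoc x b c).symm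
  smul_zero _ := rfl
  smul_add _ _ _ := rfl
  add_smul b c f := LinearMap.ext fun x =>
    (congrArg (show Λ →ₗ[K] K from f) (mul_add x b c)).trans
      (map_add (show Λ →ₗ[K] K from f) _ _)
  zero_smul f := LinearMap.ext fun x =>
    (congrArg (show Λ →ₗ[K] K from f) (mul_zero x)).trans
      (map_zero (show Λ →ₗ[K] K from f))

theorem smul_apply (b : Λ) (f : DualRegular K Λ) (x : Λ) :
    (show Λ →ₗ[K] K from b • f) x = (show Λ →ₗ[K] K from f) (x * b) := rfl

end DualRegular

/-- (Classical) cotilting modules over a `K`-algebra `Λ`: finitely generated `U` of injective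
dimension at most one with `Ext¹(U, U) = 0` and an exact sequence `0 → U₁ → U₀ → D Λ → 0` with
`U₀, U₁ ∈ add U`. -/
structure IsCotilting (K : Type u) {Λ : Type u} [Field K] [Ring Λ] [Algebra K Λ]
    (U : ModuleCat.{u} Λ) : Prop where
  finite : Module.Finite Λ U
  injDim : HasInjectiveDimensionLE U 1
  ext_self : Subsingleton (Abelian.Ext U U 1)
  resolution : ∃ U₀ U₁ : ModuleCat.{u} Λ,
    addOf U U₀ ∧ addOf U U₁ ∧ ExistsShortExact U₁ U₀ (ModuleCat.of Λ (DualRegular K Λ))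

/-- The torsion pair `(T', F')` on `Λ-mod` is induced by a cotilting module `U`:
`T' = {X | Hom(X, U) = 0}` and `F' = Cogen U`. -/
def IsCotiltingInduced (K : Type u) {Λ : Type u} [Field K] [Ring Λ] [Algebra K Λ]
    (T' F' : ObjectProperty (ModuleCat.{u} Λ)) : Prop :=
  ∃ U : ModuleCat.{u} Λ, IsCotilting K U ∧
    (∀ X, T' X ↔ finGen Λ X ∧ ∀ f : X →ₗ[Λ] U, f = 0) ∧
    (∀ X, F' X ↔ cogenOf U X)

/-- The modules isomorphic to `M₁ ⊕ M₂` with `M₁ ∈ C₁` and `M₂ ∈ C₂`. -/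
def directSumOf (C₁ C₂ : ObjectProperty (ModuleCat.{u} R)) : ObjectProperty (ModuleCat.{u} R) :=
  fun M => ∃ M₁ M₂ : ModuleCat.{u} R, C₁ M₁ ∧ C₂ M₂ ∧ Nonempty (M ≃ₗ[R] (M₁ × M₂))

/-- The decomposition of a module as `M₁ ⊕ M₂` with `M₁ ∈ C₁` and `M₂ ∈ C₂` is unique up to
isomorphism of the two summands, which is what entitles one to write `C₁ ⊕ C₂`. -/
def HasUniqueDecomposition (C₁ C₂ : ObjectProperty (ModuleCat.{u} R)) : Prop :=
  ∀ M₁ M₂ N₁ N₂ : ModuleCat.{u} R, C₁ M₁ → C₂ M₂ → C₁ N₁ → C₂ N₂ →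
    Nonempty ((M₁ × M₂) ≃ₗ[R] (N₁ × N₂)) → Nonempty (M₁ ≃ₗ[R] N₁) ∧ Nonempty (M₂ ≃ₗ[R] N₂)

/-- The top `M / rad M` of a module, `rad M` being the intersection of the maximal submodules. -/
noncomputable def topOf (M : ModuleCat.{u} R) : ModuleCat.{u} R :=
  ModuleCat.of R (M ⧸ Module.jacobson R M)

/-- The socle of a module: the sum of its simple submodules. -/
noncomputable def socleOf (M : ModuleCat.{u} R) : ModuleCat.{u} R :=
  ModuleCat.of R (sSup {N : Submodule R M | IsSimpleModule R N} : Submodule R M)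

end Modules

/-! ### Path algebras -/

/-- The defining relations of the path algebra `KQ`, among the trivial paths `e v` and the
arrows `a` of `Q`. Products are read from right to left, so that a left module is a
representation of `Q`, an arrow `v ⟶ w` mapping `e v M` to `e w M`. -/
inductive PathAlgebra.Rel (K : Type u) [Field K] (V : Type) [Quiver.{0} V] [Fintype V] :
    FreeAlgebra K (V ⊕ Quiver.Total V) → FreeAlgebra K (V ⊕ Quiver.Total V) → Prop
  | idem (v : V) : PathAlgebra.Rel K V
      (FreeAlgebra.ι K (.inl v) * FreeAlgebra.ι K (.inl v)) (FreeAlgebra.ι K (.inl v))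
  | orth (v w : V) (h : v ≠ w) : PathAlgebra.Rel K V
      (FreeAlgebra.ι K (.inl v) * FreeAlgebra.ι K (.inl w)) 0
  | sum_eq_one : PathAlgebra.Rel K V (∑ v, FreeAlgebra.ι K (.inl v)) 1
  | target_mul (a : Quiver.Total V) : PathAlgebra.Rel K V
      (FreeAlgebra.ι K (.inl a.right) * FreeAlgebra.ι K (.inr a)) (FreeAlgebra.ι K (.inr a))
  | mul_source (a : Quiver.Total V) : PathAlgebra.Rel K V
      (FreeAlgebra.ι K (.inr a) * FreeAlgebra.ι K (.inl a.left)) (FreeAlgebra.ι K (.inr a))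

/-- The path algebra `KQ` of a quiver `Q` with finite vertex set `V`, presented by generators
(trivial paths and arrows) and relations. -/
def PathAlgebra (K : Type u) [Field K] (V : Type) [Quiver.{0} V] [Fintype V] : Type u :=
  RingQuot (PathAlgebra.Rel K V)

namespace PathAlgebra

section

variable (K : Type u) [Field K] (V : Type) [Quiver.{0} V] [Fintype V]

noncomputable instance : Ring (PathAlgebra K V) :=
  inferInstanceAs (Ring (RingQuot (PathAlgebra.Rel K V)))

noncomputable instance : Algebra K (PathAlgebra K V) :=
  inferInstanceAs (Algebra K (RingQuot (PathAlgebra.Rel K V)))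

variable {V}

/-- The trivial path at a vertex. -/
noncomputable def vertex (v : V) : PathAlgebra K V :=
  RingQuot.mkAlgHom K (PathAlgebra.Rel K V) (FreeAlgebra.ι K (.inl v))

/-- An arrow as an element of the path algebra. -/
noncomputable def arrow (a : Quiver.Total V) : PathAlgebra K V :=
  RingQuot.mkAlgHom K (PathAlgebra.Rel K V) (FreeAlgebra.ι K (.inr a))

theorem vertex_mul_self (v : V) : vertex K v * vertex K v = vertex K v := by
  have h := RingQuot.mkAlgHom_rel K (PathAlgebra.Rel.idem (K := K) v)
  rw [map_mul] at h
  exact h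

theorem vertex_mul_of_ne {v w : V} (hvw : v ≠ w) : vertex K v * vertex K w = 0 := by
  have h := RingQuot.mkAlgHom_rel K (PathAlgebra.Rel.orth (K := K) v w hvw)
  rw [map_mul, map_zero] at h
  exact h

theorem sum_vertex : ∑ v : V, vertex K v = 1 := by
  have h := RingQuot.mkAlgHom_rel K (PathAlgebra.Rel.sum_eq_one (K := K) (V := V))
  rw [map_sum, map_one] at h
  exact h

theorem target_mul_arrow (a : Quiver.Total V) : vertex K a.right * arrow K a = arrow K a := by
  have h := RingQuot.mkAlgHom_rel K (PathAlgebra.Rel.target_mul (K := K) a)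
  rw [map_mul] at h
  exact h

theorem arrow_mul_source (a : Quiver.Total V) : arrow K a * vertex K a.left = arrow K a := by
  have h := RingQuot.mkAlgHom_rel K (PathAlgebra.Rel.mul_source (K := K) a)
  rw [map_mul] at h
  exact h

end

section lift

variable {K : Type u} [Field K] {V : Type} [Quiver.{0} V] [Fintype V]
  {B : Type u} [Ring B] [Algebra K B]

/-- The universal property of the path algebra. -/
noncomputable def lift (e : V → B) (x : Quiver.Total V → B)
    (h1 : ∀ v, e v * e v = e v) (h2 : ∀ v w, v ≠ w → e v * e w = 0) (h3 : ∑ v, e v = 1)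
    (h4 : ∀ a, e a.right * x a = x a) (h5 : ∀ a, x a * e a.left = x a) :
    PathAlgebra K V →ₐ[K] B :=
  RingQuot.liftAlgHom K ⟨FreeAlgebra.lift K (Sum.elim e x), by
    intro p q h
    cases h with
    | idem v => simpa using h1 v
    | orth v w h => simpa using h2 v w h
    | sum_eq_one => simpa using h3
    | target_mul a => simpa using h4 a
    | mul_source a => simpa using h5 a⟩

variable (e : V → B) (x : Quiver.Total V → B)
    (h1 : ∀ v, e v * e v = e v) (h2 : ∀ v w, v ≠ w → e v * e w = 0) (h3 : ∑ v, e v = 1)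
    (h4 : ∀ a, e a.right * x a = x a) (h5 : ∀ a, x a * e a.left = x a)

@[simp] theorem lift_vertex (v : V) : lift (K := K) e x h1 h2 h3 h4 h5 (vertex K v) = e v := by
  simp only [lift, vertex]
  erw [RingQuot.liftAlgHom_mkAlgHom_apply]
  simp

@[simp] theorem lift_arrow (a : Quiver.Total V) :
    lift (K := K) e x h1 h2 h3 h4 h5 (arrow K a) = x a := by
  simp only [lift, arrow]
  erw [RingQuot.liftAlgHom_mkAlgHom_apply]
  simp

end lift

section

variable (K : Type u) [Field K] {V : Type} [Quiver.{0} V] [Fintype V]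

/-- The simple module at the vertex `v` is `K` with `e v` acting as the identity, the other
trivial paths and all arrows acting as zero; this is its structure map. -/
noncomputable def simpleHom [DecidableEq V] (v : V) : PathAlgebra K V →ₐ[K] K :=
  lift (fun w => if w = v then 1 else 0) (fun _ => 0)
    (by intro w; by_cases h : w = v <;> simp [h])
    (by
      intro w w' h
      by_cases h1 : w = v
      · have h2 : w' ≠ v := fun h2 => h (h1.trans h2.symm)
        simp [h2]
      · simp [h1])
    (by simp) (by simp) (by simp)

/-- The simple module `S v` at the vertex `v`. -/
noncomputable def simpleModule [DecidableEq V] (v : V) : ModuleCat.{u} (PathAlgebra K V) :=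
  (ModuleCat.restrictScalars (simpleHom K v).toRingHom).obj (ModuleCat.of K K)

/-- The direct sum of the simple modules at the vertices in `Δ`. -/
noncomputable def simplesAt [DecidableEq V] (Δ : Finset V) : ModuleCat.{u} (PathAlgebra K V) :=
  ModuleCat.of (PathAlgebra K V) ((v : {v // v ∈ Δ}) → simpleModule K v.1)

/-- The two-sided ideal `J` of `KQ` generated by the arrows, as a `K`-subspace. -/
noncomputable def arrowIdeal (V : Type) [Quiver.{0} V] [Fintype V] :
    Submodule K (PathAlgebra K V) :=
  ⊤ * Submodule.span K (Set.range (arrow K)) * ⊤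

/-- The ordinary (nilpotent) modules: the finite-dimensional `KQ`-modules `M` such that
`J ^ N M = 0` for some `N`. -/
def ordinary (V : Type) [Quiver.{0} V] [Fintype V] :
    ObjectProperty (ModuleCat.{u} (PathAlgebra K V)) :=
  fun M => Module.Finite K (RestrictScalars K (PathAlgebra K V) M) ∧
    ∃ N : ℕ, ∀ a ∈ arrowIdeal K V ^ N, ∀ m : M, a • m = 0

end

end PathAlgebra

/-! ### Full subquivers -/

/-- The vertices of the full subquiver `Q(Q₀ - Δ)`. -/
def DelVertex {V : Type} (Δ : Finset V) : Type := {v : V // v ∉ Δ}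

namespace DelVertex

variable {V : Type} [Quiver.{0} V] [Fintype V] [DecidableEq V] (Δ : Finset V)

instance : Quiver.{0} (DelVertex Δ) where
  Hom v w := v.1 ⟶ w.1

instance : Fintype (DelVertex Δ) := inferInstanceAs (Fintype {v : V // v ∉ Δ})

/-- The surjection from `KQ` to the path algebra of the full subquiver `Q(Q₀ - Δ)` which kills
the trivial paths at the vertices in `Δ` and all arrows starting or ending in `Δ`. -/
noncomputable def proj (K : Type u) [Field K] :
    PathAlgebra K V →ₐ[K] PathAlgebra K (DelVertex Δ) :=
  PathAlgebra.lift
    (fun v => if h : v ∉ Δ then PathAlgebra.vertex K (V := DelVertex Δ) ⟨v, h⟩ else 0)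
    (fun a => if h : a.left ∉ Δ ∧ a.right ∉ Δ then
      PathAlgebra.arrow K (V := DelVertex Δ) ⟨⟨a.left, h.1⟩, ⟨a.right, h.2⟩, a.hom⟩ else 0)
    (by
      intro v
      by_cases h : v ∉ Δ
      · simp only [dif_pos h]
        exact PathAlgebra.vertex_mul_self K _
      · simp only [dif_neg h, mul_zero])
    (by
      intro v w hvw
      by_cases h : v ∉ Δ
      · by_cases h' : w ∉ Δ
        · simp only [dif_pos h, dif_pos h']
          exact PathAlgebra.vertex_mul_of_ne K fun h2 => hvw (congrArg Subtype.val h2)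
        · simp only [dif_neg h', mul_zero]
      · simp only [dif_neg h, zero_mul])
    (by
      rw [← PathAlgebra.sum_vertex K (V := DelVertex Δ),
        ← Finset.sum_subset (Finset.subset_univ (Finset.univ.filter (· ∉ Δ)))
          (fun v _ hv => dif_neg (by simpa using hv))]
      refine Finset.sum_bij' (fun v hv => (⟨v, by simpa using hv⟩ : DelVertex Δ))
        (fun v _ => v.1) ?_ ?_ ?_ ?_ ?_
      · intros; exact Finset.mem_univ _
      · intro v _; simpa using v.2
      · intros; rfl
      · intros; rfl
      · intro v hv
        exact dif_pos (by simpa using hv))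
    (by
      intro a
      by_cases h : a.left ∉ Δ ∧ a.right ∉ Δ
      · simp only [dif_pos h, dif_pos h.2]
        exact PathAlgebra.target_mul_arrow K (V := DelVertex Δ)
          ⟨⟨a.left, h.1⟩, ⟨a.right, h.2⟩, a.hom⟩
      · simp only [dif_neg h, mul_zero])
    (by
      intro a
      by_cases h : a.left ∉ Δ ∧ a.right ∉ Δ
      · simp only [dif_pos h, dif_pos h.1]
        exact PathAlgebra.arrow_mul_source K (V := DelVertex Δ)
          ⟨⟨a.left, h.1⟩, ⟨a.right, h.2⟩, a.hom⟩
      · simp only [dif_neg h, zero_mul])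

/-- A class of modules over the path algebra of `Q(Q₀ - Δ)`, regarded as a class of
`KQ`-modules (closed under isomorphism) by letting `KQ` act through `proj`. -/
noncomputable def asKQ {K : Type u} [Field K]
    (P : ObjectProperty (ModuleCat.{u} (PathAlgebra K (DelVertex Δ)))) :
    ObjectProperty (ModuleCat.{u} (PathAlgebra K V)) :=
  P.map (ModuleCat.restrictScalars (proj Δ K).toRingHom)

end DelVertex

/-! ### The cyclic quiver -/

/-- The vertices of the cyclic quiver `Ã_n`, which has `n` vertices and one arrow `i ⟶ i + 1`
for each vertex `i` (a loop if `n = 1`). -/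
def CyclicQuiver (n : ℕ) : Type := ZMod n

namespace CyclicQuiver

instance (n : ℕ) : Quiver.{0} (CyclicQuiver n) where
  Hom i j := PLift ((show ZMod n from j) = (show ZMod n from i) + 1)

instance (n : ℕ) : DecidableEq (CyclicQuiver n) := inferInstanceAs (DecidableEq (ZMod n))

instance (n : ℕ) [NeZero n] : Fintype (CyclicQuiver n) := inferInstanceAs (Fintype (ZMod n))

variable (K : Type u) [Field K] (n : ℕ) [NeZero n]

/-- The category `E_n` of ordinary modules over the cyclic quiver. -/
def E : ObjectProperty (ModuleCat.{u} (PathAlgebra K (CyclicQuiver n))) :=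
  PathAlgebra.ordinary K (CyclicQuiver n)

variable {n}

/-- `Ray(Δ)`: the modules in `E_n` whose socle lies in `add (⨁_{v ∈ Δ} S v)`. -/
def Ray (Δ : Finset (CyclicQuiver n)) :
    ObjectProperty (ModuleCat.{u} (PathAlgebra K (CyclicQuiver n))) :=
  fun M => E K n M ∧ addOf (PathAlgebra.simplesAt K Δ) (socleOf M)

/-- `Coray(Δ)`: the modules in `E_n` whose top lies in `add (⨁_{v ∈ Δ} S v)`. -/
def Coray (Δ : Finset (CyclicQuiver n)) :
    ObjectProperty (ModuleCat.{u} (PathAlgebra K (CyclicQuiver n))) :=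
  fun M => E K n M ∧ addOf (PathAlgebra.simplesAt K Δ) (topOf M)

variable (n)

/-- A non-empty set `Δ` of vertices together with a pair `(T', F')` of classes of modules over
the path algebra of the full subquiver of `Ã_n` on the complement of `Δ`. -/
structure PairDatum where
  Δ : Finset (CyclicQuiver n)
  nonempty : Δ.Nonempty
  T' : ObjectProperty (ModuleCat.{u} (PathAlgebra K (DelVertex Δ)))
  F' : ObjectProperty (ModuleCat.{u} (PathAlgebra K (DelVertex Δ)))

/-- The data of the first kind: `(T', F')` is a torsion pair on `Ã_n(Q₀ - Δ)-mod` which is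
induced by a cotilting module. -/
structure FirstKind extends PairDatum K n where
  isTorsionPair : IsTorsionPair (finGen _) T' F'
  induced : IsCotiltingInduced K T' F'

/-- The data of the second kind: `(T', F')` is a torsion pair on `Ã_n(Q₀ - Δ)-mod` which is
induced by a tilting module. -/
structure SecondKind extends PairDatum K n where
  isTorsionPair : IsTorsionPair (finGen _) T' F'
  induced : IsTiltingInduced T' F'

variable {K n}

/-- The pair `(Coray(Δ) ⊕ T', F')`. -/
noncomputable def FirstKind.pair (d : FirstKind K n) :
    ObjectProperty (ModuleCat.{u} (PathAlgebra K (CyclicQuiver n))) ×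
      ObjectProperty (ModuleCat.{u} (PathAlgebra K (CyclicQuiver n))) :=
  (directSumOf (Coray K d.Δ) (DelVertex.asKQ d.Δ d.T'), DelVertex.asKQ d.Δ d.F')

/-- The pair `(T', F' ⊕ Ray(Δ))`. -/
noncomputable def SecondKind.pair (d : SecondKind K n) :
    ObjectProperty (ModuleCat.{u} (PathAlgebra K (CyclicQuiver n))) ×
      ObjectProperty (ModuleCat.{u} (PathAlgebra K (CyclicQuiver n))) :=
  (DelVertex.asKQ d.Δ d.T', directSumOf (DelVertex.asKQ d.Δ d.F') (Ray K d.Δ))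

end CyclicQuiver

/-! Every module in `E K n` is a direct sum of uniserial modules `Uni K i l` (top at `i`, length
`l`, socle at `i + l - 1`), so a torsion pair (T, F) is governed by its uniserials. The torsion
sequence of a uniserial again consists of uniserials (`exists_uni_split`). Applied to one of length
2n, it shows that some torsion or some torsion-free uniserial has length at least n. A torsion
uniserial that runs once around the cycle can be glued to itself, so all uniserials with its top are
torsion; dually, a long torsion-free one makes all uniserials with its socle torsion-free. The two
cases exclude each other, since some nonzero uniserial has the given top and the given socle. This
gives the two kinds, with Δ the set of all such tops (`torsionTops`) or of all such socles
(`freeSocles`).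

In the first case F lives on the vertices outside Δ, and cutting T down to these vertices gives a
torsion pair on Λ_Δ-mod. The indecomposable projectives of Λ_Δ are the uniserials that avoid Δ but
would enter it if prolonged by one step at the socle; gluing shows that they lie in F
(`uni_free_of_torsionTops`). Conversely, start from a torsion pair (T', F') on Λ_Δ-mod with all
projectives in F'. A uniserial whose top is outside Δ but which meets Δ has a nonzero projective
quotient. Hence a module without maps to F' splits into uniserials with top in Δ and uniserials in
T', so (Coray(Δ) ⊕ T', F') is a torsion pair on `E K n` (`isTorsionPair_coray`), and Δ is recovered
from it (`torsionTops_coray`). The second case is dual, with injectives and Ray(Δ).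

It remains to see that a torsion pair on Λ_Δ-mod is induced by a cotilting module exactly when Λ_Δ
is torsion-free, and by a tilting module exactly when DΛ_Δ is torsion. One direction is the
faithfulness of (co)tilting modules. For the other, take a minimal right F'-approximation U₀ → DΛ.
It is onto because Λ is in F', and its kernel U₁ is Ext-injective in F' by Wakamatsu's lemma; then
U₀ ⊕ U₁ is cotilting and cogenerates F'. Approximations exist because only finitely many uniserials
avoid Δ, and the homological dimensions are at most one because every uniserial has a two-term
projective resolution and a two-term injective coresolution by uniserials. -/

set_option linter.unusedSectionVars false

/-! ### Formal properties of torsion pairs. -/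

section TorsionPairs

variable {R : Type u} [Ring R]

theorem CategoryTheory.ObjectProperty.prop_of_linearEquiv (P : ObjectProperty (ModuleCat.{u} R))
    [P.IsClosedUnderIsomorphisms] {M N : Type u} [AddCommGroup M] [Module R M] [AddCommGroup N]
    [Module R N] (e : M ≃ₗ[R] N) (h : P (ModuleCat.of R M)) : P (ModuleCat.of R N) :=
  P.prop_of_iso e.toModuleIso h

namespace IsTorsionPair

variable {C T F : ObjectProperty (ModuleCat.{u} R)}

/-- If all maps from X to F vanish, the projection of X onto its torsion-free quotient is zero, so X
is its own torsion part. Hence each class determines the other, and the closure properties below are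
formal. -/
theorem torsion_iff (h : IsTorsionPair C T F) (X : ModuleCat.{u} R) :
    T X ↔ C X ∧ ∀ Y, F Y → ∀ f : X →ₗ[R] Y, f = 0 := by
  refine ⟨fun hX => ⟨h.torsion_le _ hX, fun Y hY f => h.hom_zero _ _ hX hY f⟩, ?_⟩
  rintro ⟨hC, hX⟩
  obtain ⟨X', X'', hX', hX'', f, g, hf, hfg, hg⟩ := h.exists_exact X hC
  have hg0 := hX _ hX'' g
  have hs : Function.Surjective f := fun x => (hfg x).1 (by simp [hg0])
  have := h.torsion_iso
  exact T.prop_of_linearEquiv (LinearEquiv.ofBijective f ⟨hf, hs⟩) hX'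

theorem free_iff (h : IsTorsionPair C T F) (Y : ModuleCat.{u} R) :
    F Y ↔ C Y ∧ ∀ X, T X → ∀ f : X →ₗ[R] Y, f = 0 := by
  refine ⟨fun hX => ⟨h.free_le _ hX, fun X hY f => h.hom_zero _ _ hY hX f⟩, ?_⟩
  rintro ⟨hC, hX⟩
  obtain ⟨X', X'', hX', hX'', f, g, hf, hfg, hg⟩ := h.exists_exact Y hC
  have hf0 := hX _ hX' f
  have : Function.Injective g := by
    rw [injective_iff_map_eq_zero]
    intro x hx
    obtain ⟨y, rfl⟩ := (hfg x).1 hx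
    simp [hf0]
  have := h.free_iso
  exact F.prop_of_linearEquiv (LinearEquiv.ofBijective g ⟨‹_›, hg⟩).symm hX''

theorem torsion_eq {T' : ObjectProperty (ModuleCat.{u} R)} (h : IsTorsionPair C T F)
    (h' : IsTorsionPair C T' F) : T = T' :=
  funext fun X => propext ((h.torsion_iff X).trans (h'.torsion_iff X).symm)

theorem free_eq {F' : ObjectProperty (ModuleCat.{u} R)} (h : IsTorsionPair C T F)
    (h' : IsTorsionPair C T F') : F = F' :=
  funext fun X => propext ((h.free_iff X).trans (h'.free_iff X).symm)

variable {L M N : Type u} [AddCommGroup L] [Module R L] [AddCommGroup M] [Module R M]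
  [AddCommGroup N] [Module R N]

theorem torsion_of_surjective (h : IsTorsionPair C T F) (f : M →ₗ[R] N)
    (hf : Function.Surjective f) (hN : C (.of R N)) (hM : T (.of R M)) : T (.of R N) := by
  refine (h.torsion_iff _).2 ⟨hN, fun Y hY g => ?_⟩
  have := h.hom_zero _ _ hM hY (g ∘ₗ f)
  ext x
  obtain ⟨y, rfl⟩ := hf x
  exact DFunLike.congr_fun this y

theorem free_of_injective (h : IsTorsionPair C T F) (f : M →ₗ[R] N)
    (hf : Function.Injective f) (hM : C (.of R M)) (hN : F (.of R N)) : F (.of R M) := by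
  refine (h.free_iff _).2 ⟨hM, fun X hX g => ?_⟩
  have := h.hom_zero _ _ hX hN (f ∘ₗ g)
  ext x
  apply hf
  exact (DFunLike.congr_fun this x).trans (map_zero f).symm

theorem torsion_of_exact (h : IsTorsionPair C T F) (f : L →ₗ[R] M) (g : M →ₗ[R] N)
    (hfg : Function.Exact f g) (hg : Function.Surjective g) (hM : C (.of R M))
    (hL : T (.of R L)) (hN : T (.of R N)) : T (.of R M) := by
  refine (h.torsion_iff _).2 ⟨hM, fun Y hY φ => ?_⟩
  have h0 := h.hom_zero _ _ hL hY (φ ∘ₗ f)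
  have hker : LinearMap.ker g ≤ LinearMap.ker φ := by
    intro x hx
    obtain ⟨y, rfl⟩ := (hfg x).1 hx
    exact DFunLike.congr_fun h0 y
  let e := g.quotKerEquivOfSurjective hg
  have h1 := h.hom_zero _ _ hN hY (((LinearMap.ker g).liftQ φ hker) ∘ₗ e.symm.toLinearMap)
  ext x
  have h2 : ((LinearMap.ker g).liftQ φ hker) (e.symm (g x)) = 0 := DFunLike.congr_fun h1 (g x)
  have h3 : e.symm (g x) = (LinearMap.ker g).mkQ x := by
    rw [LinearEquiv.symm_apply_eq]; rfl
  rw [h3] at h2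
  exact h2

theorem free_of_exact (h : IsTorsionPair C T F) (f : L →ₗ[R] M) (g : M →ₗ[R] N)
    (hf : Function.Injective f) (hfg : Function.Exact f g) (hM : C (.of R M))
    (hL : F (.of R L)) (hN : F (.of R N)) : F (.of R M) := by
  refine (h.free_iff _).2 ⟨hM, fun X hX φ => ?_⟩
  have h0 := h.hom_zero _ _ hX hN (g ∘ₗ φ)
  let e := LinearEquiv.ofInjective f hf
  have h1 := h.hom_zero _ _ hX hL (e.symm.toLinearMap ∘ₗ
    φ.codRestrict (LinearMap.range f) fun x => (hfg _).1 (DFunLike.congr_fun h0 x))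
  ext x
  have h2 : e.symm (φ.codRestrict (LinearMap.range f)
    (fun x => (hfg _).1 (DFunLike.congr_fun h0 x)) x) = 0 := DFunLike.congr_fun h1 x
  rw [LinearEquiv.symm_apply_eq, map_zero] at h2
  exact congrArg Subtype.val h2

theorem torsion_prod (h : IsTorsionPair C T F) (hC : C (.of R (M × N)))
    (hM : T (.of R M)) (hN : T (.of R N)) : T (.of R (M × N)) :=
  h.torsion_of_exact (LinearMap.inl R M N) (LinearMap.snd R M N) .inl_snd
    Prod.snd_surjective hC hM hN

theorem free_prod (h : IsTorsionPair C T F) (hC : C (.of R (M × N)))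
    (hM : F (.of R M)) (hN : F (.of R N)) : F (.of R (M × N)) :=
  h.free_of_exact (LinearMap.inl R M N) (LinearMap.snd R M N) LinearMap.inl_injective .inl_snd
    hC hM hN

theorem torsion_pi (h : IsTorsionPair C T F) {ι : Type} [Fintype ι] {M : ι → Type u}
    [∀ i, AddCommGroup (M i)] [∀ i, Module R (M i)] (hC : C (.of R (∀ i, M i)))
    (hM : ∀ i, T (.of R (M i))) : T (.of R (∀ i, M i)) := by
  classical
  refine (h.torsion_iff _).2 ⟨hC, fun Y hY f => ?_⟩
  refine LinearMap.pi_ext' fun i => ?_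
  exact h.hom_zero _ _ (hM i) hY (f ∘ₗ LinearMap.single R M i)

theorem free_pi (h : IsTorsionPair C T F) {ι : Type} {M : ι → Type u}
    [∀ i, AddCommGroup (M i)] [∀ i, Module R (M i)] (hC : C (.of R (∀ i, M i)))
    (hM : ∀ i, F (.of R (M i))) : F (.of R (∀ i, M i)) := by
  refine (h.free_iff _).2 ⟨hC, fun X hX f => ?_⟩
  ext x i
  exact DFunLike.congr_fun (h.hom_zero _ _ hX (hM i) (LinearMap.proj i ∘ₗ f)) x

theorem torsion_of_subsingleton (h : IsTorsionPair C T F) [Subsingleton M] (hC : C (.of R M)) :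
    T (.of R M) :=
  (h.torsion_iff _).2 ⟨hC, fun _ _ f => LinearMap.ext fun x => by
    change f x = 0
    rw [Subsingleton.elim (α := M) x 0, map_zero]⟩

theorem free_of_subsingleton (h : IsTorsionPair C T F) [Subsingleton M] (hC : C (.of R M)) :
    F (.of R M) :=
  (h.free_iff _).2 ⟨hC, fun _ _ _ => LinearMap.ext fun _ => Subsingleton.elim (α := M) _ _⟩

theorem subsingleton_of_torsion_of_free (h : IsTorsionPair C T F) (hT : T (.of R M))
    (hF : F (.of R M)) : Subsingleton M := by
  have := h.hom_zero _ _ hT hF LinearMap.id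
  exact ⟨fun x y => (DFunLike.congr_fun this x).trans (DFunLike.congr_fun this y).symm⟩

end IsTorsionPair

end TorsionPairs

/-! ### Short exact sequences: homological dimension and vanishing of Ext. -/

section ShortExact

variable {R : Type u} [Ring R]
variable {L M N : Type u} [AddCommGroup L] [Module R L] [AddCommGroup M] [Module R M]
  [AddCommGroup N] [Module R N]

/-- The short exact sequence in `ModuleCat R` attached to two linear maps. -/
theorem exists_shortExact (f : L →ₗ[R] M) (g : M →ₗ[R] N) (hf : Function.Injective f)
    (hfg : Function.Exact f g) (hg : Function.Surjective g) :
    ∃ w : ModuleCat.ofHom f ≫ ModuleCat.ofHom g = 0,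
      (ShortComplex.mk (ModuleCat.ofHom f) (ModuleCat.ofHom g) w).ShortExact := by
  have w : ModuleCat.ofHom f ≫ ModuleCat.ofHom g = 0 := by
    ext x; exact hfg.apply_apply_eq_zero x
  have hm : Mono (ModuleCat.ofHom f) := (ModuleCat.mono_iff_injective (ModuleCat.ofHom f)).2 hf
  have he : Epi (ModuleCat.ofHom g) := (ModuleCat.epi_iff_surjective (ModuleCat.ofHom g)).2 hg
  exact ⟨w, { exact := (ShortComplex.ShortExact.moduleCat_exact_iff_function_exact _).2 hfg }⟩

theorem hasProjectiveDimensionLE_one_of_exact (f : L →ₗ[R] M) (g : M →ₗ[R] N)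
    (hf : Function.Injective f) (hfg : Function.Exact f g) (hg : Function.Surjective g)
    (hL : Module.Projective R L) (hM : Module.Projective R M) :
    HasProjectiveDimensionLE (ModuleCat.of R N) 1 := by
  obtain ⟨w, h⟩ := exists_shortExact f g hf hfg hg
  have : Projective (ModuleCat.of R L) := (IsProjective.iff_projective _).1 hL
  have : Projective (ModuleCat.of R M) := (IsProjective.iff_projective _).1 hM
  exact h.hasProjectiveDimensionLT_X₃ 1 inferInstance inferInstance

theorem hasInjectiveDimensionLE_one_of_exact (f : L →ₗ[R] M) (g : M →ₗ[R] N)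
    (hf : Function.Injective f) (hfg : Function.Exact f g) (hg : Function.Surjective g)
    (hM : Module.Injective R M) (hN : Module.Injective R N) :
    HasInjectiveDimensionLE (ModuleCat.of R L) 1 := by
  obtain ⟨w, h⟩ := exists_shortExact f g hf hfg hg
  have : Injective (ModuleCat.of R M) := (Module.injective_iff_injective_object _ _).1 hM
  have : Injective (ModuleCat.of R N) := (Module.injective_iff_injective_object _ _).1 hN
  exact h.hasInjectiveDimensionLT_X₁ 1 inferInstance inferInstance

/-- Dimension shifting: M is projective, so every class in Ext¹(N, Y) comes from a map L → Y under
the connecting map, and maps that extend to M go to zero. Vanishing of Ext¹ becomes an extension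
problem for linear maps. -/
theorem subsingleton_ext_one_of_extend (f : L →ₗ[R] M) (g : M →ₗ[R] N)
    (hf : Function.Injective f) (hfg : Function.Exact f g) (hg : Function.Surjective g)
    (hM : Module.Projective R M) (Y : ModuleCat.{u} R)
    (H : ∀ φ : L →ₗ[R] Y, ∃ ψ : M →ₗ[R] Y, ψ ∘ₗ f = φ) :
    Subsingleton (Abelian.Ext (ModuleCat.of R N) Y 1) := by
  obtain ⟨w, h⟩ := exists_shortExact f g hf hfg hg
  have : Projective (ModuleCat.of R M) := (IsProjective.iff_projective _).1 hM
  refine subsingleton_of_forall_eq 0 fun x => ?_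
  obtain ⟨y, rfl⟩ := Abelian.Ext.contravariant_sequence_exact₃ h Y x
    (Abelian.Ext.eq_zero_of_projective _) (n₀ := 0) rfl
  obtain ⟨φ, rfl⟩ := (Abelian.Ext.mk₀_bijective _ _).2 y
  obtain ⟨ψ, hψ⟩ := H φ.hom
  have : φ = ModuleCat.ofHom f ≫ ModuleCat.ofHom ψ := by
    ext x; exact (DFunLike.congr_fun hψ x).symm
  rw [this, ← Abelian.Ext.mk₀_comp_mk₀]
  exact h.extClass_comp_assoc (Abelian.Ext.mk₀ (ModuleCat.ofHom ψ))

/-- The dual dimension shift, along an injective middle term: vanishing of Ext¹ becomes a lifting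
problem. -/
theorem subsingleton_ext_one_of_lift (f : L →ₗ[R] M) (g : M →ₗ[R] N)
    (hf : Function.Injective f) (hfg : Function.Exact f g) (hg : Function.Surjective g)
    (hM : Module.Injective R M) (X : ModuleCat.{u} R)
    (H : ∀ φ : X →ₗ[R] N, ∃ ψ : X →ₗ[R] M, g ∘ₗ ψ = φ) :
    Subsingleton (Abelian.Ext X (ModuleCat.of R L) 1) := by
  obtain ⟨w, h⟩ := exists_shortExact f g hf hfg hg
  have : Injective (ModuleCat.of R M) := (Module.injective_iff_injective_object _ _).1 hM
  refine subsingleton_of_forall_eq 0 fun x => ?_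
  obtain ⟨y, rfl⟩ := Abelian.Ext.covariant_sequence_exact₁ X h x
    (Abelian.Ext.eq_zero_of_injective _) (n₀ := 0) rfl
  obtain ⟨φ, rfl⟩ := (Abelian.Ext.mk₀_bijective _ _).2 y
  obtain ⟨ψ, hψ⟩ := H φ.hom
  have : φ = ModuleCat.ofHom ψ ≫ ModuleCat.ofHom g := by
    ext x; exact (DFunLike.congr_fun hψ x).symm
  rw [this, ← Abelian.Ext.mk₀_comp_mk₀, Abelian.Ext.comp_assoc_of_second_deg_zero]
  exact (congrArg (fun z => (Abelian.Ext.mk₀ (ModuleCat.ofHom ψ)).comp z (zero_add 1))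
    h.comp_extClass).trans (Abelian.Ext.comp_zero _ _ _ _ _)

theorem subsingleton_ext_mid_right (f : L →ₗ[R] M) (g : M →ₗ[R] N)
    (hf : Function.Injective f) (hfg : Function.Exact f g) (hg : Function.Surjective g)
    (X : ModuleCat.{u} R) {k : ℕ} (hL : Subsingleton (Abelian.Ext X (ModuleCat.of R L) k))
    (hN : Subsingleton (Abelian.Ext X (ModuleCat.of R N) k)) :
    Subsingleton (Abelian.Ext X (ModuleCat.of R M) k) := by
  obtain ⟨w, h⟩ := exists_shortExact f g hf hfg hg
  refine subsingleton_of_forall_eq 0 fun x => ?_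
  obtain ⟨y, rfl⟩ := Abelian.Ext.covariant_sequence_exact₂ X h x (hN.elim _ _)
  have hy : y = 0 := hL.elim _ _
  rw [hy, Abelian.Ext.zero_comp]

theorem subsingleton_ext_mid_left (f : L →ₗ[R] M) (g : M →ₗ[R] N)
    (hf : Function.Injective f) (hfg : Function.Exact f g) (hg : Function.Surjective g)
    (Y : ModuleCat.{u} R) {k : ℕ} (hL : Subsingleton (Abelian.Ext (ModuleCat.of R L) Y k))
    (hN : Subsingleton (Abelian.Ext (ModuleCat.of R N) Y k)) :
    Subsingleton (Abelian.Ext (ModuleCat.of R M) Y k) := by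
  obtain ⟨w, h⟩ := exists_shortExact f g hf hfg hg
  refine subsingleton_of_forall_eq 0 fun x => ?_
  obtain ⟨y, rfl⟩ := Abelian.Ext.contravariant_sequence_exact₂ h Y x (hL.elim _ _)
  have hy : y = 0 := hN.elim _ _
  rw [hy, Abelian.Ext.comp_zero]

end ShortExact

/-! ### The dual of the regular module is faithful and injective. -/

namespace DualRegular

variable (K : Type u) {Λ : Type u} [Field K] [Ring Λ] [Algebra K Λ]

noncomputable instance : Module K (DualRegular K Λ) :=
  inferInstanceAs (Module K (Λ →ₗ[K] K))

instance : IsScalarTower K Λ (DualRegular K Λ) where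
  smul_assoc c b f := LinearMap.ext fun x => by
    change (show Λ →ₗ[K] K from f) (x * (c • b)) = c • (show Λ →ₗ[K] K from f) (x * b)
    rw [mul_smul_comm, map_smul]

instance [Module.Finite K Λ] : Module.Finite K (DualRegular K Λ) :=
  inferInstanceAs (Module.Finite K (Λ →ₗ[K] K))

instance [Module.Finite K Λ] : Module.Finite Λ (DualRegular K Λ) :=
  Module.Finite.of_restrictScalars_finite K Λ _

variable {K}
variable {M : Type*} [AddCommGroup M] [Module K M] [Module Λ M] [IsScalarTower K Λ M]

/-- The homomorphism `m ↦ (b ↦ ξ (b • m))` into the dual of the regular module given by a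
functional `ξ`. -/
noncomputable def ofFunctional (ξ : M →ₗ[K] K) : M →ₗ[Λ] DualRegular K Λ where
  toFun m := (show Λ →ₗ[K] K from ξ ∘ₗ (LinearMap.toSpanSingleton Λ M m).restrictScalars K)
  map_add' x y := LinearMap.ext fun b => by
    change ξ (b • (x + y)) = ξ (b • x) + ξ (b • y)
    rw [smul_add, map_add]
  map_smul' c x := LinearMap.ext fun b => by
    change ξ (b • c • x) = ξ ((b * c) • x)
    rw [mul_smul]

theorem ofFunctional_apply (ξ : M →ₗ[K] K) (m : M) (b : Λ) :
    (show Λ →ₗ[K] K from ofFunctional ξ m) b = ξ (b • m) := rfl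

theorem eq_zero_of_ofFunctional {ξ : M →ₗ[K] K} {m : M}
    (h : ofFunctional (Λ := Λ) ξ m = 0) : ξ m = 0 := by
  have := DFunLike.congr_fun (show (show Λ →ₗ[K] K from ofFunctional ξ m) = 0 from h) 1
  rwa [ofFunctional_apply, one_smul] at this

theorem eq_zero_of_forall_smul_eq_zero {a : Λ} (h : ∀ f : DualRegular K Λ, a • f = 0) :
    a = 0 := by
  rw [← Module.forall_dual_apply_eq_zero_iff K]
  intro f
  have h1 : (show Λ →ₗ[K] K from a • (show DualRegular K Λ from f)) 1 = 0 := by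
    rw [h]; rfl
  rwa [smul_apply, one_mul] at h1

/-- A Λ-homomorphism into DΛ is the same as a K-functional, namely its value at 1, and functionals
extend along injections of vector spaces. -/
instance : Module.Injective Λ (DualRegular K Λ) where
  out X Y _ _ _ _ f hf g := by
    let : Module K X := Module.compHom X (algebraMap K Λ)
    let : Module K Y := Module.compHom Y (algebraMap K Λ)
    have : IsScalarTower K Λ X := .of_algebraMap_smul fun _ _ => rfl
    have : IsScalarTower K Λ Y := .of_algebraMap_smul fun _ _ => rfl
    obtain ⟨r, hr⟩ := (f.restrictScalars K).exists_leftInverse_of_injective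
      (LinearMap.ker_eq_bot.2 hf)
    let ev : DualRegular K Λ →ₗ[K] K :=
      { toFun := fun φ => (show Λ →ₗ[K] K from φ) 1
        map_add' := fun _ _ => rfl
        map_smul' := fun _ _ => rfl }
    refine ⟨ofFunctional (ev ∘ₗ g.restrictScalars K ∘ₗ r), fun x => LinearMap.ext fun b => ?_⟩
    have h1 : r (b • f x) = b • x := by
      rw [← map_smul]
      exact DFunLike.congr_fun hr (b • x)
    change (show Λ →ₗ[K] K from g (r (b • f x))) 1 = (show Λ →ₗ[K] K from g x) b
    rw [h1, map_smul, smul_apply, one_mul]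

end DualRegular

/-! ### Classes induced by tilting or cotilting modules contain the injectives or the projectives.
-/

section FiniteDimensional

variable {K Λ : Type u} [Field K] [Ring Λ] [Algebra K Λ]

theorem exists_separating_functionals (K : Type*) [Field K] (M : Type*) [AddCommGroup M]
    [Module K M] [Module.Finite K M] :
    ∃ (k : ℕ) (ξ : Fin k → M →ₗ[K] K), ∀ m, (∀ j, ξ j m = 0) → m = 0 := by
  refine ⟨_, fun j => (Module.finBasis K M).coord j, fun m hm => ?_⟩
  exact (Module.Basis.forall_coord_eq_zero_iff _).1 hm

/-- Finitely many functionals separate the points of M, and each of them is the value at 1 of a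
homomorphism to DΛ. -/
theorem exists_embedding_dualRegular (K : Type u) {Λ : Type u} [Field K] [Ring Λ] [Algebra K Λ]
    [Module.Finite K Λ] (M : Type u) [AddCommGroup M] [Module Λ M] [Module.Finite Λ M] :
    ∃ (k : ℕ) (i : M →ₗ[Λ] (Fin k → DualRegular K Λ)), Function.Injective i := by
  let : Module K M := Module.compHom M (algebraMap K Λ)
  have : IsScalarTower K Λ M := .of_algebraMap_smul fun _ _ => rfl
  have : Module.Finite K M := Module.Finite.trans Λ M
  obtain ⟨k, ξ, hξ⟩ := exists_separating_functionals K M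
  refine ⟨k, LinearMap.pi fun j => DualRegular.ofFunctional (ξ j), ?_⟩
  rw [injective_iff_map_eq_zero]
  intro m hm
  exact hξ m fun j => DualRegular.eq_zero_of_ofFunctional (congrFun hm j)

theorem smul_eq_zero_of_addOf {R : Type u} [Ring R] {X M : ModuleCat.{u} R} (h : addOf X M)
    {a : R} (ha : ∀ x : X, a • x = 0) (m : M) : a • m = 0 := by
  obtain ⟨k, i, p, hip⟩ := h
  have : a • i m = 0 := funext fun j => ha _
  have h1 : m = p (i m) := (DFunLike.congr_fun hip m).symm
  rw [h1, ← map_smul, this, map_zero]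

/-- The torsion-free class induced by a cotilting module contains the projectives. -/
theorem IsCotiltingInduced.free_of_projective [Module.Finite K Λ]
    {T F : ObjectProperty (ModuleCat.{u} Λ)} (h : IsTorsionPair (finGen Λ) T F)
    (hU : IsCotiltingInduced K T F) (P : Type u) [AddCommGroup P] [Module Λ P]
    [Module.Finite Λ P] (hP : Module.Projective Λ P) : F (.of Λ P) := by
  have : IsNoetherianRing Λ := isNoetherian_of_tower K inferInstance
  have hΛ : F (.of Λ Λ) := by
    obtain ⟨U, ⟨hfin, -, -, U₀, U₁, h₀, -, f, g, -, -, hg⟩, -, hF⟩ := hU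
    rw [hF]
    let : Module K U := Module.compHom U (algebraMap K Λ)
    have : IsScalarTower K Λ U := .of_algebraMap_smul fun _ _ => rfl
    have : Module.Finite K U := Module.Finite.trans Λ U
    -- Acting on a K-basis of U embeds Λ into a power of U provided that U is faithful. An element
    -- that kills U kills U₀ in add U, hence the quotient DΛ of U₀, and DΛ is faithful.
    refine ⟨_, LinearMap.pi fun j => LinearMap.toSpanSingleton Λ U (Module.finBasis K U j), ?_⟩
    rw [injective_iff_map_eq_zero]
    intro a ha
    have h1 (u : U) : a • u = 0 := by
      have : (Algebra.lsmul K K U a : U →ₗ[K] U) = 0 :=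
        (Module.finBasis K U).ext fun j => congrFun ha j
      exact DFunLike.congr_fun this u
    refine DualRegular.eq_zero_of_forall_smul_eq_zero (K := K) fun φ => ?_
    obtain ⟨y, rfl⟩ := hg φ
    rw [← map_smul, smul_eq_zero_of_addOf h₀ h1, map_zero]
  obtain ⟨k, f, hf⟩ := Module.Finite.exists_fin' Λ P
  obtain ⟨s, hs⟩ := Module.projective_lifting_property f LinearMap.id hf
  have hk : F (.of Λ (Fin k → Λ)) := h.free_pi (Module.Finite.pi (R := Λ)) fun _ => hΛ
  refine h.free_of_injective s ?_ ‹_› hk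
  exact Function.LeftInverse.injective (g := f) fun x => DFunLike.congr_fun hs x

/-- The torsion class induced by a tilting module contains the injectives. -/
theorem IsTiltingInduced.torsion_of_injective (K : Type u) {Λ : Type u} [Field K] [Ring Λ]
    [Algebra K Λ] [Module.Finite K Λ]
    {T F : ObjectProperty (ModuleCat.{u} Λ)} (h : IsTorsionPair (finGen Λ) T F)
    (hU : IsTiltingInduced T F) (I : Type u) [AddCommGroup I] [Module Λ I]
    [Module.Finite Λ I] (hI : Module.Injective Λ I) : T (.of Λ I) := by
  have hD : T (.of Λ (DualRegular K Λ)) := by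
    obtain ⟨U, ⟨hfin, -, -, U₀, U₁, h₀, -, f, g, hf, -, -⟩, hT, -⟩ := hU
    rw [hT]
    let : Module K U := Module.compHom U (algebraMap K Λ)
    have : IsScalarTower K Λ U := .of_algebraMap_smul fun _ _ => rfl
    have : Module.Finite K U := Module.Finite.trans Λ U
    obtain ⟨k, ξ, hξ⟩ := exists_separating_functionals K U
    let Ψ : (Fin k → U) →ₗ[Λ] DualRegular K Λ :=
      ∑ j, DualRegular.ofFunctional (ξ j) ∘ₗ LinearMap.proj j
    refine ⟨k, Ψ, ?_⟩
    -- Ψ is onto as soon as no nonzero element of Λ is annihilated by its range. Such an element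
    -- would kill U, hence U₀, hence the copy of 1 inside U₀.
    let W : Subspace K (Module.Dual K Λ) := LinearMap.range (Ψ.restrictScalars K)
    have hW : W.dualCoannihilator = ⊥ := by
      rw [eq_bot_iff]
      intro a ha
      rw [Submodule.mem_dualCoannihilator] at ha
      have h1 (u : U) : a • u = 0 := by
        refine hξ _ fun j => ?_
        have h2 := ha _ (LinearMap.mem_range_self (Ψ.restrictScalars K) (Pi.single j u))
        have h3 : Ψ (Pi.single j u) = DualRegular.ofFunctional (ξ j) u := by
          simp only [Ψ, LinearMap.sum_apply, LinearMap.comp_apply, LinearMap.proj_apply]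
          rw [Finset.sum_eq_single j]
          · simp
          · intro i _ hij
            simp [hij]
          · simp
        rw [LinearMap.restrictScalars_apply, h3] at h2
        exact h2
      have h2 : a • (1 : Λ) = 0 := hf <| by
        rw [map_smul, smul_eq_zero_of_addOf h₀ h1, map_zero]
      simpa using h2
    have hW' : W = ⊤ := by
      rw [← Subspace.dualCoannihilator_dualAnnihilator_eq (W := W), hW,
        Submodule.dualAnnihilator_bot]
    intro φ
    have : (show Module.Dual K Λ from φ) ∈ W := hW' ▸ Submodule.mem_top
    exact this
  obtain ⟨k, i, hi⟩ := exists_embedding_dualRegular K (Λ := Λ) I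
  obtain ⟨r, hr⟩ := hI.out i hi LinearMap.id
  exact h.torsion_of_surjective r (fun x => ⟨i x, hr x⟩) ‹_›
    (h.torsion_pi (Module.Finite.pi (R := Λ)) fun _ => hD)

end FiniteDimensional

/-! ### Minimal approximations, Wakamatsu's lemma and the construction of (co)tilting modules. -/

section Approximations

variable {R : Type u} [Ring R]

/-- A right approximation of `D` by modules in `F`. -/
structure IsRightApprox (F : ObjectProperty (ModuleCat.{u} R)) {U D : Type u} [AddCommGroup U]
    [Module R U] [AddCommGroup D] [Module R D] (p : U →ₗ[R] D) : Prop where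
  prop : F (.of R U)
  exists_lift : ∀ X : ModuleCat.{u} R, F X → ∀ g : X →ₗ[R] D, ∃ h : X →ₗ[R] U, p ∘ₗ h = g

/-- A left approximation of `D` by modules in `T`. -/
structure IsLeftApprox (T : ObjectProperty (ModuleCat.{u} R)) {U D : Type u} [AddCommGroup U]
    [Module R U] [AddCommGroup D] [Module R D] (c : D →ₗ[R] U) : Prop where
  prop : T (.of R U)
  exists_desc : ∀ X : ModuleCat.{u} R, T X → ∀ g : D →ₗ[R] X, ∃ h : U →ₗ[R] X, h ∘ₗ c = g

theorem bijective_of_range_length_le {M : Type u} [AddCommGroup M] [Module R M]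
    [IsArtinian R M] [IsNoetherian R M] (h : M →ₗ[R] M)
    (hl : Module.length R M ≤ Module.length R (LinearMap.range h)) : Function.Bijective h := by
  have h1 : LinearMap.range h = ⊤ := by
    by_contra hne
    exact absurd (Submodule.length_lt hne) (not_lt.2 hl)
  have h2 := LinearMap.range_eq_top.1 h1
  exact ⟨IsNoetherian.injective_of_surjective_endomorphism h h2, h2⟩

variable {T F : ObjectProperty (ModuleCat.{u} R)}

/-- An approximation of least length is minimal: if p ∘ h = p, then p restricted to the range of h
is again an approximation, so this range cannot be shorter than U and h is bijective. -/
theorem IsTorsionPair.exists_minimal_rightApprox [IsArtinianRing R]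
    (hTF : IsTorsionPair (finGen R) T F)
    {D : Type u} [AddCommGroup D] [Module R D]
    (hD : ∃ (U : ModuleCat.{u} R) (p : U →ₗ[R] D), IsRightApprox F p) :
    ∃ (U : ModuleCat.{u} R) (p : U →ₗ[R] D), IsRightApprox F p ∧
      ∀ h : U →ₗ[R] U, p ∘ₗ h = p → Function.Bijective h := by
  let S : Set ℕ∞ := {k | ∃ (U : ModuleCat.{u} R) (p : U →ₗ[R] D), IsRightApprox F p ∧
    Module.length R U = k}
  have hS : S.Nonempty := let ⟨U, p, h⟩ := hD; ⟨_, U, p, h, rfl⟩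
  obtain ⟨U, p, hp, hU⟩ := WellFounded.min_mem wellFounded_lt S hS
  refine ⟨U, p, hp, fun h hh => ?_⟩
  have : Module.Finite R U := hTF.free_le _ hp.prop
  refine bijective_of_range_length_le h ?_
  rw [hU]
  refine WellFounded.min_le wellFounded_lt ?_
  refine ⟨.of R (LinearMap.range h), p ∘ₗ (LinearMap.range h).subtype, ⟨?_, ?_⟩, rfl⟩
  · exact hTF.free_of_injective (LinearMap.range h).subtype Subtype.val_injective
      (show Module.Finite R _ from inferInstance) hp.prop
  · intro X hX g
    obtain ⟨k, hk⟩ := hp.exists_lift X hX g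
    refine ⟨h.rangeRestrict ∘ₗ k, ?_⟩
    rw [← hk]
    ext x
    exact DFunLike.congr_fun hh (k x)

/-- Again an approximation of least length works; here c is corestricted to the range of h. -/
theorem IsTorsionPair.exists_minimal_leftApprox [IsArtinianRing R]
    (hTF : IsTorsionPair (finGen R) T F)
    {D : Type u} [AddCommGroup D] [Module R D]
    (hD : ∃ (U : ModuleCat.{u} R) (c : D →ₗ[R] U), IsLeftApprox T c) :
    ∃ (U : ModuleCat.{u} R) (c : D →ₗ[R] U), IsLeftApprox T c ∧
      ∀ h : U →ₗ[R] U, h ∘ₗ c = c → Function.Bijective h := by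
  let S : Set ℕ∞ := {k | ∃ (U : ModuleCat.{u} R) (c : D →ₗ[R] U), IsLeftApprox T c ∧
    Module.length R U = k}
  have hS : S.Nonempty := let ⟨U, p, h⟩ := hD; ⟨_, U, p, h, rfl⟩
  obtain ⟨U, c, hc, hU⟩ := WellFounded.min_mem wellFounded_lt S hS
  refine ⟨U, c, hc, fun h hh => ?_⟩
  have : Module.Finite R U := hTF.torsion_le _ hc.prop
  refine bijective_of_range_length_le h ?_
  rw [hU]
  refine WellFounded.min_le wellFounded_lt ?_
  refine ⟨.of R (LinearMap.range h), h.rangeRestrict ∘ₗ c, ⟨?_, ?_⟩, rfl⟩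
  · exact hTF.torsion_of_surjective h.rangeRestrict h.surjective_rangeRestrict
      (show Module.Finite R _ from inferInstance) hc.prop
  · intro X hX g
    obtain ⟨k, hk⟩ := hc.exists_desc X hX g
    refine ⟨k ∘ₗ (LinearMap.range h).subtype, ?_⟩
    rw [← hk]
    ext x
    exact congrArg k (DFunLike.congr_fun hh x)

/-- **Wakamatsu's lemma**: the kernel of a minimal right approximation is `Ext`-injective. -/
theorem IsTorsionPair.subsingleton_ext_ker (hTF : IsTorsionPair (finGen R) T F)
    {U D : Type u} [AddCommGroup U] [Module R U] [AddCommGroup D] [Module R D]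
    (p : U →ₗ[R] D) (hp : IsRightApprox F p)
    (hmin : ∀ h : U →ₗ[R] U, p ∘ₗ h = p → Function.Bijective h)
    (X : ModuleCat.{u} R) (hX : F X) :
    Subsingleton (Abelian.Ext X (.of R (LinearMap.ker p)) 1) := by
  have : Module.Finite R U := hTF.free_le _ hp.prop
  have : Module.Finite R X := hTF.free_le _ hX
  obtain ⟨k, g, hg⟩ := Module.Finite.exists_fin' R X
  let Q := LinearMap.ker g
  refine subsingleton_ext_one_of_extend Q.subtype g Subtype.val_injective
    (LinearMap.exact_subtype_ker_map g) hg inferInstance _ fun φ => ?_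
  let ι := (LinearMap.ker p).subtype
  -- The quotient by N is the pushout of the free presentation of X along ker g → ker p → U. It is
  -- an extension of X by U, hence in F, and p extends to a map p' on it that kills the free part.
  -- Lifting p' through p gives G, and minimality makes G ∘ inU an automorphism e of U.
  let N : Submodule R (U × (Fin k → R)) :=
    LinearMap.range (LinearMap.prod (ι ∘ₗ φ) (-Q.subtype))
  let inU : U →ₗ[R] (U × (Fin k → R)) ⧸ N := N.mkQ ∘ₗ LinearMap.inl _ _ _
  let g' : ((U × (Fin k → R)) ⧸ N) →ₗ[R] X := N.liftQ (g ∘ₗ LinearMap.snd _ _ _) <| by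
    rintro _ ⟨q, rfl⟩
    change g (-(q : Fin k → R)) = 0
    rw [map_neg, q.2, neg_zero]
  let p' : ((U × (Fin k → R)) ⧸ N) →ₗ[R] D := N.liftQ (p ∘ₗ LinearMap.fst _ _ _) <| by
    rintro _ ⟨q, rfl⟩
    exact (φ q).2
  have hinU : Function.Injective inU := by
    rw [injective_iff_map_eq_zero]
    intro u hu
    obtain ⟨q, hq⟩ := (Submodule.Quotient.mk_eq_zero N).1 hu
    have h2 : -(q : Fin k → R) = 0 := congrArg Prod.snd hq
    have h3 : q = 0 := Subtype.ext (neg_eq_zero.1 h2)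
    have h1 : (ι (φ q) : U) = u := congrArg Prod.fst hq
    rw [← h1, h3, map_zero, map_zero]
  have hrel (q : Q) : N.mkQ (0, (q : Fin k → R)) = inU (φ q : U) := by
    refine ((Submodule.Quotient.eq N).2 ?_).symm
    exact ⟨q, by ext <;> simp [ι]⟩
  have hex : Function.Exact inU g' := by
    intro y
    obtain ⟨⟨u, x⟩, rfl⟩ := N.mkQ_surjective y
    constructor
    · intro hx
      refine ⟨u + (φ ⟨x, hx⟩ : U), ?_⟩
      rw [map_add, ← hrel ⟨x, hx⟩]
      change N.mkQ (u, 0) + N.mkQ (0, x) = _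
      rw [← map_add]
      simp
    · rintro ⟨u', hu'⟩
      rw [← hu']
      change g 0 = 0
      exact map_zero g
  have hE : F (.of R ((U × (Fin k → R)) ⧸ N)) :=
    hTF.free_of_exact inU g' hinU hex (show Module.Finite R _ from inferInstance) hp.prop hX
  obtain ⟨G, hG⟩ := hp.exists_lift _ hE p'
  have hh : p ∘ₗ (G ∘ₗ inU) = p := by
    ext u
    exact DFunLike.congr_fun hG (inU u)
  let e := LinearEquiv.ofBijective _ (hmin _ hh)
  have he (u : U) : p (e.symm u) = p u := by
    conv_rhs => rw [← e.apply_symm_apply u]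
    exact (DFunLike.congr_fun hh (e.symm u)).symm
  -- After the correction by the inverse of e, G retracts the pushout onto U compatibly with the
  -- maps to D. On the free part it therefore lands in ker p, and there it extends φ.
  refine ⟨(e.symm.toLinearMap ∘ₗ G ∘ₗ N.mkQ ∘ₗ LinearMap.inr _ _ _).codRestrict
    (LinearMap.ker p) fun x => ?_, ?_⟩
  · refine (he _).trans ((DFunLike.congr_fun hG (N.mkQ (0, x))).trans ?_)
    exact map_zero p
  · ext q
    change e.symm (G (N.mkQ (0, (q : Fin k → R)))) = (φ q : U)
    rw [hrel, LinearEquiv.symm_apply_eq]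
    rfl

/-- The dual of Wakamatsu's lemma: the cokernel of a minimal left approximation is
`Ext`-projective. -/
theorem IsTorsionPair.subsingleton_ext_coker (K : Type u) [Field K] [Algebra K R]
    [IsNoetherianRing R] [Module.Finite K R] (hTF : IsTorsionPair (finGen R) T F)
    {U D : Type u} [AddCommGroup U] [Module R U] [AddCommGroup D] [Module R D]
    (c : D →ₗ[R] U) (hc : IsLeftApprox T c)
    (hmin : ∀ h : U →ₗ[R] U, h ∘ₗ c = c → Function.Bijective h)
    (X : ModuleCat.{u} R) (hX : T X) :
    Subsingleton (Abelian.Ext (.of R (U ⧸ LinearMap.range c)) X 1) := by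
  have : Module.Finite R U := hTF.torsion_le _ hc.prop
  have : Module.Finite R X := hTF.torsion_le _ hX
  obtain ⟨k, i, hi⟩ := exists_embedding_dualRegular K (Λ := R) X
  let I := Fin k → DualRegular K R
  let q := (LinearMap.range i).mkQ
  have hiq : Function.Exact i q := LinearMap.exact_map_mkQ_range i
  refine subsingleton_ext_one_of_lift i q hi hiq (Submodule.mkQ_surjective _)
    inferInstance _ fun φ => ?_
  let π := (LinearMap.range c).mkQ
  -- P is the pullback of q and φ ∘ π, an extension of U by X and hence in T. The map (c, 0) from D
  -- to P factors through c, which gives G. By minimality pr ∘ G is invertible, so after correction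
  -- the second coordinate of G lifts φ ∘ π and vanishes on the range of c.
  let P : Submodule R (U × I) :=
    LinearMap.ker ((φ ∘ₗ π) ∘ₗ LinearMap.fst R U I - q ∘ₗ LinearMap.snd R U I)
  have hP (y : U × I) : y ∈ P ↔ φ (π y.1) = q y.2 := by
    rw [LinearMap.mem_ker, LinearMap.sub_apply, sub_eq_zero]; rfl
  have hqi (x : X) : q (i x) = 0 := hiq.apply_apply_eq_zero x
  have hπc (x : D) : π (c x) = 0 := (LinearMap.exact_map_mkQ_range c).apply_apply_eq_zero x
  let inX : X →ₗ[R] P := (LinearMap.inr R U I ∘ₗ i).codRestrict P fun x => by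
    rw [hP]
    change φ (π 0) = q (i x)
    rw [hqi, map_zero, map_zero]
  let pr : P →ₗ[R] U := LinearMap.fst R U I ∘ₗ P.subtype
  have hpr : Function.Surjective pr := by
    intro t
    obtain ⟨y, hy⟩ := Submodule.mkQ_surjective (LinearMap.range i) (φ (π t))
    exact ⟨⟨(t, y), (hP _).2 hy.symm⟩, rfl⟩
  have hex : Function.Exact inX pr := by
    rintro ⟨⟨t, y⟩, hy⟩
    constructor
    · intro ht
      have ht : t = 0 := ht
      subst ht
      have h1 : q y = 0 := by
        rw [← (hP _).1 hy]
        change φ (π 0) = 0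
        rw [map_zero, map_zero]
      obtain ⟨x, rfl⟩ := (hiq y).1 h1
      exact ⟨x, rfl⟩
    · rintro ⟨x, hx⟩
      rw [← hx]
      rfl
  have hE : T (.of R P) :=
    hTF.torsion_of_exact inX pr hex hpr (show Module.Finite R _ from inferInstance) hX hc.prop
  let cP : D →ₗ[R] P := (LinearMap.inl R U I ∘ₗ c).codRestrict P fun x => by
    rw [hP]
    change φ (π (c x)) = q 0
    rw [hπc, map_zero, map_zero]
  obtain ⟨G, hG⟩ := hc.exists_desc _ hE cP
  have hh : (pr ∘ₗ G) ∘ₗ c = c := by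
    ext x
    exact congrArg pr (DFunLike.congr_fun hG x)
  let e := LinearEquiv.ofBijective _ (hmin _ hh)
  have hec (x : D) : e.symm (c x) = c x := by
    rw [LinearEquiv.symm_apply_eq]
    exact (DFunLike.congr_fun hh x).symm
  let r : U →ₗ[R] I := LinearMap.snd R U I ∘ₗ P.subtype ∘ₗ G ∘ₗ e.symm.toLinearMap
  have hr (t : U) : q (r t) = φ (π t) := by
    have h1 := (hP _).1 (G (e.symm t)).2
    have h2 : (G (e.symm t) : U × I).1 = t := e.apply_symm_apply t
    rw [h2] at h1
    exact h1.symm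
  refine ⟨(LinearMap.range c).liftQ r ?_, ?_⟩
  · rintro _ ⟨x, rfl⟩
    change (G (e.symm (c x)) : U × I).2 = 0
    rw [hec]
    have h1 : G (c x) = cP x := DFunLike.congr_fun hG x
    rw [h1]
    rfl
  · refine Submodule.linearMap_qext _ ?_
    ext t
    exact hr t

variable {K Λ : Type u} [Field K] [Ring Λ] [Algebra K Λ] [Module.Finite K Λ]

theorem addOf_fst {R : Type u} [Ring R] (M N : ModuleCat.{u} R) : addOf (.of R (M × N)) M :=
  ⟨1, LinearMap.pi fun _ => LinearMap.inl R M N, LinearMap.fst R M N ∘ₗ LinearMap.proj 0, rfl⟩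

theorem addOf_snd {R : Type u} [Ring R] (M N : ModuleCat.{u} R) : addOf (.of R (M × N)) N :=
  ⟨1, LinearMap.pi fun _ => LinearMap.inr R M N, LinearMap.snd R M N ∘ₗ LinearMap.proj 0, rfl⟩

/-- A torsion pair whose torsion-free class contains the regular module is induced by a cotilting
module, provided that right approximations exist and injective dimensions are at most one. -/
theorem IsTorsionPair.isCotiltingInduced {T F : ObjectProperty (ModuleCat.{u} Λ)}
    (hTF : IsTorsionPair (finGen Λ) T F) (hΛ : F (.of Λ Λ))
    (happ : ∃ (U : ModuleCat.{u} Λ) (p : U →ₗ[Λ] DualRegular K Λ), IsRightApprox F p)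
    (hid : ∀ X, finGen Λ X → HasInjectiveDimensionLE X 1) : IsCotiltingInduced K T F := by
  have : IsArtinianRing Λ := isArtinian_of_tower K inferInstance
  have : IsNoetherianRing Λ := isNoetherian_of_tower K inferInstance
  obtain ⟨U₀, p, hp, hmin⟩ := hTF.exists_minimal_rightApprox happ
  -- Since Λ is in F, every map Λ → DΛ factors through p.
  have hsurj : Function.Surjective p := by
    intro y
    obtain ⟨h, hh⟩ := hp.exists_lift _ hΛ (LinearMap.toSpanSingleton Λ _ y)
    refine ⟨h (1 : Λ), (DFunLike.congr_fun hh (1 : Λ)).trans ?_⟩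
    exact one_smul Λ y
  let U₁ : ModuleCat.{u} Λ := .of Λ (LinearMap.ker p)
  have hfin₀ : Module.Finite Λ U₀ := hTF.free_le _ hp.prop
  have hfin₁ : Module.Finite Λ U₁ := inferInstanceAs (Module.Finite Λ (LinearMap.ker p))
  have hF₁ : F U₁ := hTF.free_of_injective (LinearMap.ker p).subtype Subtype.val_injective
    hfin₁ hp.prop
  have hfin : Module.Finite Λ (U₀ × U₁) := inferInstance
  have hF : F (.of Λ (U₀ × U₁)) := hTF.free_prod hfin hp.prop hF₁
  have hE₁ (X) (hX : F X) := hTF.subsingleton_ext_ker p hp hmin X hX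
  -- U₀ is an extension of the injective module DΛ by U₁, so it inherits Ext-injectivity from U₁.
  have hE₀ (X) (hX : F X) : Subsingleton (Abelian.Ext X U₀ 1) := by
    have : Injective (ModuleCat.of Λ (DualRegular K Λ)) :=
      (Module.injective_iff_injective_object _ _).1 inferInstance
    exact subsingleton_ext_mid_right (LinearMap.ker p).subtype p Subtype.val_injective
      (LinearMap.exact_subtype_ker_map p) hsurj X (hE₁ X hX)
      (Abelian.Ext.subsingleton_of_injective _ _ _)
  have hE (X) (hX : F X) : Subsingleton (Abelian.Ext X (.of Λ (U₀ × U₁)) 1) :=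
    subsingleton_ext_mid_right (LinearMap.inl Λ U₀ U₁) (LinearMap.snd Λ U₀ U₁)
      LinearMap.inl_injective .inl_snd Prod.snd_surjective X (hE₀ X hX) (hE₁ X hX)
  have hcogen (X : ModuleCat.{u} Λ) : F X ↔ cogenOf (.of Λ (U₀ × U₁)) X := by
    constructor
    · intro hX
      have : Module.Finite Λ X := hTF.free_le _ hX
      obtain ⟨k, i, hi⟩ := exists_embedding_dualRegular K (Λ := Λ) X
      -- An embedding of X into a power of DΛ lifts coordinatewise through p, and the lift into a
      -- power of U₀ stays injective.
      choose h hh using fun j => hp.exists_lift X hX (LinearMap.proj j ∘ₗ i)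
      refine ⟨k, LinearMap.pi fun j => LinearMap.inl Λ U₀ U₁ ∘ₗ h j, ?_⟩
      rw [injective_iff_map_eq_zero]
      intro x hx
      refine hi ((funext fun j => ?_).trans (map_zero i).symm)
      have h0 : h j x = 0 := congrArg Prod.fst (congrFun hx j)
      have h1 := DFunLike.congr_fun (hh j) x
      rw [LinearMap.comp_apply, h0, map_zero] at h1
      exact h1.symm
    · rintro ⟨k, i, hi⟩
      have : Module.Finite Λ X := Module.Finite.of_injective i hi
      exact hTF.free_of_injective i hi ‹_›
        (hTF.free_pi (show Module.Finite Λ _ from inferInstance) fun _ => hF)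
  refine ⟨.of Λ (U₀ × U₁), ⟨hfin, hid _ hfin, hE _ hF, U₀, U₁, addOf_fst _ _, addOf_snd _ _,
    (LinearMap.ker p).subtype, p, Subtype.val_injective, LinearMap.exact_subtype_ker_map p,
    hsurj⟩, fun X => ?_, hcogen⟩
  rw [hTF.torsion_iff]
  refine and_congr_right fun hX => ⟨fun h => h _ hF, fun h Y hY f => ?_⟩
  obtain ⟨k, i, hi⟩ := (hcogen Y).1 hY
  ext x
  refine hi ((funext fun j => ?_).trans (map_zero i).symm)
  exact DFunLike.congr_fun (h (LinearMap.proj j ∘ₗ i ∘ₗ f)) x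

/-- A torsion pair whose torsion class contains the dual of the regular module is induced by a
tilting module, provided that left approximations exist and projective dimensions are at most
one. -/
theorem IsTorsionPair.isTiltingInduced (K : Type u) {Λ : Type u} [Field K] [Ring Λ] [Algebra K Λ]
    [Module.Finite K Λ] {T F : ObjectProperty (ModuleCat.{u} Λ)}
    (hTF : IsTorsionPair (finGen Λ) T F) (hD : T (.of Λ (DualRegular K Λ)))
    (happ : ∃ (U : ModuleCat.{u} Λ) (c : Λ →ₗ[Λ] U), IsLeftApprox T c)
    (hpd : ∀ X, finGen Λ X → HasProjectiveDimensionLE X 1) : IsTiltingInduced T F := by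
  have : IsArtinianRing Λ := isArtinian_of_tower K inferInstance
  have : IsNoetherianRing Λ := isNoetherian_of_tower K inferInstance
  obtain ⟨U₀, c, hc, hmin⟩ := hTF.exists_minimal_leftApprox happ
  -- An embedding of Λ into a power of DΛ, which is torsion, factors through c.
  have hinj : Function.Injective c := by
    obtain ⟨k, i, hi⟩ := exists_embedding_dualRegular K (Λ := Λ) Λ
    obtain ⟨h, hh⟩ := hc.exists_desc (.of Λ (Fin k → DualRegular K Λ))
      (hTF.torsion_pi (show Module.Finite Λ _ from inferInstance) fun _ => hD) i
    have h1 : Function.Injective (h ∘ₗ c) := by rw [hh]; exact hi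
    exact Function.Injective.of_comp h1
  let U₁ : ModuleCat.{u} Λ := .of Λ (U₀ ⧸ LinearMap.range c)
  let q : U₀ →ₗ[Λ] U₁ := (LinearMap.range c).mkQ
  have hq : Function.Surjective q := Submodule.mkQ_surjective _
  have hfin₀ : Module.Finite Λ U₀ := hTF.torsion_le _ hc.prop
  have hfin₁ : Module.Finite Λ U₁ := Module.Finite.of_surjective q hq
  have hT₁ : T U₁ := hTF.torsion_of_surjective q hq hfin₁ hc.prop
  have hfin : Module.Finite Λ (U₀ × U₁) := inferInstance
  have hT : T (.of Λ (U₀ × U₁)) := hTF.torsion_prod hfin hc.prop hT₁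
  have hE₁ (X) (hX : T X) := hTF.subsingleton_ext_coker K c hc hmin X hX
  have hE₀ (X) (hX : T X) : Subsingleton (Abelian.Ext U₀ X 1) := by
    have : Projective (ModuleCat.of Λ Λ) := (IsProjective.iff_projective _).1 inferInstance
    exact subsingleton_ext_mid_left c q hinj (LinearMap.exact_map_mkQ_range c) hq X
      (Abelian.Ext.subsingleton_of_projective _ _ _) (hE₁ X hX)
  have hE (X) (hX : T X) : Subsingleton (Abelian.Ext (.of Λ (U₀ × U₁)) X 1) :=
    subsingleton_ext_mid_left (LinearMap.inl Λ U₀ U₁) (LinearMap.snd Λ U₀ U₁)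
      LinearMap.inl_injective .inl_snd Prod.snd_surjective X (hE₀ X hX) (hE₁ X hX)
  have hgen (X : ModuleCat.{u} Λ) : T X ↔ genOf (.of Λ (U₀ × U₁)) X := by
    constructor
    · intro hX
      have : Module.Finite Λ X := hTF.torsion_le _ hX
      obtain ⟨k, g, hg⟩ := Module.Finite.exists_fin' Λ X
      -- Each coordinate of a free cover of X factors through c, so X is already a quotient of a
      -- power of U₀.
      choose h hh using fun j => hc.exists_desc X hX (g ∘ₗ LinearMap.single Λ (fun _ => Λ) j)
      refine ⟨k, ∑ j, h j ∘ₗ LinearMap.fst Λ U₀ U₁ ∘ₗ LinearMap.proj j, fun x => ?_⟩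
      obtain ⟨y, rfl⟩ := hg x
      refine ⟨fun j => (c (y j), 0), ?_⟩
      conv_rhs => rw [← LinearMap.sum_single_apply (fun _ => Λ) y, map_sum]
      rw [LinearMap.sum_apply]
      exact Finset.sum_congr rfl fun j _ => DFunLike.congr_fun (hh j) (y j)
    · rintro ⟨k, g, hg⟩
      have : Module.Finite Λ X := Module.Finite.of_surjective g hg
      exact hTF.torsion_of_surjective g hg ‹_›
        (hTF.torsion_pi (show Module.Finite Λ _ from inferInstance) fun _ => hT)
  refine ⟨.of Λ (U₀ × U₁), ⟨hfin, hpd _ hfin, hE _ hT, U₀, U₁, addOf_fst _ _, addOf_snd _ _,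
    c, q, hinj, LinearMap.exact_map_mkQ_range c, hq⟩, hgen, fun X => ?_⟩
  rw [hTF.free_iff]
  refine and_congr_right fun hX => ⟨fun h => h _ hT, fun h Y hY f => ?_⟩
  obtain ⟨k, g, hg⟩ := (hgen Y).1 hY
  have h0 : f ∘ₗ g = 0 := LinearMap.pi_ext' fun j =>
    (h ((f ∘ₗ g) ∘ₗ LinearMap.single Λ (fun _ => U₀ × U₁) j)).trans (LinearMap.zero_comp _).symm
  ext x
  obtain ⟨y, rfl⟩ := hg x
  exact DFunLike.congr_fun h0 y

end Approximations

/-! ### The path algebra of the cyclic quiver, generated by the trivial paths and one shift. -/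

namespace CyclicQuiver

instance (n : ℕ) : CommRing (CyclicQuiver n) := inferInstanceAs (CommRing (ZMod n))

variable (K : Type u) [Field K] (n : ℕ) [NeZero n]

/-- The path algebra of the cyclic quiver. -/
abbrev Alg : Type u := PathAlgebra K (CyclicQuiver n)

variable {n} in
/-- The arrow starting at a given vertex. -/
def arrowFrom (v : CyclicQuiver n) : Quiver.Total (CyclicQuiver n) := ⟨v, v + 1, PLift.up rfl⟩

/-- The sum of all arrows of the cyclic quiver. -/
noncomputable def shift : Alg K n :=
  ∑ v : CyclicQuiver n, PathAlgebra.arrow K (arrowFrom v)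

variable {K n}

open PathAlgebra (vertex arrow)

theorem shift_mul_vertex (v : CyclicQuiver n) :
    shift K n * vertex K v = arrow K (arrowFrom v) := by
  rw [shift, Finset.sum_mul, Finset.sum_eq_single v]
  · exact PathAlgebra.arrow_mul_source K (arrowFrom v)
  · intro w _ hw
    rw [← PathAlgebra.arrow_mul_source, mul_assoc]
    exact (congrArg _ (PathAlgebra.vertex_mul_of_ne K hw)).trans (mul_zero _)
  · simp

theorem vertex_mul_shift (v : CyclicQuiver n) :
    vertex K (v + 1) * shift K n = shift K n * vertex K v := by
  rw [shift_mul_vertex, shift, Finset.mul_sum, Finset.sum_eq_single v]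
  · exact PathAlgebra.target_mul_arrow K (arrowFrom v)
  · intro w _ hw
    rw [← PathAlgebra.target_mul_arrow, ← mul_assoc]
    have h : v + 1 ≠ w + 1 := fun h => hw (add_right_cancel h).symm
    exact (congrArg (· * _) (PathAlgebra.vertex_mul_of_ne K h)).trans (zero_mul _)
  · simp

theorem arrow_eq (a : Quiver.Total (CyclicQuiver n)) :
    arrow K a = shift K n * vertex K a.left := by
  obtain ⟨v, w, ⟨h⟩⟩ := a
  have h' : w = v + 1 := h
  subst h'
  exact (shift_mul_vertex v).symm

/-- This commutation rule encodes the shape of the cycle: k shifts carry what is located at v to v +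
k. Together with the orthogonality of the idempotents it replaces computations with paths. -/
theorem vertex_mul_shift_pow (v : CyclicQuiver n) (k : ℕ) :
    vertex K (v + k) * shift K n ^ k = shift K n ^ k * vertex K v := by
  induction k with
  | zero => simp
  | succ k ih =>
    rw [pow_succ', ← mul_assoc, Nat.cast_succ, ← add_assoc, vertex_mul_shift, mul_assoc, ih,
      mul_assoc]

/-- Induction over the elements of the path algebra. -/
theorem alg_induction {P : Alg K n → Prop} (algebraMap : ∀ c, P (algebraMap K _ c))
    (vertex : ∀ v : CyclicQuiver n, P (vertex K v))
    (shift : P (shift K n))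
    (add : ∀ a b, P a → P b → P (a + b)) (mul : ∀ a b, P a → P b → P (a * b)) (a : Alg K n) :
    P a := by
  obtain ⟨x, rfl⟩ := RingQuot.mkAlgHom_surjective K (PathAlgebra.Rel K (CyclicQuiver n)) a
  induction x using FreeAlgebra.induction with
  | grade0 c =>
    rw [AlgHom.commutes]
    exact algebraMap c
  | grade1 x =>
    rcases x with v | a
    · exact vertex v
    · have h : arrow K a = _ := arrow_eq a
      change P (arrow K a)
      rw [h]
      exact mul _ _ shift (vertex _)
  | mul a b ha hb =>
    rw [map_mul]
    exact mul _ _ ha hb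
  | add a b ha hb =>
    rw [map_add]
    exact add _ _ ha hb

section Modules

variable {M N : Type*} [AddCommGroup M] [Module K M] [Module (Alg K n) M]
  [IsScalarTower K (Alg K n) M] [AddCommGroup N] [Module K N] [Module (Alg K n) N]
  [IsScalarTower K (Alg K n) N]

/-- A linear map which commutes with the trivial paths and the sum of the arrows is a
homomorphism of modules over the path algebra. -/
def mkHom (f : M →ₗ[K] N) (hv : ∀ (v : CyclicQuiver n) m, f (vertex K v • m) = vertex K v • f m)
    (hs : ∀ m, f (shift K n • m) = shift K n • f m) : M →ₗ[Alg K n] N where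
  toFun := f
  map_add' := f.map_add
  map_smul' a := by
    induction a using alg_induction with
    | algebraMap c => simp
    | vertex v => exact hv v
    | shift => exact hs
    | add a b ha hb => intro m; simp only [add_smul, map_add, ha, hb, RingHom.id_apply]
    | mul a b ha hb => intro m; simp only [mul_smul, ha, hb, RingHom.id_apply]

@[simp] theorem mkHom_apply (f : M →ₗ[K] N) (hv hs) (m : M) :
    mkHom (n := n) f hv hs m = f m := rfl

end Modules

end CyclicQuiver

/-! ### The uniserial modules and the maps into and out of them. -/

namespace CyclicQuiver

variable (K : Type u) [Field K] {n : ℕ} [NeZero n]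

open PathAlgebra (vertex arrow)

/-- The uniserial module with top `S i` and length `l`. It has a basis indexed by `Fin l`, the
`k`-th basis vector being located at the vertex `i + k`, and the arrows map the `k`-th basis
vector to the next one. -/
def Uni (_i : CyclicQuiver n) (l : ℕ) : Type u := Fin l → K

namespace Uni

variable (i : CyclicQuiver n) (l : ℕ)

instance : AddCommGroup (Uni K i l) := inferInstanceAs (AddCommGroup (Fin l → K))
instance : Module K (Uni K i l) := inferInstanceAs (Module K (Fin l → K))
instance : Module.Finite K (Uni K i l) := inferInstanceAs (Module.Finite K (Fin l → K))
instance : Subsingleton (Uni K i 0) := inferInstanceAs (Subsingleton (Fin 0 → K))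

/-- The action of the trivial path at `v`. -/
def vertexEnd (v : CyclicQuiver n) : Module.End K (Uni K i l) where
  toFun f k := if i + (k.1 : ℕ) = v then f k else 0
  map_add' f g := funext fun k => by
    change (if _ then f k + g k else 0) = (if _ then f k else 0) + (if _ then g k else 0)
    split_ifs <;> simp
  map_smul' c f := funext fun k => by
    change (if _ then c * f k else 0) = c * (if _ then f k else 0)
    split_ifs <;> simp

/-- The action of the sum of all arrows. -/
def shiftEnd : Module.End K (Uni K i l) where
  toFun f k := if 0 < k.1 then f ⟨k.1 - 1, by omega⟩ else 0
  map_add' f g := funext fun k => by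
    change (if _ then f _ + g _ else 0) = (if _ then f _ else 0) + (if _ then g _ else 0)
    split_ifs <;> simp
  map_smul' c f := funext fun k => by
    change (if _ then c * f _ else 0) = c * (if _ then f _ else 0)
    split_ifs <;> simp

theorem sum_vertexEnd : ∑ v, vertexEnd K i l v = 1 := by
  refine LinearMap.ext fun f => funext fun k => ?_
  rw [LinearMap.sum_apply]
  refine (Finset.sum_apply k _ _).trans ?_
  change ∑ v, (if i + (k.1 : ℕ) = v then f k else 0) = f k
  simp

/-- The structure map of the uniserial module. -/
noncomputable def toEnd : Alg K n →ₐ[K] Module.End K (Uni K i l) :=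
  PathAlgebra.lift (vertexEnd K i l) (fun a => shiftEnd K i l * vertexEnd K i l a.left)
    (fun v => LinearMap.ext fun f => funext fun k => by
      change (if _ then (if _ then f k else 0) else 0) = (if _ then f k else 0)
      split_ifs <;> rfl)
    (fun v w h => LinearMap.ext fun f => funext fun k => by
      change (if i + (k.1 : ℕ) = v then (if i + (k.1 : ℕ) = w then f k else 0) else 0) = 0
      split_ifs with h1 h2
      · exact absurd (h1.symm.trans h2) h
      · rfl
      · rfl)
    (sum_vertexEnd K i l)
    (fun a => LinearMap.ext fun f => funext fun k => by
      obtain ⟨v, w, ⟨h⟩⟩ := a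
      have h' : w = v + 1 := h
      subst h'
      change (if i + (k.1 : ℕ) = v + 1 then (if 0 < k.1 then
        (if i + ((k.1 - 1 : ℕ) : CyclicQuiver n) = v then f _ else 0) else 0) else 0) =
        (if 0 < k.1 then (if i + ((k.1 - 1 : ℕ) : CyclicQuiver n) = v then f _ else 0) else 0)
      split_ifs with h1 h2 h3 h4 h5
      · rfl
      · rfl
      · rfl
      · refine absurd ?_ h1
        rw [← h5, Nat.cast_sub h4]
        push_cast
        ring
      · rfl
      · rfl)
    (fun a => LinearMap.ext fun f => funext fun k => by
      change (if 0 < k.1 then (if _ then (if _ then f _ else 0) else 0) else 0) =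
        (if 0 < k.1 then (if _ then f _ else 0) else 0)
      split_ifs <;> rfl)

noncomputable instance : Module (Alg K n) (Uni K i l) :=
  Module.compHom _ (toEnd K i l).toRingHom

instance : IsScalarTower K (Alg K n) (Uni K i l) where
  smul_assoc c a m := by
    change toEnd K i l (c • a) m = c • toEnd K i l a m
    rw [map_smul, LinearMap.smul_apply]

variable {K i l}

theorem vertex_smul_apply (v : CyclicQuiver n) (f : Uni K i l) (k : Fin l) :
    (vertex K v • f) k = if i + (k.1 : ℕ) = v then f k else 0 := by
  change toEnd K i l (vertex K v) f k = _
  rw [toEnd, PathAlgebra.lift_vertex]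
  rfl

theorem shift_smul_apply (f : Uni K i l) (k : Fin l) :
    (shift K n • f) k = if 0 < k.1 then f ⟨k.1 - 1, by omega⟩ else 0 := by
  change toEnd K i l (shift K n) f k = _
  have : toEnd K i l (shift K n) = shiftEnd K i l := by
    rw [shift, map_sum, ← mul_one (shiftEnd K i l), ← sum_vertexEnd K i l, Finset.mul_sum]
    refine Finset.sum_congr rfl fun v _ => ?_
    rw [toEnd, PathAlgebra.lift_arrow]
    rfl
  rw [this]
  rfl

theorem shift_pow_smul_apply (j : ℕ) (f : Uni K i l) (k : Fin l) :
    (shift K n ^ j • f) k = if j ≤ k.1 then f ⟨k.1 - j, by omega⟩ else 0 := by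
  induction j generalizing k with
  | zero => simp
  | succ j ih =>
    rw [pow_succ', mul_smul, shift_smul_apply]
    by_cases h : 0 < k.1
    · rw [if_pos h, ih]
      by_cases h' : j ≤ k.1 - 1
      · rw [if_pos h', if_pos (by omega)]
        congr 2
        dsimp only
        omega
      · rw [if_neg h', if_neg (by omega)]
    · rw [if_neg h, if_neg (by omega)]

theorem shift_pow_smul_eq_zero (f : Uni K i l) : shift K n ^ l • f = 0 :=
  funext fun k => by
    rw [shift_pow_smul_apply, if_neg (by omega)]
    rfl

variable (K i l) in
/-- The generator of the uniserial module of length `l + 1`. -/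
def gen : Uni K i (l + 1) := fun k => if k = 0 then 1 else 0

theorem gen_apply (k : Fin (l + 1)) : gen K i l k = if k = 0 then 1 else 0 := rfl

theorem shift_pow_smul_gen_apply (j : ℕ) (k : Fin (l + 1)) :
    (shift K n ^ j • gen K i l) k = if k.1 = j then 1 else 0 := by
  rw [shift_pow_smul_apply]
  simp only [gen_apply, Fin.ext_iff, Fin.val_zero]
  split_ifs <;> first | rfl | omega

theorem vertex_smul_gen : vertex K i • gen K i l = gen K i l :=
  funext fun k => by
    rw [vertex_smul_apply, gen_apply]
    split_ifs with h1 h2 h3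
    · rfl
    · rfl
    · simp [h3] at h1
    · rfl

theorem eq_sum (f : Uni K i (l + 1)) :
    f = ∑ k : Fin (l + 1), f k • shift K n ^ k.1 • gen K i l := by
  funext j
  have : (∑ k : Fin (l + 1), f k • shift K n ^ k.1 • gen K i l) j =
      ∑ k : Fin (l + 1), (f k • shift K n ^ k.1 • gen K i l) j := Finset.sum_apply j _ _
  rw [this, Finset.sum_eq_single j]
  · change f j = f j * (shift K n ^ j.1 • gen K i l) j
    rw [shift_pow_smul_gen_apply, if_pos rfl, mul_one]
  · intro k _ hk
    change f k * (shift K n ^ k.1 • gen K i l) j = 0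
    rw [shift_pow_smul_gen_apply, if_neg fun h => hk (Fin.ext h.symm), mul_zero]
  · simp

/-- The coefficients of an element of a uniserial module. -/
def coeff (k : Fin l) : Uni K i l →ₗ[K] K where
  toFun f := f k
  map_add' _ _ := rfl
  map_smul' _ _ := rfl

section Maps

variable {M : Type*} [AddCommGroup M] [Module (Alg K n) M]

theorem vertex_smul_shift_pow_smul {x : M} (hx : vertex K i • x = x) (v : CyclicQuiver n) (k : ℕ) :
    vertex K v • shift K n ^ k • x = if i + (k : ℕ) = v then shift K n ^ k • x else 0 := by
  have h : shift K n ^ k • x = vertex K (i + k) • shift K n ^ k • x := by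
    rw [← mul_smul, vertex_mul_shift_pow, mul_smul, hx]
  split_ifs with hv
  · rw [← hv, ← h]
  · rw [h, ← mul_smul, PathAlgebra.vertex_mul_of_ne K (Ne.symm hv), zero_smul]

-- The shifts of the generator form a K-basis.
@[ext] theorem hom_ext {f g : Uni K i (l + 1) →ₗ[Alg K n] M} (h : f (gen K i l) = g (gen K i l)) :
    f = g := by
  let : Module K M := Module.compHom M (algebraMap K (Alg K n))
  have : IsScalarTower K (Alg K n) M := .of_algebraMap_smul fun _ _ => rfl
  have key (f : Uni K i (l + 1) →ₗ[Alg K n] M) (x) :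
      f x = ∑ k : Fin (l + 1), x k • shift K n ^ k.1 • f (gen K i l) := by
    conv_lhs => rw [eq_sum x, map_sum]
    refine Finset.sum_congr rfl fun k _ => ?_
    rw [LinearMap.map_smul_of_tower f (x k), map_smul]
  ext x
  rw [key f, key g, h]

/-- The last coefficient of a homomorphism into a uniserial module. -/
def lastCoeff : Uni K i (l + 1) →ₗ[K] K := coeff (Fin.last l)

theorem lastCoeff_apply (f : Uni K i (l + 1)) : lastCoeff f = f (Fin.last l) := rfl

/-- The socle is located at `i + l`. The condition is written as `v + 1 = i + length`, without
subtraction, to match the hypothesis of `colift`. -/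
theorem lastCoeff_vertex_smul (v : CyclicQuiver n) (f : Uni K i (l + 1)) :
    lastCoeff (vertex K v • f) =
      if v + 1 = i + ((l + 1 : ℕ) : CyclicQuiver n) then lastCoeff f else 0 := by
  rw [lastCoeff_apply, vertex_smul_apply]
  refine if_congr ?_ rfl rfl
  rw [Fin.val_last, Nat.cast_succ, ← add_assoc, add_left_inj]
  exact eq_comm

/-- Shifting l - k times moves the k-th coordinate to the last place. So the last coefficient plays
for maps into a uniserial the role that the generator plays for maps out of it. -/
theorem apply_eq_lastCoeff (f : Uni K i (l + 1)) (k : Fin (l + 1)) :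
    f k = lastCoeff (shift K n ^ (l - k.1) • f) := by
  have h := shift_pow_smul_apply (l - k.1) f (Fin.last l)
  rw [if_pos (by rw [Fin.val_last]; omega)] at h
  rw [lastCoeff_apply, h]
  congr 1
  refine Fin.ext ?_
  change k.1 = l - (l - k.1)
  omega

theorem hom_ext_last {f g : M →ₗ[Alg K n] Uni K i (l + 1)}
    (h : ∀ m, lastCoeff (f m) = lastCoeff (g m)) : f = g := by
  ext m
  funext k
  rw [apply_eq_lastCoeff (f m), apply_eq_lastCoeff (g m), ← map_smul, ← map_smul, h]

variable [Module K M] [IsScalarTower K (Alg K n) M]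

/-- The homomorphism out of a uniserial module given by the image of its generator. -/
noncomputable def desc (x : M) (hx : vertex K i • x = x) (hl : shift K n ^ l • x = 0) :
    Uni K i l →ₗ[Alg K n] M :=
  mkHom (∑ k : Fin l, (LinearMap.toSpanSingleton K M (shift K n ^ k.1 • x)) ∘ₗ coeff k)
    (fun v f => by
      rw [LinearMap.sum_apply, LinearMap.sum_apply, Finset.smul_sum]
      refine Finset.sum_congr rfl fun k _ => ?_
      change (vertex K v • f) k • shift K n ^ k.1 • x = vertex K v • f k • shift K n ^ k.1 • x
      rw [vertex_smul_apply, smul_comm (vertex K v), vertex_smul_shift_pow_smul hx]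
      split_ifs <;> simp)
    (fun f => by
      rw [LinearMap.sum_apply, LinearMap.sum_apply, Finset.smul_sum]
      change ∑ k : Fin l, (shift K n • f) k • shift K n ^ k.1 • x =
        ∑ k : Fin l, shift K n • f k • shift K n ^ k.1 • x
      cases l with
      | zero => simp
      | succ l =>
        rw [Fin.sum_univ_succ, Fin.sum_univ_castSucc]
        simp only [shift_smul_apply, Fin.val_zero, lt_irrefl, if_false, zero_smul, zero_add,
          Fin.val_succ, Nat.zero_lt_succ, if_true, Fin.val_castSucc, Fin.val_last]
        rw [smul_comm _ (f (Fin.last l)), ← mul_smul (shift K n), ← pow_succ', hl, smul_zero,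
          add_zero]
        refine Finset.sum_congr rfl fun k _ => ?_
        rw [smul_comm (shift K n), ← mul_smul (shift K n), ← pow_succ']
        rfl)

theorem desc_apply (x : M) (hx : vertex K i • x = x) (hl : shift K n ^ l • x = 0)
    (f : Uni K i l) : desc x hx hl f = ∑ k : Fin l, f k • shift K n ^ k.1 • x := by
  simp only [desc, mkHom_apply, LinearMap.sum_apply]
  rfl

@[simp] theorem desc_gen (x : M) (hx : vertex K i • x = x) (hl : shift K n ^ (l + 1) • x = 0) :
    desc x hx hl (gen K i l) = x := by
  rw [desc_apply, Finset.sum_eq_single 0]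
  · simp [gen_apply]
  · intro k _ hk
    simp [gen_apply, hk]
  · simp

/-- The homomorphism into a uniserial module given by the last coefficient. -/
noncomputable def colift (φ : M →ₗ[K] K)
    (hφ : ∀ (v : CyclicQuiver n) m, φ (vertex K v • m) = if v + 1 = i + (l : ℕ) then φ m else 0)
    (hl : ∀ m, φ (shift K n ^ l • m) = 0) : M →ₗ[Alg K n] Uni K i l :=
  mkHom (N := Uni K i l)
    -- The exponent l - 1 - k is the number of shifts from the k-th basis vector to the last one,
    -- where φ is read off.
    { toFun := fun m k => φ (shift K n ^ (l - 1 - k.1) • m)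
      map_add' := fun m m' => funext fun k => by
        rw [smul_add, map_add]
        rfl
      map_smul' := fun c m => funext fun k => by
        rw [smul_comm, map_smul]
        rfl }
    (fun v m => funext fun k => by
      rw [vertex_smul_apply]
      change φ (shift K n ^ (l - 1 - k.1) • vertex K v • m) =
        if _ then φ (shift K n ^ (l - 1 - k.1) • m) else 0
      rw [← mul_smul, ← vertex_mul_shift_pow, mul_smul, hφ]
      refine if_congr ?_ rfl rfl
      have h : (l : CyclicQuiver n) = k.1 + (l - 1 - k.1 : ℕ) + 1 := by
        rw [← Nat.cast_add, ← Nat.cast_succ]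
        congr 1
        omega
      rw [h]
      constructor
      · intro h1
        linear_combination -h1
      · intro h1
        linear_combination -h1)
    (fun m => funext fun k => by
      rw [shift_smul_apply]
      change φ (shift K n ^ (l - 1 - k.1) • shift K n • m) =
        if _ then φ (shift K n ^ (l - 1 - (k.1 - 1)) • m) else 0
      rw [← mul_smul, ← pow_succ]
      split_ifs with h
      · congr 3
        omega
      · rw [show l - 1 - k.1 + 1 = l by omega, hl])

theorem colift_apply (φ : M →ₗ[K] K) (hφ) (hl) (m : M) (k : Fin l) :
    colift (i := i) φ hφ hl m k = φ (shift K n ^ (l - 1 - k.1) • m) := rfl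

theorem lastCoeff_colift (φ : M →ₗ[K] K) (hφ) (hl) (m : M) :
    lastCoeff (colift (i := i) (l := l + 1) φ hφ hl m) = φ m := by
  rw [lastCoeff_apply, colift_apply]
  simp

end Maps

variable (K i)

/-- The inclusion of the `k`-th radical layer of a uniserial module. -/
noncomputable def incl (k l : ℕ) : Uni K (i + (k : CyclicQuiver n)) l →ₗ[Alg K n] Uni K i (k + l) :=
  mkHom (N := Uni K i (k + l))
    { toFun := fun f x => if h : k ≤ x.1 then f ⟨x.1 - k, by omega⟩ else 0
      map_add' := fun f g => funext fun x => by
        change (if h : _ then f _ + g _ else 0) = (if h : _ then f _ else 0) + (if h : _ then g _ else 0)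
        split_ifs <;> simp
      map_smul' := fun c f => funext fun x => by
        change (if h : _ then c * f _ else 0) = c * (if h : _ then f _ else 0)
        split_ifs <;> simp }
    (fun v f => funext fun x => by
      rw [vertex_smul_apply]
      change (if h : k ≤ x.1 then (vertex K v • f) ⟨x.1 - k, by omega⟩ else 0) =
        if _ then (if h : k ≤ x.1 then f ⟨x.1 - k, by omega⟩ else 0) else 0
      split_ifs with h1 h2 h2
      · rw [vertex_smul_apply, if_pos]
        rw [← h2, add_assoc, ← Nat.cast_add]
        congr 2
        exact Nat.add_sub_of_le h1
      · rw [vertex_smul_apply, if_neg]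
        refine fun h3 => h2 (h3 ▸ ?_)
        rw [add_assoc, ← Nat.cast_add]
        congr 2
        exact (Nat.add_sub_of_le h1).symm
      · rfl
      · rfl)
    (fun f => funext fun x => by
      rw [shift_smul_apply]
      change (if h : k ≤ x.1 then (shift K n • f) ⟨x.1 - k, by omega⟩ else 0) =
        if _ then (if h : k ≤ x.1 - 1 then f ⟨x.1 - 1 - k, by omega⟩ else 0) else 0
      split_ifs with h1 h2 h3 h3
      · rw [shift_smul_apply, if_pos (by dsimp only; omega)]
        congr 2
        dsimp only
        omega
      · rw [shift_smul_apply, if_neg (by dsimp only; omega)]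
      · rw [shift_smul_apply, if_neg (by dsimp only; omega)]
      · omega
      · rfl
      · rfl)

theorem incl_apply (k l : ℕ) (f : Uni K (i + (k : CyclicQuiver n)) l) (x : Fin (k + l)) :
    incl K i k l f x = if h : k ≤ x.1 then f ⟨x.1 - k, by omega⟩ else 0 := rfl

/-- The projection of a uniserial module onto a quotient. -/
noncomputable def proj (k l : ℕ) : Uni K i (k + l) →ₗ[Alg K n] Uni K i k :=
  mkHom (N := Uni K i k)
    { toFun := fun f x => f (Fin.castAdd l x)
      map_add' := fun _ _ => rfl
      map_smul' := fun _ _ => rfl }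
    (fun v f => funext fun x => by
      rw [vertex_smul_apply]
      exact vertex_smul_apply v f (Fin.castAdd l x))
    (fun f => funext fun x => by
      rw [shift_smul_apply]
      exact shift_smul_apply f (Fin.castAdd l x))

theorem proj_apply (k l : ℕ) (f : Uni K i (k + l)) (x : Fin k) :
    proj K i k l f x = f (Fin.castAdd l x) := rfl

theorem incl_injective (k l : ℕ) : Function.Injective (incl K i k l) := by
  rw [injective_iff_map_eq_zero]
  intro f hf
  funext x
  have := congrFun hf (Fin.natAdd k x)
  rw [incl_apply, dif_pos (by simp)] at this
  refine Eq.trans ?_ this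
  congr 1
  exact Fin.ext (by simp)

theorem proj_surjective (k l : ℕ) : Function.Surjective (proj K i k l) := fun f =>
  ⟨fun x => if h : x.1 < k then f ⟨x.1, h⟩ else 0, funext fun x => by
    exact dif_pos x.2⟩

theorem exact_incl_proj (k l : ℕ) : Function.Exact (incl K i k l) (proj K i k l) := by
  intro f
  constructor
  · intro h
    refine ⟨fun x => f (Fin.natAdd k x), funext fun x => ?_⟩
    refine (incl_apply K i k l _ x).trans ?_
    split_ifs with hx
    · congr 1
      exact Fin.ext (Nat.add_sub_of_le hx)
    · exact (congrFun h ⟨x.1, not_le.1 hx⟩).symm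
  · rintro ⟨g, rfl⟩
    funext x
    rw [proj_apply, incl_apply, dif_neg (by simp)]
    rfl

end Uni

end CyclicQuiver

/-! ### Nilpotent modules and their decomposition into uniserials. -/

namespace CyclicQuiver

variable {K : Type u} [Field K] {n : ℕ} [NeZero n]

open PathAlgebra (vertex arrow)

/-- Checked on generators: past a trivial path, the shift only changes the vertex. This one-sided
normality makes the left ideal generated by a power of the shift two-sided. -/
theorem exists_shift_mul_eq (a : Alg K n) : ∃ b, shift K n * a = b * shift K n := by
  induction a using alg_induction with
  | algebraMap c => exact ⟨_, (Algebra.commutes c _).symm⟩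
  | vertex v => exact ⟨_, (vertex_mul_shift v).symm⟩
  | shift => exact ⟨_, rfl⟩
  | add a b ha hb =>
    obtain ⟨a', ha⟩ := ha
    obtain ⟨b', hb⟩ := hb
    exact ⟨a' + b', by rw [mul_add, ha, hb, add_mul]⟩
  | mul a b ha hb =>
    obtain ⟨a', ha⟩ := ha
    obtain ⟨b', hb⟩ := hb
    exact ⟨a' * b', by rw [← mul_assoc, ha, mul_assoc, hb, mul_assoc]⟩

theorem exists_shift_pow_mul_eq (k : ℕ) (a : Alg K n) :
    ∃ b, shift K n ^ k * a = b * shift K n ^ k := by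
  induction k with
  | zero => exact ⟨a, by simp⟩
  | succ k ih =>
    obtain ⟨b, hb⟩ := ih
    obtain ⟨c, hc⟩ := exists_shift_mul_eq b
    exact ⟨c, by rw [pow_succ', mul_assoc, hb, ← mul_assoc, hc, mul_assoc]⟩

theorem exists_eq_mul_shift_of_mem_arrowIdeal {a : Alg K n}
    (ha : a ∈ PathAlgebra.arrowIdeal K (CyclicQuiver n)) : ∃ b, a = b * shift K n := by
  have hadd {x y : Alg K n} (hx : ∃ b, x = b * shift K n) (hy : ∃ b, y = b * shift K n) :
      ∃ b, x + y = b * shift K n := by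
    obtain ⟨b, rfl⟩ := hx
    obtain ⟨c, rfl⟩ := hy
    exact ⟨b + c, (add_mul _ _ _).symm⟩
  refine Submodule.mul_induction_on ha (fun x hx y _ => ?_) fun _ _ => hadd
  have hx' : ∃ b, x = b * shift K n := by
    refine Submodule.mul_induction_on hx (fun z _ w hw => ?_) fun _ _ => hadd
    have hw' : ∃ b, w = b * shift K n := by
      induction hw using Submodule.span_induction with
      | mem w hw =>
        obtain ⟨a, rfl⟩ := hw
        rw [arrow_eq]
        exact exists_shift_mul_eq _
      | zero => exact ⟨0, (zero_mul _).symm⟩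
      | add _ _ _ _ hx hy => exact hadd hx hy
      | smul c _ _ hx =>
        obtain ⟨b, rfl⟩ := hx
        exact ⟨c • b, (smul_mul_assoc _ _ _).symm⟩
    obtain ⟨b, rfl⟩ := hw'
    exact ⟨z * b, (mul_assoc _ _ _).symm⟩
  obtain ⟨b, rfl⟩ := hx'
  obtain ⟨c, hc⟩ := exists_shift_mul_eq y
  exact ⟨b * c, by rw [mul_assoc, hc, mul_assoc]⟩

/-- Normality collects the N factors of the shift on the right. Hence nilpotency under the arrow
ideal can be tested on a single power of the shift. -/
theorem exists_eq_mul_shift_pow_of_mem {N : ℕ} {a : Alg K n}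
    (ha : a ∈ PathAlgebra.arrowIdeal K (CyclicQuiver n) ^ N) : ∃ b, a = b * shift K n ^ N := by
  induction N generalizing a with
  | zero => exact ⟨a, by simp⟩
  | succ N ih =>
    rw [pow_succ] at ha
    refine Submodule.mul_induction_on ha (fun x hx y hy => ?_) ?_
    · obtain ⟨b, rfl⟩ := ih hx
      obtain ⟨c, rfl⟩ := exists_eq_mul_shift_of_mem_arrowIdeal hy
      obtain ⟨d, hd⟩ := exists_shift_pow_mul_eq N c
      exact ⟨b * d, by rw [← mul_assoc, mul_assoc b, hd, pow_succ, mul_assoc, mul_assoc,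
        mul_assoc]⟩
    · rintro _ _ ⟨b, rfl⟩ ⟨c, rfl⟩
      exact ⟨b + c, (add_mul _ _ _).symm⟩

theorem shift_mem_arrowIdeal : shift K n ∈ PathAlgebra.arrowIdeal K (CyclicQuiver n) := by
  have h : shift K n ∈ Submodule.span K (Set.range (arrow K (V := CyclicQuiver n))) :=
    Submodule.sum_mem _ fun v _ => Submodule.subset_span ⟨_, rfl⟩
  have := Submodule.mul_mem_mul (Submodule.mul_mem_mul
    (Submodule.mem_top (R := K) (x := (1 : Alg K n))) h)
    (Submodule.mem_top (R := K) (x := (1 : Alg K n)))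
  rwa [one_mul, mul_one] at this

section Ordinary

variable {M N : Type u} [AddCommGroup M] [Module (Alg K n) M] [AddCommGroup N]
  [Module (Alg K n) N]

theorem E_iff [Module K M] [IsScalarTower K (Alg K n) M] :
    E K n (.of _ M) ↔ Module.Finite K M ∧ ∃ N, ∀ m : M, shift K n ^ N • m = 0 := by
  let e : RestrictScalars K (Alg K n) M ≃ₗ[K] M :=
    { RestrictScalars.addEquiv K (Alg K n) M with
      map_smul' := fun c x => algebraMap_smul (Alg K n) c (RestrictScalars.addEquiv K (Alg K n) M x) }
  refine and_congr ⟨fun h => ?_, fun h => ?_⟩ ⟨fun ⟨N, hN⟩ => ⟨N, ?_⟩, fun ⟨N, hN⟩ => ⟨N, ?_⟩⟩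
  · have : Module.Finite K (RestrictScalars K (Alg K n) M) := h
    exact Module.Finite.equiv e
  · exact Module.Finite.equiv e.symm
  · exact hN _ (Submodule.pow_mem_pow _ shift_mem_arrowIdeal N)
  · intro a ha m
    obtain ⟨b, rfl⟩ := exists_eq_mul_shift_pow_of_mem ha
    exact (mul_smul b _ (m : M)).trans (by rw [hN, smul_zero])

theorem E_of_injective (f : M →ₗ[Alg K n] N) (hf : Function.Injective f) (h : E K n (.of _ N)) :
    E K n (.of _ M) := by
  let : Module K M := Module.compHom M (algebraMap K (Alg K n))
  have : IsScalarTower K (Alg K n) M := .of_algebraMap_smul fun _ _ => rfl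
  let : Module K N := Module.compHom N (algebraMap K (Alg K n))
  have : IsScalarTower K (Alg K n) N := .of_algebraMap_smul fun _ _ => rfl
  rw [E_iff] at h ⊢
  obtain ⟨_, k, hk⟩ := h
  exact ⟨Module.Finite.of_injective (f.restrictScalars K) hf, k, fun m => hf (by simp [hk])⟩

theorem E_of_surjective (f : M →ₗ[Alg K n] N) (hf : Function.Surjective f)
    (h : E K n (.of _ M)) : E K n (.of _ N) := by
  let : Module K M := Module.compHom M (algebraMap K (Alg K n))
  have : IsScalarTower K (Alg K n) M := .of_algebraMap_smul fun _ _ => rfl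
  let : Module K N := Module.compHom N (algebraMap K (Alg K n))
  have : IsScalarTower K (Alg K n) N := .of_algebraMap_smul fun _ _ => rfl
  rw [E_iff] at h ⊢
  obtain ⟨_, k, hk⟩ := h
  refine ⟨Module.Finite.of_surjective (f.restrictScalars K) hf, k, fun m => ?_⟩
  obtain ⟨m, rfl⟩ := hf m
  rw [← map_smul, hk, map_zero]

theorem E_prod (hM : E K n (.of _ M)) (hN : E K n (.of _ N)) : E K n (.of _ (M × N)) := by
  let : Module K M := Module.compHom M (algebraMap K (Alg K n))
  have : IsScalarTower K (Alg K n) M := .of_algebraMap_smul fun _ _ => rfl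
  let : Module K N := Module.compHom N (algebraMap K (Alg K n))
  have : IsScalarTower K (Alg K n) N := .of_algebraMap_smul fun _ _ => rfl
  rw [E_iff] at hM hN ⊢
  obtain ⟨_, k, hk⟩ := hM
  obtain ⟨_, l, hl⟩ := hN
  refine ⟨inferInstance, k + l, fun m => Prod.ext ?_ ?_⟩
  · change shift K n ^ (k + l) • m.1 = 0
    rw [add_comm, pow_add, mul_smul, hk, smul_zero]
  · change shift K n ^ (k + l) • m.2 = 0
    rw [pow_add, mul_smul, hl, smul_zero]

theorem E_pi {ι : Type} [Finite ι] {M : ι → Type u} [∀ j, AddCommGroup (M j)]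
    [∀ j, Module (Alg K n) (M j)] (h : ∀ j, E K n (.of _ (M j))) : E K n (.of _ (∀ j, M j)) := by
  cases nonempty_fintype ι
  let inst : ∀ j, Module K (M j) := fun j => Module.compHom (M j) (algebraMap K (Alg K n))
  have : ∀ j, IsScalarTower K (Alg K n) (M j) := fun j => .of_algebraMap_smul fun _ _ => rfl
  have : ∀ j, Module.Finite K (M j) := fun j => (E_iff.1 (h j)).1
  choose k hk using fun j => (E_iff.1 (h j)).2
  refine E_iff.2 ⟨inferInstance, ∑ j, k j, fun m => funext fun j => ?_⟩
  change shift K n ^ (∑ j, k j) • m j = 0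
  obtain ⟨c, hc⟩ := Nat.exists_eq_add_of_le
    (Finset.single_le_sum (f := k) (fun _ _ => Nat.zero_le _) (Finset.mem_univ j))
  rw [hc, add_comm, pow_add, mul_smul, hk, smul_zero]

theorem E_of_subsingleton [Subsingleton M] : E K n (.of _ M) := by
  let : Module K M := Module.compHom M (algebraMap K (Alg K n))
  have : IsScalarTower K (Alg K n) M := .of_algebraMap_smul fun _ _ => rfl
  exact E_iff.2 ⟨inferInstance, 0, fun _ => Subsingleton.elim _ _⟩

theorem E_uni (i : CyclicQuiver n) (l : ℕ) : E K n (.of _ (Uni K i l)) :=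
  E_iff.2 ⟨inferInstance, l, Uni.shift_pow_smul_eq_zero⟩

instance : (E K n).IsClosedUnderIsomorphisms where
  of_iso {X Y} e h := E_of_injective (M := Y) (N := X) e.symm.toLinearEquiv.toLinearMap
    e.symm.toLinearEquiv.injective h

theorem sum_vertex_smul (m : M) : ∑ v : CyclicQuiver n, vertex K v • m = m := by
  rw [← Finset.sum_smul, PathAlgebra.sum_vertex, one_smul]

end Ordinary

section Decomposition

variable {M : Type u} [AddCommGroup M] [Module (Alg K n) M]

/-- The last basis vector spans the socle: a nonzero x whose first nonzero coordinate is the k-th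
becomes, after l - k shifts, a nonzero multiple of it. So a map that does not kill this vector has
no kernel. -/
theorem Uni.injective_of_shift_pow_smul_ne_zero {i : CyclicQuiver n} {l : ℕ}
    (f : Uni K i (l + 1) →ₗ[Alg K n] M) (h : shift K n ^ l • f (Uni.gen K i l) ≠ 0) :
    Function.Injective f := by
  let : Module K M := Module.compHom M (algebraMap K (Alg K n))
  have : IsScalarTower K (Alg K n) M := .of_algebraMap_smul fun _ _ => rfl
  rw [injective_iff_map_eq_zero]
  intro x hx
  by_contra hne
  have hex : ∃ k : ℕ, ∃ hk : k < l + 1, x ⟨k, hk⟩ ≠ 0 := by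
    by_contra hcon
    push Not at hcon
    exact hne (funext fun k => hcon k.1 k.2)
  classical
  obtain ⟨hk, hxk⟩ := Nat.find_spec hex
  have hmin (j : ℕ) (hj : j < Nat.find hex) : x ⟨j, hj.trans hk⟩ = 0 := by
    have := Nat.find_min hex hj
    push Not at this
    exact this _
  set k := Nat.find hex
  have h1 : shift K n ^ (l - k) • x = x ⟨k, hk⟩ • shift K n ^ l • Uni.gen K i l := by
    funext j
    refine (Uni.shift_pow_smul_apply _ _ _).trans ?_
    change _ = x ⟨k, hk⟩ * (shift K n ^ l • Uni.gen K i l) j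
    rw [Uni.shift_pow_smul_gen_apply]
    split_ifs with h2 h3 h3
    · rw [mul_one]
      congr 1
      exact Fin.ext (by dsimp only; omega)
    · rw [mul_zero]
      refine hmin _ ?_
      omega
    · omega
    · rw [mul_zero]
  have h2 : f (shift K n ^ (l - k) • x) = 0 := by rw [map_smul, hx, smul_zero]
  rw [h1, LinearMap.map_smul_of_tower f, map_smul] at h2
  exact (smul_ne_zero hxk h) h2

/-- A uniserial submodule of maximal Loewy length splits off. -/
theorem exists_uni_retract [Nontrivial M] (hM : E K n (.of _ M)) :
    ∃ (i : CyclicQuiver n) (l : ℕ) (δ : Uni K i (l + 1) →ₗ[Alg K n] M)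
      (ρ : M →ₗ[Alg K n] Uni K i (l + 1)), ρ ∘ₗ δ = LinearMap.id := by
  let : Module K M := Module.compHom M (algebraMap K (Alg K n))
  have : IsScalarTower K (Alg K n) M := .of_algebraMap_smul fun _ _ => rfl
  obtain ⟨hfin, hN⟩ := E_iff.1 hM
  classical
  -- The least N with shift^N M = 0 is the Loewy length of M. It is positive because M is nonzero.
  obtain ⟨l, hl⟩ : ∃ l, Nat.find hN = l + 1 := by
    refine Nat.exists_eq_succ_of_ne_zero fun h0 => ?_
    obtain ⟨m, hm⟩ := exists_ne (0 : M)
    have := Nat.find_spec hN m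
    rw [h0, pow_zero, one_smul] at this
    exact hm this
  have hnil : ∀ m : M, shift K n ^ (l + 1) • m = 0 := hl ▸ Nat.find_spec hN
  have hex : ∃ m : M, shift K n ^ l • m ≠ 0 := by
    have := Nat.find_min hN (show l < Nat.find hN by omega)
    push Not at this
    exact this
  obtain ⟨m, hm⟩ := hex
  -- An element surviving l shifts has a component at some vertex that survives them too; this
  -- component generates a uniserial of full length.
  obtain ⟨i, hi⟩ : ∃ i : CyclicQuiver n, shift K n ^ l • vertex K i • m ≠ 0 := by
    by_contra hcon
    push Not at hcon
    apply hm
    rw [← sum_vertex_smul (K := K) (n := n) m, Finset.smul_sum]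
    exact Finset.sum_eq_zero fun v _ => hcon v
  set x := vertex K i • m with hxdef
  have hx : vertex K i • x = x := by rw [hxdef, ← mul_smul, PathAlgebra.vertex_mul_self]
  let δ : Uni K i (l + 1) →ₗ[Alg K n] M := Uni.desc x hx (hnil x)
  have hδ : Function.Injective δ :=
    Uni.injective_of_shift_pow_smul_ne_zero δ (by rwa [Uni.desc_gen])
  obtain ⟨r, hr⟩ := (δ.restrictScalars K).exists_leftInverse_of_injective
    (LinearMap.ker_eq_bot.2 hδ)
  have hrx (k : ℕ) : r (shift K n ^ k • x) = shift K n ^ k • Uni.gen K i l := by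
    have h1 : shift K n ^ k • x = δ (shift K n ^ k • Uni.gen K i l) := by
      rw [map_smul, Uni.desc_gen]
    rw [h1]
    exact DFunLike.congr_fun hr _
  -- A K-linear retraction of δ is not a homomorphism, but its last coefficient, cut down to the
  -- socle vertex i + l, is a functional to which `colift` applies. The nilpotency required there is
  -- the maximality of the Loewy length.
  let φ : M →ₗ[K] K := Uni.lastCoeff ∘ₗ r ∘ₗ (Algebra.lsmul K K M (vertex K (i + (l : CyclicQuiver n))))
  have hφ (m : M) : φ m = Uni.lastCoeff (r (vertex K (i + (l : CyclicQuiver n)) • m)) := rfl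
  have hφv (v : CyclicQuiver n) (m : M) :
      φ (vertex K v • m) = if v + 1 = i + ((l + 1 : ℕ) : CyclicQuiver n) then φ m else 0 := by
    rw [hφ, hφ, ← mul_smul, Nat.cast_succ, ← add_assoc]
    split_ifs with h
    · rw [add_right_cancel h, PathAlgebra.vertex_mul_self]
    · have hne : i + (l : CyclicQuiver n) ≠ v := fun h' => h (by rw [h'])
      rw [PathAlgebra.vertex_mul_of_ne K hne, zero_smul, map_zero, map_zero]
  let ρ : M →ₗ[Alg K n] Uni K i (l + 1) := Uni.colift φ hφv fun m => by rw [hnil, map_zero]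
  refine ⟨i, l, δ, ρ, ?_⟩
  refine Uni.hom_ext ?_
  rw [LinearMap.comp_apply, Uni.desc_gen, LinearMap.id_apply]
  funext k
  refine (Uni.colift_apply _ _ _ _ _).trans ?_
  rw [hφ, Uni.vertex_smul_shift_pow_smul hx, Uni.gen_apply]
  have hk := k.2
  split_ifs with h1 h2 h2
  · rw [hrx, Uni.lastCoeff_apply, Uni.shift_pow_smul_gen_apply, if_pos]
    rw [Fin.val_last, h2, Fin.val_zero]
    omega
  · rw [hrx, Uni.lastCoeff_apply, Uni.shift_pow_smul_gen_apply, if_neg]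
    rw [Fin.ext_iff, Fin.val_zero] at h2
    rw [Fin.val_last]
    omega
  · refine absurd ?_ h1
    rw [h2, Fin.val_zero]
    rfl
  · rw [map_zero, map_zero]

theorem exists_prod_equiv_of_retract {R : Type*} [Ring R] {M U : Type*} [AddCommGroup M]
    [Module R M] [AddCommGroup U] [Module R U] (δ : U →ₗ[R] M) (ρ : M →ₗ[R] U)
    (h : ρ ∘ₗ δ = LinearMap.id) : Nonempty ((U × LinearMap.ker ρ) ≃ₗ[R] M) := by
  have h' (u : U) : ρ (δ u) = u := DFunLike.congr_fun h u
  refine ⟨LinearEquiv.ofBijective (δ.coprod (LinearMap.ker ρ).subtype) ⟨?_, fun m => ?_⟩⟩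
  · rw [injective_iff_map_eq_zero]
    rintro ⟨u, k⟩ huk
    have huk : δ u + k = 0 := huk
    have h1 : u = 0 := by
      have := congrArg ρ huk
      rwa [map_add, h', k.2, add_zero, map_zero] at this
    subst h1
    rw [map_zero, zero_add] at huk
    exact Prod.ext rfl (Subtype.ext huk)
  · refine ⟨(ρ m, ⟨m - δ (ρ m), ?_⟩), ?_⟩
    · rw [LinearMap.mem_ker, map_sub, h', sub_self]
    · simp

/-- Every module in `E n` is a direct sum of uniserial modules. -/
theorem E_induction (P : ObjectProperty (ModuleCat.{u} (Alg K n))) [P.IsClosedUnderIsomorphisms]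
    (zero : ∀ M : ModuleCat.{u} (Alg K n), Subsingleton M → P M)
    (uni_prod : ∀ (i : CyclicQuiver n) (l : ℕ) (M : ModuleCat.{u} (Alg K n)), E K n M → P M →
      P (.of _ (Uni K i (l + 1) × M)))
    (M : ModuleCat.{u} (Alg K n)) (hM : E K n M) : P M := by
  open ModuleCat in
  induction hd : Module.finrank K M using Nat.strong_induction_on generalizing M with
  | _ d ih =>
  rcases subsingleton_or_nontrivial M with h | h
  · exact zero M h
  obtain ⟨i, l, δ, ρ, hδρ⟩ := exists_uni_retract hM
  obtain ⟨e⟩ := exists_prod_equiv_of_retract δ ρ hδρ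
  have hker : E K n (.of _ (LinearMap.ker ρ)) :=
    E_of_injective (LinearMap.ker ρ).subtype Subtype.val_injective hM
  have hfin : Module.Finite K M := (E_iff.1 hM).1
  refine P.prop_of_linearEquiv e (uni_prod i l (.of _ (LinearMap.ker ρ)) hker ?_)
  refine ih _ ?_ (.of _ (LinearMap.ker ρ)) hker rfl
  rw [← hd]
  refine Submodule.finrank_lt (s := (LinearMap.ker ρ).restrictScalars K) fun htop => ?_
  have h0 : ρ (δ (Uni.gen K i l)) = 0 := by
    have : δ (Uni.gen K i l) ∈ (LinearMap.ker ρ).restrictScalars K := htop ▸ Submodule.mem_top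
    exact this
  have h1 : Uni.gen K i l = 0 := (DFunLike.congr_fun hδρ _).symm.trans h0
  have h2 := congrFun h1 0
  rw [Uni.gen_apply, if_pos rfl] at h2
  exact one_ne_zero h2

end Decomposition

end CyclicQuiver

/-- The isomorphism and its inverse are block triangular, so their diagonal blocks are inverse to
each other. Uniqueness of the summands thus follows from Hom-orthogonality, without the
Krull–Schmidt theorem. -/
theorem nonempty_linearEquiv_of_prod {R : Type*} [Ring R] {M₁ M₂ N₁ N₂ : Type*}
    [AddCommGroup M₁] [Module R M₁] [AddCommGroup M₂] [Module R M₂] [AddCommGroup N₁]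
    [Module R N₁] [AddCommGroup N₂] [Module R N₂] (e : (M₁ × M₂) ≃ₗ[R] (N₁ × N₂))
    (h : ∀ f : M₁ →ₗ[R] N₂, f = 0) (h' : ∀ f : N₁ →ₗ[R] M₂, f = 0) :
    Nonempty (M₁ ≃ₗ[R] N₁) ∧ Nonempty (M₂ ≃ₗ[R] N₂) := by
  have h1 (m : M₁) : (e (m, 0)).2 = 0 :=
    DFunLike.congr_fun (h (LinearMap.snd R N₁ N₂ ∘ₗ e.toLinearMap ∘ₗ LinearMap.inl R M₁ M₂)) m
  have h2 (m : N₁) : (e.symm (m, 0)).2 = 0 :=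
    DFunLike.congr_fun
      (h' (LinearMap.snd R M₁ M₂ ∘ₗ e.symm.toLinearMap ∘ₗ LinearMap.inl R N₁ N₂)) m
  have h3 (m : M₁) : e (m, 0) = ((e (m, 0)).1, 0) := Prod.ext rfl (h1 m)
  have h4 (m : N₁) : e.symm (m, 0) = ((e.symm (m, 0)).1, 0) := Prod.ext rfl (h2 m)
  have h5 (x : M₁ × M₂) : (e.symm (0, (e x).2)).2 = x.2 := by
    have h6 : ((0 : N₁), (e x).2) = e x - ((e x).1, 0) := by ext <;> simp
    rw [h6, map_sub, e.symm_apply_apply, Prod.snd_sub, h2, sub_zero]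
  have h7 (x : N₁ × N₂) : (e (0, (e.symm x).2)).2 = x.2 := by
    have h6 : ((0 : M₁), (e.symm x).2) = e.symm x - ((e.symm x).1, 0) := by ext <;> simp
    rw [h6, map_sub, e.apply_symm_apply, Prod.snd_sub, h1, sub_zero]
  refine ⟨⟨LinearEquiv.ofLinearMap
    (LinearMap.fst R N₁ N₂ ∘ₗ e.toLinearMap ∘ₗ LinearMap.inl R M₁ M₂)
    (LinearMap.fst R M₁ M₂ ∘ₗ e.symm.toLinearMap ∘ₗ LinearMap.inl R N₁ N₂) ?_ ?_⟩,
    ⟨LinearEquiv.ofLinearMap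
    (LinearMap.snd R N₁ N₂ ∘ₗ e.toLinearMap ∘ₗ LinearMap.inr R M₁ M₂)
    (LinearMap.snd R M₁ M₂ ∘ₗ e.symm.toLinearMap ∘ₗ LinearMap.inr R N₁ N₂) ?_ ?_⟩⟩
  · ext m
    change (e ((e.symm (m, 0)).1, 0)).1 = m
    rw [← h4, e.apply_symm_apply]
  · ext m
    change (e.symm ((e (m, 0)).1, 0)).1 = m
    rw [← h3, e.symm_apply_apply]
  · ext m
    exact h7 (0, m)
  · ext m
    exact h5 (0, m)

/-! ### Modules vanishing on Δ, and descriptions of Coray(Δ) and Ray(Δ) free of tops and socles. -/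

namespace CyclicQuiver

variable (K : Type u) [Field K] {n : ℕ} [NeZero n] (Δ : Finset (CyclicQuiver n))

open PathAlgebra (vertex arrow)

/-- The module `M` has no composition factors `S v` with `v ∈ Δ`. -/
def VanishesOn (M : Type u) [AddCommGroup M] [Module (Alg K n) M] : Prop :=
  ∀ v ∈ Δ, ∀ m : M, vertex K v • m = 0

/-- The submodule generated by the part of `M` located at the vertices in `Δ`. -/
noncomputable def genSub (M : Type u) [AddCommGroup M] [Module (Alg K n) M] : Submodule (Alg K n) M :=
  Submodule.span _ {x | ∃ v ∈ Δ, vertex K v • x = x}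

/-- The largest submodule of `M` which vanishes on `Δ`. -/
noncomputable def annSub (M : Type u) [AddCommGroup M] [Module (Alg K n) M] : Submodule (Alg K n) M where
  carrier := {x | ∀ b : Alg K n, ∀ v ∈ Δ, vertex K v • b • x = 0}
  zero_mem' := by simp
  add_mem' {x y} hx hy b v hv := by rw [smul_add, smul_add, hx b v hv, hy b v hv, add_zero]
  smul_mem' c x hx b v hv := by
    rw [← mul_smul b]
    exact hx _ v hv

variable {K Δ}
variable {M N : Type u} [AddCommGroup M] [Module (Alg K n) M] [AddCommGroup N]
  [Module (Alg K n) N]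

theorem VanishesOn.of_injective (h : VanishesOn K Δ N) (f : M →ₗ[Alg K n] N)
    (hf : Function.Injective f) : VanishesOn K Δ M := fun v hv m =>
  hf (by rw [map_smul, h v hv, map_zero])

theorem VanishesOn.of_surjective (h : VanishesOn K Δ M) (f : M →ₗ[Alg K n] N)
    (hf : Function.Surjective f) : VanishesOn K Δ N := fun v hv m => by
  obtain ⟨m, rfl⟩ := hf m
  rw [← map_smul, h v hv, map_zero]

theorem VanishesOn.of_exact {L : Type u} [AddCommGroup L] [Module (Alg K n) L]
    (f : L →ₗ[Alg K n] M) (g : M →ₗ[Alg K n] N) (hfg : Function.Exact f g)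
    (hL : VanishesOn K Δ L) (hN : VanishesOn K Δ N) : VanishesOn K Δ M := fun v hv m => by
  obtain ⟨x, hx⟩ := (hfg (vertex K v • m)).1 (by rw [map_smul, hN v hv])
  rw [← PathAlgebra.vertex_mul_self, mul_smul, ← hx, ← map_smul, hL v hv, map_zero]

theorem VanishesOn.prod (hM : VanishesOn K Δ M) (hN : VanishesOn K Δ N) :
    VanishesOn K Δ (M × N) := fun v hv _ => Prod.ext (hM v hv _) (hN v hv _)

theorem vanishesOn_quotient_genSub : VanishesOn K Δ (M ⧸ genSub K Δ M) := by
  intro v hv m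
  obtain ⟨m, rfl⟩ := Submodule.mkQ_surjective _ m
  rw [← map_smul]
  refine (Submodule.Quotient.mk_eq_zero _).2 (Submodule.subset_span ⟨v, hv, ?_⟩)
  rw [← mul_smul, PathAlgebra.vertex_mul_self]

theorem vanishesOn_annSub : VanishesOn K Δ (annSub K Δ M) := fun v hv m =>
  Subtype.ext (by simpa using m.2 1 v hv)

theorem annSub_eq_top (h : VanishesOn K Δ M) : annSub K Δ M = ⊤ :=
  eq_top_iff.2 fun _ _ _ v hv => h v hv _

theorem map_genSub_le (f : M →ₗ[Alg K n] N) : (genSub K Δ M).map f ≤ genSub K Δ N := by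
  rw [genSub, Submodule.map_span, Submodule.span_le]
  rintro _ ⟨x, ⟨v, hv, hx⟩, rfl⟩
  exact Submodule.subset_span ⟨v, hv, by rw [← map_smul, hx]⟩

theorem genSub_eq_top_of_surjective (f : M →ₗ[Alg K n] N) (hf : Function.Surjective f)
    (h : genSub K Δ M = ⊤) : genSub K Δ N = ⊤ := by
  have := map_genSub_le (Δ := Δ) f
  rwa [h, Submodule.map_top, LinearMap.range_eq_top.2 hf, top_le_iff] at this

theorem annSub_le_comap (f : M →ₗ[Alg K n] N) : annSub K Δ M ≤ (annSub K Δ N).comap f :=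
  fun x hx b v hv => by rw [← map_smul, ← map_smul, hx b v hv, map_zero]

/-- A generator located at a vertex of Δ goes to an element located there, and N has no nonzero
ones. This is the orthogonality of Coray(Δ) to the modules over Λ_Δ. -/
theorem hom_eq_zero_of_genSub_eq_top (hM : genSub K Δ M = ⊤) (hN : VanishesOn K Δ N)
    (f : M →ₗ[Alg K n] N) : f = 0 := by
  have h : genSub K Δ M ≤ LinearMap.ker f := by
    rw [genSub, Submodule.span_le]
    rintro x ⟨v, hv, hx⟩
    change f x = 0
    rw [← hx, map_smul, hN v hv]
  rw [hM, top_le_iff] at h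
  exact LinearMap.ker_eq_top.1 h

theorem hom_eq_zero_of_annSub_eq_bot (hM : VanishesOn K Δ M) (hN : annSub K Δ N = ⊥)
    (f : M →ₗ[Alg K n] N) : f = 0 := by
  ext x
  have h : f x ∈ annSub K Δ N := annSub_le_comap f (annSub_eq_top hM ▸ Submodule.mem_top)
  rwa [hN] at h

theorem genSub_prod_eq_top (hM : genSub K Δ M = ⊤) (hN : genSub K Δ N = ⊤) :
    genSub K Δ (M × N) = ⊤ := by
  rw [eq_top_iff]
  rintro ⟨x, y⟩ -
  have hx : LinearMap.inl (Alg K n) M N x ∈ genSub K Δ (M × N) :=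
    map_genSub_le _ (Submodule.mem_map_of_mem (hM ▸ Submodule.mem_top))
  have hy : LinearMap.inr (Alg K n) M N y ∈ genSub K Δ (M × N) :=
    map_genSub_le _ (Submodule.mem_map_of_mem (hN ▸ Submodule.mem_top))
  have := add_mem hx hy
  simpa using this

theorem annSub_prod_eq_bot (hM : annSub K Δ M = ⊥) (hN : annSub K Δ N = ⊥) :
    annSub K Δ (M × N) = ⊥ := by
  rw [eq_bot_iff]
  rintro ⟨x, y⟩ h
  have hx := annSub_le_comap (LinearMap.fst (Alg K n) M N) h
  have hy := annSub_le_comap (LinearMap.snd (Alg K n) M N) h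
  rw [hM] at hx
  rw [hN] at hy
  exact Prod.ext hx hy

section Semisimple

/-- If shift • m were nonzero, it would generate m. Iterating this, with the shifts moved to the
right by normality, puts m into the left multiples of shift^N • m = 0. -/
theorem shift_smul_eq_zero_of_isSimpleModule [IsSimpleModule (Alg K n) M]
    (h : ∃ N, ∀ m : M, shift K n ^ N • m = 0) (m : M) : shift K n • m = 0 := by
  by_contra hne
  obtain ⟨b, hb⟩ := IsSimpleModule.toSpanSingleton_surjective (Alg K n) hne m
  have hb : b • shift K n • m = m := hb
  have key (k : ℕ) : ∃ c : Alg K n, c • shift K n ^ k • m = m := by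
    induction k with
    | zero => exact ⟨1, by simp⟩
    | succ k ih =>
      obtain ⟨c, hc⟩ := ih
      obtain ⟨d, hd⟩ := exists_shift_mul_eq c
      refine ⟨b * d, ?_⟩
      rw [mul_smul, pow_succ', mul_smul, ← mul_smul d, ← hd, mul_smul (shift K n), hc, hb]
  obtain ⟨N, hN⟩ := h
  obtain ⟨c, hc⟩ := key N
  rw [hN, smul_zero] at hc
  rw [← hc, smul_zero] at hne
  exact hne rfl

/-- With the shift acting as zero, only scalars and orthogonal idempotents act, and these commute.
-/
theorem vertex_smul_smul_comm (h : ∀ m : M, shift K n • m = 0) (v : CyclicQuiver n)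
    (a : Alg K n) (m : M) : vertex K v • a • m = a • vertex K v • m := by
  induction a using alg_induction generalizing m with
  | algebraMap c => rw [← mul_smul, ← mul_smul, Algebra.commutes]
  | vertex w =>
    rw [← mul_smul, ← mul_smul]
    by_cases hvw : v = w
    · rw [hvw]
    · rw [PathAlgebra.vertex_mul_of_ne K hvw, PathAlgebra.vertex_mul_of_ne K (Ne.symm hvw)]
  | shift => rw [h, h, smul_zero]
  | add a b ha hb => rw [add_smul, smul_add, ha, hb, add_smul]
  | mul a b ha hb => rw [mul_smul, ha, hb, mul_smul]

theorem simpleModule_vertex_smul (v w : CyclicQuiver n) (x : PathAlgebra.simpleModule K v) :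
    vertex K w • x = if w = v then x else 0 := by
  change PathAlgebra.simpleHom K v (vertex K w) * (show K from x) = _
  rw [PathAlgebra.simpleHom, PathAlgebra.lift_vertex]
  split_ifs
  · exact one_mul (show K from x)
  · exact zero_mul (show K from x)

theorem simpleModule_shift_smul (v : CyclicQuiver n) (x : PathAlgebra.simpleModule K v) :
    shift K n • x = 0 := by
  change PathAlgebra.simpleHom K v (shift K n) * (show K from x) = 0
  have : PathAlgebra.simpleHom K v (shift K n) = 0 := by
    rw [shift, map_sum]
    refine Finset.sum_eq_zero fun w _ => ?_
    rw [PathAlgebra.simpleHom, PathAlgebra.lift_arrow]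
  rw [this, zero_mul]

theorem vanishesOn_compl_of_addOf (h : addOf (PathAlgebra.simplesAt K Δ) (.of _ M)) :
    VanishesOn K Δᶜ M := by
  intro v hv m
  refine smul_eq_zero_of_addOf h (fun x => funext fun w => ?_) m
  refine (simpleModule_vertex_smul w.1 v _).trans (if_neg ?_)
  rintro rfl
  exact Finset.mem_compl.1 hv w.2

/-- With a K-basis b of M, the coordinates of the vertex components of m give a map into a power of
the sum of simples, indexed by b. Sending the w-coordinate in place j to the w-component of b j is a
retraction, because the idempotents at the vertices of Δ sum to the identity of M. -/
theorem addOf_simplesAt [Module K M] [IsScalarTower K (Alg K n) M] [Module.Finite K M]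
    (hs : ∀ m : M, shift K n • m = 0) (h : VanishesOn K Δᶜ M) :
    addOf (PathAlgebra.simplesAt K Δ) (.of _ M) := by
  let b := Module.finBasis K M
  let S := PathAlgebra.simplesAt K Δ
  let instS : Module K S := inferInstanceAs (Module K ({v // v ∈ Δ} → K))
  have towerS : IsScalarTower K (Alg K n) S := .of_algebraMap_smul fun c x => funext fun v => by
    change PathAlgebra.simpleHom K v.1 (algebraMap K _ c) * (show K from x v) = _
    rw [AlgHom.commutes]
    rfl
  have hvS (v : CyclicQuiver n) (x : S) (w) : (vertex K v • x) w = if v = w.1 then x w else 0 :=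
    simpleModule_vertex_smul w.1 v (x w)
  have hsS (x : S) : shift K n • x = 0 := funext fun w => simpleModule_shift_smul w.1 (x w)
  let i : M →ₗ[Alg K n] (Fin (Module.finrank K M) → S) :=
    mkHom { toFun := fun m j w => b.repr (vertex K w.1 • m) j
            map_add' := fun x y => funext fun j => funext fun w => by
              rw [smul_add, map_add]
              rfl
            map_smul' := fun c x => funext fun j => funext fun w => by
              rw [smul_comm, map_smul]
              rfl }
      (fun v m => funext fun j => funext fun w => by
        refine Eq.trans ?_ (hvS v _ w).symm
        change b.repr (vertex K w.1 • vertex K v • m) j =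
          if v = w.1 then b.repr (vertex K w.1 • m) j else (0 : K)
        by_cases hvw : v = w.1
        · rw [if_pos hvw, hvw, ← mul_smul, PathAlgebra.vertex_mul_self]
        · rw [if_neg hvw, ← mul_smul, PathAlgebra.vertex_mul_of_ne K (Ne.symm hvw), zero_smul, map_zero]
          rfl)
      (fun m => funext fun j => by
        refine Eq.trans ?_ (hsS _).symm
        funext w
        change b.repr (vertex K w.1 • shift K n • m) j = 0
        rw [hs, smul_zero, map_zero]
        rfl)
  let q : S →ₗ[K] (({v // v ∈ Δ}) → K) := LinearMap.id
  let p₀ (j : Fin (Module.finrank K M)) : S →ₗ[Alg K n] M :=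
    mkHom ((∑ w : {v // v ∈ Δ}, (LinearMap.toSpanSingleton K M (vertex K w.1 • b j)) ∘ₗ
        (LinearMap.proj w)) ∘ₗ q)
      (fun v x => by
        rw [LinearMap.comp_apply, LinearMap.comp_apply, LinearMap.sum_apply, LinearMap.sum_apply,
          Finset.smul_sum]
        refine Finset.sum_congr rfl fun w _ => ?_
        change (show K from (vertex K v • x) w) • vertex K w.1 • b j =
          vertex K v • (show K from x w) • vertex K w.1 • b j
        rw [hvS, smul_comm (vertex K v), ← mul_smul (vertex K v)]
        by_cases hvw : v = w.1
        · rw [if_pos hvw, hvw, PathAlgebra.vertex_mul_self]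
        · rw [if_neg hvw, PathAlgebra.vertex_mul_of_ne K hvw, zero_smul, smul_zero]
          exact zero_smul K _)
      (fun x => by
        rw [hsS, map_zero, hs])
  have hp₀ (j) (x : S) : p₀ j x = ∑ w : {v // v ∈ Δ}, (show K from x w) • vertex K w.1 • b j := by
    change ((∑ w : {v // v ∈ Δ}, (LinearMap.toSpanSingleton K M (vertex K w.1 • b j)) ∘ₗ
        (LinearMap.proj w)) ∘ₗ q) x = _
    rw [LinearMap.comp_apply, LinearMap.sum_apply]
    rfl
  refine ⟨_, i, ∑ j, p₀ j ∘ₗ LinearMap.proj j, ?_⟩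
  ext m
  rw [LinearMap.comp_apply, LinearMap.sum_apply]
  simp only [LinearMap.comp_apply, LinearMap.proj_apply, hp₀]
  change ∑ j, ∑ w : {v // v ∈ Δ}, b.repr (vertex K w.1 • m) j • vertex K w.1 • b j = m
  rw [Finset.sum_comm]
  have h1 (w : {v // v ∈ Δ}) :
      ∑ j, b.repr (vertex K w.1 • m) j • vertex K w.1 • b j = vertex K w.1 • m := by
    simp only [smul_comm _ (vertex K w.1)]
    rw [← Finset.smul_sum, b.sum_repr, ← mul_smul, PathAlgebra.vertex_mul_self]
  rw [Finset.sum_congr rfl fun w _ => h1 w]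
  conv_rhs => rw [← sum_vertex_smul (K := K) (n := n) m]
  rw [← Finset.sum_subset (Finset.subset_univ Δ)
    fun v _ hv => h v (Finset.mem_compl.2 hv) m]
  exact Finset.sum_coe_sort Δ fun v => vertex K v • m

end Semisimple

theorem isNoetherian_of_E (h : E K n (.of _ M)) : IsNoetherian (Alg K n) M := by
  let : Module K M := Module.compHom M (algebraMap K (Alg K n))
  have : IsScalarTower K (Alg K n) M := .of_algebraMap_smul fun _ _ => rfl
  have := (E_iff.1 h).1
  exact isNoetherian_of_tower K inferInstance

theorem isArtinian_of_E (h : E K n (.of _ M)) : IsArtinian (Alg K n) M := by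
  let : Module K M := Module.compHom M (algebraMap K (Alg K n))
  have : IsScalarTower K (Alg K n) M := .of_algebraMap_smul fun _ _ => rfl
  have := (E_iff.1 h).1
  exact isArtinian_of_tower K inferInstance

/-- If the submodule generated at Δ were proper, it would lie in a maximal submodule. That one
contains the radical, hence also all components outside Δ, where the top vanishes, and so it would
be everything. Conversely the top is killed by the shift, so its part outside Δ cannot come from
generators at Δ. -/
theorem coray_iff : Coray K Δ (.of _ M) ↔ E K n (.of _ M) ∧ genSub K Δ M = ⊤ := by
  refine and_congr_right fun hM => ⟨fun h => ?_, fun h => ?_⟩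
  · by_contra hne
    have := isNoetherian_of_E hM
    obtain ⟨N, hN, hle⟩ := (eq_top_or_exists_le_coatom _).resolve_left hne
    have hjac : Module.jacobson (Alg K n) M ≤ N := sInf_le hN
    have hv := vanishesOn_compl_of_addOf h
    refine hN.1 (eq_top_iff.2 fun x _ => ?_)
    rw [← sum_vertex_smul (K := K) (n := n) x]
    refine sum_mem fun v _ => ?_
    by_cases hvΔ : v ∈ Δ
    · refine hle (Submodule.subset_span ⟨v, hvΔ, ?_⟩)
      rw [← mul_smul, PathAlgebra.vertex_mul_self]
    · refine hjac ((Submodule.Quotient.mk_eq_zero _).1 ?_)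
      exact hv v (Finset.mem_compl.2 hvΔ) (Submodule.Quotient.mk x)
  · have hX := E_of_surjective (Module.jacobson (Alg K n) M).mkQ (Submodule.mkQ_surjective _) hM
    let : Module K (M ⧸ Module.jacobson (Alg K n) M) :=
      Module.compHom _ (algebraMap K (Alg K n))
    have : IsScalarTower K (Alg K n) (M ⧸ Module.jacobson (Alg K n) M) :=
      .of_algebraMap_smul fun _ _ => rfl
    have := (E_iff.1 hX).1
    have hs (m : M ⧸ Module.jacobson (Alg K n) M) : shift K n • m = 0 := by
      obtain ⟨x, rfl⟩ := Submodule.mkQ_surjective _ m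
      rw [← map_smul]
      refine (Submodule.Quotient.mk_eq_zero _).2 ?_
      rw [Module.jacobson, Submodule.mem_sInf]
      intro N hN
      have : IsSimpleModule (Alg K n) (M ⧸ N) := isSimpleModule_iff_isCoatom.2 hN
      have hQ := E_of_surjective N.mkQ N.mkQ_surjective hM
      let : Module K (M ⧸ N) := Module.compHom _ (algebraMap K (Alg K n))
      have : IsScalarTower K (Alg K n) (M ⧸ N) := .of_algebraMap_smul fun _ _ => rfl
      refine (Submodule.Quotient.mk_eq_zero N).1 ?_
      exact shift_smul_eq_zero_of_isSimpleModule (E_iff.1 hQ).2 (N.mkQ x)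
    refine addOf_simplesAt hs fun v hv m => ?_
    have htop := genSub_eq_top_of_surjective _ (Submodule.mkQ_surjective
      (Module.jacobson (Alg K n) M)) h
    have hm : m ∈ genSub K Δ (M ⧸ Module.jacobson (Alg K n) M) := htop ▸ Submodule.mem_top
    induction hm using Submodule.span_induction with
    | mem x hx =>
      obtain ⟨w, hw, hx⟩ := hx
      have hvw : v ≠ w := by
        rintro rfl
        exact Finset.mem_compl.1 hv hw
      rw [← hx, ← mul_smul, PathAlgebra.vertex_mul_of_ne K hvw, zero_smul]
    | zero => exact smul_zero _
    | add x y _ _ hx hy => rw [smul_add, hx, hy, add_zero]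
    | smul a x _ hx => rw [vertex_smul_smul_comm hs, hx, smul_zero]

/-- The dual argument, with minimal submodules and the socle: a nonzero submodule vanishing on Δ
contains a simple one, whose components all vanish. -/
theorem ray_iff : Ray K Δ (.of _ M) ↔ E K n (.of _ M) ∧ annSub K Δ M = ⊥ := by
  refine and_congr_right fun hM => ⟨fun h => ?_, fun h => ?_⟩
  · by_contra hne
    have := isArtinian_of_E hM
    obtain ⟨N, hN, hle⟩ := (eq_bot_or_exists_atom_le _).resolve_left hne
    have hsoc : N ≤ sSup {N : Submodule (Alg K n) M | IsSimpleModule (Alg K n) N} :=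
      le_sSup (isSimpleModule_iff_isAtom.2 hN)
    have hv := vanishesOn_compl_of_addOf h
    refine hN.1 (eq_bot_iff.2 fun x hx => ?_)
    rw [Submodule.mem_bot, ← sum_vertex_smul (K := K) (n := n) x]
    refine Finset.sum_eq_zero fun v _ => ?_
    by_cases hvΔ : v ∈ Δ
    · simpa using hle hx 1 v hvΔ
    · exact congrArg Subtype.val (hv v (Finset.mem_compl.2 hvΔ) ⟨x, hsoc hx⟩)
  · let S := sSup {N : Submodule (Alg K n) M | IsSimpleModule (Alg K n) N}
    have hX := E_of_injective S.subtype Subtype.val_injective hM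
    let : Module K S := Module.compHom _ (algebraMap K (Alg K n))
    have : IsScalarTower K (Alg K n) S := .of_algebraMap_smul fun _ _ => rfl
    have := (E_iff.1 hX).1
    have hs (m : S) : shift K n • m = 0 := by
      obtain ⟨x, hx⟩ := m
      refine Subtype.ext ?_
      change shift K n • x = 0
      have hx' : x ∈ ⨆ N : {N : Submodule (Alg K n) M | IsSimpleModule (Alg K n) N}, N.1 := by
        rwa [← sSup_eq_iSup']
      induction hx' using Submodule.iSup_induction' with
      | mem N y hy =>
        have := N.2
        have hN := E_of_injective N.1.subtype Subtype.val_injective hM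
        let : Module K N.1 := Module.compHom _ (algebraMap K (Alg K n))
        have : IsScalarTower K (Alg K n) N.1 := .of_algebraMap_smul fun _ _ => rfl
        have : IsSimpleModule (Alg K n) N.1 := N.2
        exact congrArg Subtype.val
          (shift_smul_eq_zero_of_isSimpleModule (E_iff.1 hN).2 (⟨y, hy⟩ : N.1))
      | zero => exact smul_zero _
      | add y z hy hz ihy ihz =>
        rw [← sSup_eq_iSup'] at hy hz
        rw [smul_add, ihy hy, ihz hz, add_zero]
    refine addOf_simplesAt hs fun v hv m => ?_
    -- In the socle the idempotents commute with the whole algebra, so a component outside Δ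
    -- generates a submodule that vanishes on Δ.
    have hmem : (vertex K v • m : S).1 ∈ annSub K Δ M := by
      intro b w hw
      have hwv : w ≠ v := by
        rintro rfl
        exact Finset.mem_compl.1 hv hw
      have : vertex K w • b • vertex K v • m = 0 := by
        rw [vertex_smul_smul_comm hs, ← mul_smul (vertex K w),
          PathAlgebra.vertex_mul_of_ne K hwv, zero_smul, smul_zero]
      exact congrArg Subtype.val this
    rw [h] at hmem
    exact Subtype.ext hmem

end CyclicQuiver

/-! ### Torsion pairs seen on uniserial modules: the dichotomy. -/

namespace CyclicQuiver

variable {K : Type u} [Field K] {n : ℕ} [NeZero n]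

open PathAlgebra (vertex arrow)

namespace Uni

variable {i : CyclicQuiver n} {l : ℕ}
variable {M : Type u} [AddCommGroup M] [Module (Alg K n) M]

theorem gen_ne_zero : gen K i l ≠ 0 := fun h => by
  have := congrFun h 0
  rw [gen_apply, if_pos rfl] at this
  exact one_ne_zero this

instance : Nontrivial (Uni K i (l + 1)) := ⟨⟨_, _, gen_ne_zero⟩⟩

theorem vanishesOn_iff {Δ : Finset (CyclicQuiver n)} :
    VanishesOn K Δ (Uni K i l) ↔ ∀ k : ℕ, k < l → i + (k : CyclicQuiver n) ∉ Δ := by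
  constructor
  · intro h k hk hmem
    let x : Uni K i l := fun _ => 1
    have h1 := congrFun (h _ hmem x) ⟨k, hk⟩
    have h2 := (vertex_smul_apply _ x ⟨k, hk⟩).symm.trans h1
    rw [if_pos rfl] at h2
    exact one_ne_zero (α := K) h2
  · intro h v hv f
    funext k
    rw [vertex_smul_apply, if_neg]
    · rfl
    · rintro rfl
      exact h k.1 k.2 hv

theorem eq_top_of_gen_mem {S : Submodule (Alg K n) (Uni K i (l + 1))} (h : gen K i l ∈ S) :
    S = ⊤ := by
  refine eq_top_iff.2 fun f _ => ?_
  rw [eq_sum f]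
  exact sum_mem fun k _ => S.smul_of_tower_mem _ (S.smul_mem _ h)

theorem genSub_eq_top {Δ : Finset (CyclicQuiver n)} (h : i ∈ Δ) : genSub K Δ (Uni K i l) = ⊤ := by
  cases l with
  | zero => exact Subsingleton.elim _ _
  | succ l => exact eq_top_of_gen_mem (Submodule.subset_span ⟨i, h, vertex_smul_gen⟩)

/-- The vertex j in Δ is the socle. Each coordinate of an element can be shifted to the last place,
which is located at j and therefore vanishes on `annSub`. -/
theorem annSub_eq_bot {Δ : Finset (CyclicQuiver n)} {j : CyclicQuiver n} (hj : j ∈ Δ)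
    (h : i + (l : CyclicQuiver n) = j + 1) : annSub K Δ (Uni K i l) = ⊥ := by
  cases l with
  | zero => exact Subsingleton.elim _ _
  | succ l =>
    refine eq_bot_iff.2 fun f hf => funext fun k => ?_
    have h1 := hf (shift K n ^ (l - k.1)) j hj
    have h2 := lastCoeff_vertex_smul (K := K) j (shift K n ^ (l - k.1) • f)
    rw [if_pos h.symm, h1, map_zero] at h2
    exact (apply_eq_lastCoeff f k).trans h2.symm

theorem exists_proj {k l : ℕ} (h : k ≤ l) :
    ∃ p : Uni K i l →ₗ[Alg K n] Uni K i k, Function.Surjective p := by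
  obtain ⟨m, rfl⟩ := Nat.exists_eq_add_of_le h
  exact ⟨_, proj_surjective K i k m⟩

theorem exists_incl {j : CyclicQuiver n} {k l : ℕ} (h : k ≤ l)
    (hij : j + (k : CyclicQuiver n) = i + (l : CyclicQuiver n)) :
    ∃ p : Uni K j k →ₗ[Alg K n] Uni K i l, Function.Injective p := by
  obtain ⟨m, rfl⟩ := Nat.exists_eq_add_of_le' h
  have hj : j = i + (m : CyclicQuiver n) := by
    rw [Nat.cast_add] at hij
    linear_combination hij
  subst hj
  exact ⟨_, incl_injective K i m k⟩

end Uni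

section TorsionPair

variable {T F : ObjectProperty (ModuleCat.{u} (Alg K n))}

theorem uni_torsion_of_le (h : IsTorsionPair (E K n) T F) {i : CyclicQuiver n} {k l : ℕ}
    (hkl : k ≤ l) (hT : T (.of _ (Uni K i l))) : T (.of _ (Uni K i k)) := by
  obtain ⟨p, hp⟩ := Uni.exists_proj (K := K) (i := i) hkl
  exact h.torsion_of_surjective p hp (E_uni i k) hT

theorem uni_free_of_le (h : IsTorsionPair (E K n) T F) {i j : CyclicQuiver n} {k l : ℕ}
    (hkl : k ≤ l) (hij : j + (k : CyclicQuiver n) = i + (l : CyclicQuiver n))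
    (hF : F (.of _ (Uni K i l))) : F (.of _ (Uni K j k)) := by
  obtain ⟨p, hp⟩ := Uni.exists_incl (K := K) hkl hij
  exact h.free_of_injective p hp (E_uni j k) hF

theorem uni_torsion_add (h : IsTorsionPair (E K n) T F) {i j : CyclicQuiver n} {k l : ℕ}
    (hij : i + (k : CyclicQuiver n) = j) (h₁ : T (.of _ (Uni K i k)))
    (h₂ : T (.of _ (Uni K j l))) : T (.of _ (Uni K i (k + l))) := by
  subst hij
  exact h.torsion_of_exact _ _ (Uni.exact_incl_proj K i k l) (Uni.proj_surjective K i k l)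
    (E_uni _ _) h₂ h₁

theorem uni_free_add (h : IsTorsionPair (E K n) T F) {i j : CyclicQuiver n} {k l : ℕ}
    (hij : i + (k : CyclicQuiver n) = j) (h₁ : F (.of _ (Uni K i k)))
    (h₂ : F (.of _ (Uni K j l))) : F (.of _ (Uni K i (k + l))) := by
  subst hij
  exact h.free_of_exact _ _ (Uni.incl_injective K i k l) (Uni.exact_incl_proj K i k l)
    (E_uni _ _) h₂ h₁

/-- The torsion sequence of a uniserial module consists of uniserial modules. -/
theorem exists_uni_split (h : IsTorsionPair (E K n) T F) (i : CyclicQuiver n) (l : ℕ) :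
    ∃ k m : ℕ, k + m = l ∧ F (.of _ (Uni K i k)) ∧
      T (.of _ (Uni K (i + (k : CyclicQuiver n)) m)) := by
  have hTi := h.torsion_iso
  have hFi := h.free_iso
  cases l with
  | zero => exact ⟨0, 0, rfl, h.free_of_subsingleton (E_uni _ _),
      h.torsion_of_subsingleton (E_uni _ _)⟩
  | succ l =>
  obtain ⟨X, Y, hX, hY, f, g, hf, hfg, hg⟩ := h.exists_exact _ (E_uni (K := K) i (l + 1))
  let : Module K Y := Module.compHom Y (algebraMap K (Alg K n))
  have : IsScalarTower K (Alg K n) Y := .of_algebraMap_smul fun _ _ => rfl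
  set y := g (Uni.gen K i l) with hy
  have hvy : vertex K i • y = y := by rw [hy, ← map_smul, Uni.vertex_smul_gen]
  -- The quotient Y is generated by the image y of the generator, so Y is the uniserial whose length
  -- is the nilpotency order k of y.
  have hex : ∃ k, shift K n ^ k • y = 0 :=
    ⟨l + 1, by rw [hy, ← map_smul, Uni.shift_pow_smul_eq_zero, map_zero]⟩
  classical
  have hky := Nat.find_spec hex
  have hmin := fun j => Nat.find_min hex (m := j)
  have hkl : Nat.find hex ≤ l + 1 := Nat.find_min' hex
    (by rw [hy, ← map_smul, Uni.shift_pow_smul_eq_zero, map_zero])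
  generalize Nat.find hex = k at hky hmin hkl
  let δ : Uni K i k →ₗ[Alg K n] Y := Uni.desc y hvy hky
  obtain ⟨hδ, hyδ⟩ : Function.Injective δ ∧ y ∈ LinearMap.range δ := by
    cases k with
    | zero =>
      refine ⟨Function.injective_of_subsingleton _, ?_⟩
      rw [pow_zero, one_smul] at hky
      rw [hky]
      exact zero_mem _
    | succ k =>
      have hgen : δ (Uni.gen K i k) = y := Uni.desc_gen _ _ _
      refine ⟨Uni.injective_of_shift_pow_smul_ne_zero δ ?_, ⟨_, hgen⟩⟩
      rw [hgen]
      exact hmin k (Nat.lt_succ_self k)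
  have hδs : Function.Surjective δ := by
    intro z
    obtain ⟨x, rfl⟩ := hg z
    have htop : (LinearMap.range δ).comap g = ⊤ := Uni.eq_top_of_gen_mem hyδ
    have hx : x ∈ (LinearMap.range δ).comap g := htop ▸ Submodule.mem_top
    exact hx
  let e := LinearEquiv.ofBijective δ ⟨hδ, hδs⟩
  obtain ⟨m, hm⟩ := Nat.exists_eq_add_of_le hkl
  refine ⟨k, m, hm.symm, F.prop_of_linearEquiv e.symm hY, ?_⟩
  -- The lengths l + 1 and k + m agree only propositionally; c is the transport, and through it g
  -- becomes the standard projection.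
  obtain ⟨c, hc⟩ : ∃ c : Uni K i (l + 1) →ₗ[Alg K n] Uni K i (k + m), Function.Bijective c ∧
      δ ∘ₗ Uni.proj K i k m ∘ₗ c = g := by
    have key : ∀ L (hL : L = l + 1) (p : Uni K i L →ₗ[Alg K n] Uni K i k),
        (∀ x : Uni K i L, ∀ a : Fin k, p x a = x ⟨a.1, by omega⟩) →
        ∃ c : Uni K i (l + 1) →ₗ[Alg K n] Uni K i L, Function.Bijective c ∧ δ ∘ₗ p ∘ₗ c = g := by
      rintro _ rfl p hp
      refine ⟨LinearMap.id, Function.bijective_id, Uni.hom_ext ?_⟩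
      change δ (p (Uni.gen K i l)) = y
      have h1 : δ (p (Uni.gen K i l)) = ∑ a : Fin k, p (Uni.gen K i l) a • shift K n ^ a.1 • y :=
        Uni.desc_apply _ _ _ _
      rw [h1]
      cases k with
      | zero =>
        rw [pow_zero, one_smul] at hky
        rw [hky]
        simp
      | succ k =>
        rw [Finset.sum_eq_single 0]
        · rw [hp]
          simp [Uni.gen_apply]
        · intro a _ ha
          rw [hp, Uni.gen_apply, if_neg, zero_smul]
          exact fun h0 => ha (Fin.ext ((congrArg Fin.val h0).trans rfl))
        · simp
    exact key (k + m) hm.symm (Uni.proj K i k m) fun _ _ => rfl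
  obtain ⟨hcb, hc⟩ := hc
  have hexact : Function.Exact (c ∘ₗ f) (Uni.proj K i k m) := by
    intro x
    obtain ⟨x, rfl⟩ := hcb.2 x
    have h1 : Uni.proj K i k m (c x) = 0 ↔ g x = 0 := by
      rw [← hc, LinearMap.comp_apply, LinearMap.comp_apply, map_eq_zero_iff δ hδ]
    rw [h1, hfg]
    constructor
    · rintro ⟨z, rfl⟩
      exact ⟨z, rfl⟩
    · rintro ⟨z, hz⟩
      exact ⟨z, hcb.1 hz⟩
  -- Both ranges are the kernel of the same projection, which identifies X with the k-th radical
  -- layer.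
  have hr : LinearMap.range (c ∘ₗ f) = LinearMap.range (Uni.incl K i k m) := by
    rw [← hexact.linearMap_ker_eq, (Uni.exact_incl_proj K i k m).linearMap_ker_eq]
  let e₁ := LinearEquiv.ofInjective (c ∘ₗ f) (hcb.1.comp hf)
  let e₂ := LinearEquiv.ofInjective (Uni.incl K i k m) (Uni.incl_injective K i k m)
  exact T.prop_of_linearEquiv ((e₁.trans (LinearEquiv.ofEq _ _ hr)).trans e₂.symm) hX

theorem natCast_self : ((n : ℕ) : CyclicQuiver n) = 0 := ZMod.natCast_self n

/-- One turn around the cycle ends where it began, so the module can be glued to itself: extensions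
give all multiples of n, and quotients all other lengths. -/
theorem uni_torsion_of_period (h : IsTorsionPair (E K n) T F) {i : CyclicQuiver n}
    (hT : T (.of _ (Uni K i n))) (l : ℕ) : T (.of _ (Uni K i l)) := by
  have key (c : ℕ) : T (.of _ (Uni K i (c * n))) := by
    induction c with
    | zero =>
      rw [zero_mul]
      exact h.torsion_of_subsingleton (E_uni _ _)
    | succ c ih =>
      rw [Nat.succ_mul, add_comm]
      exact uni_torsion_add h (by rw [natCast_self, add_zero]) hT ih
  exact uni_torsion_of_le h (Nat.le_mul_of_pos_right l (NeZero.pos n)) (key l)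

theorem uni_free_of_period (h : IsTorsionPair (E K n) T F) {j : CyclicQuiver n}
    (hF : F (.of _ (Uni K j n))) (i : CyclicQuiver n) (l : ℕ)
    (hij : i + (l : CyclicQuiver n) = j) : F (.of _ (Uni K i l)) := by
  have key (c : ℕ) : F (.of _ (Uni K j (c * n))) := by
    induction c with
    | zero =>
      rw [zero_mul]
      exact h.free_of_subsingleton (E_uni _ _)
    | succ c ih =>
      rw [Nat.succ_mul, add_comm]
      exact uni_free_add h (by rw [natCast_self, add_zero]) hF ih
  refine uni_free_of_le h (Nat.le_mul_of_pos_right l (NeZero.pos n)) ?_ (key l)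
  rw [hij, Nat.cast_mul, natCast_self, mul_zero, add_zero]

/-- The vertices `i` such that all uniserial modules with top `S i` are torsion. -/
noncomputable def torsionTops (T : ObjectProperty (ModuleCat.{u} (Alg K n))) :
    Finset (CyclicQuiver n) := by
  classical exact Finset.univ.filter fun i => ∀ l, T (.of _ (Uni K i l))

/-- The vertices `j` such that all uniserial modules with socle `S j` are torsion-free. -/
noncomputable def freeSocles (F : ObjectProperty (ModuleCat.{u} (Alg K n))) :
    Finset (CyclicQuiver n) := by
  classical exact Finset.univ.filter fun j =>
    ∀ (i : CyclicQuiver n) (l : ℕ), i + (l : CyclicQuiver n) = j + 1 → F (.of _ (Uni K i l))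

theorem mem_torsionTops {i : CyclicQuiver n} :
    i ∈ torsionTops T ↔ ∀ l, T (.of _ (Uni K i l)) := by
  simp [torsionTops]

theorem mem_freeSocles {j : CyclicQuiver n} :
    j ∈ freeSocles F ↔ ∀ (i : CyclicQuiver n) (l : ℕ), i + (l : CyclicQuiver n) = j + 1 →
      F (.of _ (Uni K i l)) := by
  simp [freeSocles]

/-- In the torsion sequence of a uniserial that winds twice around the cycle, one of the two ends
has length at least n. -/
theorem nonempty_torsionTops_or_freeSocles (h : IsTorsionPair (E K n) T F) :
    (torsionTops T).Nonempty ∨ (freeSocles F).Nonempty := by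
  obtain ⟨k, m, hkm, hF, hT⟩ := exists_uni_split h 0 (n + n)
  rcases le_or_gt n m with hm | hm
  · exact .inl ⟨_, mem_torsionTops.2 (uni_torsion_of_period h (uni_torsion_of_le h hm hT))⟩
  -- The torsion-free quotient has top 0 and length k, so its socle is located at k - 1.
  · refine .inr ⟨(k : CyclicQuiver n) - 1, mem_freeSocles.2 fun i l hil => ?_⟩
    refine uni_free_of_period h (j := (k : CyclicQuiver n)) ?_ i l
      (by rw [hil, sub_add_cancel])
    refine uni_free_of_le h (show n ≤ k by omega) ?_ hF
    rw [natCast_self, zero_add, add_zero]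

theorem exists_natCast_add_eq (i j : CyclicQuiver n) :
    ∃ l : ℕ, l < n ∧ i + (l : CyclicQuiver n) = j := by
  refine ⟨ZMod.val (n := n) (j - i), ZMod.val_lt _, ?_⟩
  have : ((ZMod.val (n := n) (j - i) : ℕ) : CyclicQuiver n) = j - i := ZMod.natCast_zmod_val _
  rw [this]
  exact add_sub_cancel _ _

/-- The uniserial running from the given top to the given socle would be torsion and torsion-free.
-/
theorem not_nonempty_torsionTops_and_freeSocles (h : IsTorsionPair (E K n) T F) :
    ¬((torsionTops T).Nonempty ∧ (freeSocles F).Nonempty) := by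
  rintro ⟨⟨i, hi⟩, ⟨j, hj⟩⟩
  obtain ⟨l, -, hl⟩ := exists_natCast_add_eq i j
  have h1 := mem_torsionTops.1 hi (l + 1)
  have h2 := mem_freeSocles.1 hj i (l + 1) (by rw [Nat.cast_succ, ← add_assoc, hl])
  have := h.subsingleton_of_torsion_of_free h1 h2
  exact not_subsingleton (Uni K i (l + 1)) this

end TorsionPair

end CyclicQuiver

/-! ### Sums of classes, and factoring maps through kernels and ranges. -/

instance {R : Type u} [Ring R] (C₁ C₂ : ObjectProperty (ModuleCat.{u} R)) :
    (directSumOf C₁ C₂).IsClosedUnderIsomorphisms where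
  of_iso := by
    rintro X Y e ⟨M₁, M₂, h₁, h₂, ⟨f⟩⟩
    exact ⟨M₁, M₂, h₁, h₂, ⟨e.symm.toLinearEquiv.trans f⟩⟩

theorem directSumOf_prod_left {R : Type u} [Ring R] {C₁ C₂ : ObjectProperty (ModuleCat.{u} R)}
    {U : Type u} [AddCommGroup U] [Module R U] {M : ModuleCat.{u} R} (h : directSumOf C₁ C₂ M)
    (hU : ∀ X, C₁ X → C₁ (.of R (U × X))) : directSumOf C₁ C₂ (.of R (U × M)) := by
  obtain ⟨M₁, M₂, h₁, h₂, ⟨f⟩⟩ := h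
  exact ⟨.of R (U × M₁), M₂, hU _ h₁, h₂,
    ⟨((LinearEquiv.refl R U).prodCongr f).trans (LinearEquiv.prodAssoc R U M₁ M₂).symm⟩⟩

theorem directSumOf_prod_right {R : Type u} [Ring R] {C₁ C₂ : ObjectProperty (ModuleCat.{u} R)}
    {U : Type u} [AddCommGroup U] [Module R U] {M : ModuleCat.{u} R} (h : directSumOf C₁ C₂ M)
    (hU : ∀ X, C₂ X → C₂ (.of R (U × X))) : directSumOf C₁ C₂ (.of R (U × M)) := by
  obtain ⟨M₁, M₂, h₁, h₂, ⟨f⟩⟩ := h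
  exact ⟨M₁, .of R (U × M₂), h₁, hU _ h₂,
    ⟨((LinearEquiv.refl R U).prodCongr f).trans (((LinearEquiv.prodAssoc R U M₁ M₂).symm.trans
      ((LinearEquiv.prodComm R U M₁).prodCongr (LinearEquiv.refl R M₂))).trans
      (LinearEquiv.prodAssoc R M₁ U M₂))⟩⟩

theorem LinearMap.exists_comp_eq_of_ker_le {R : Type*} [Ring R] {M N P : Type*} [AddCommGroup M]
    [Module R M] [AddCommGroup N] [Module R N] [AddCommGroup P] [Module R P] (π : M →ₗ[R] N)
    (hπ : Function.Surjective π) (φ : M →ₗ[R] P) (h : LinearMap.ker π ≤ LinearMap.ker φ) :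
    ∃ ψ : N →ₗ[R] P, ψ ∘ₗ π = φ := by
  refine ⟨(LinearMap.ker π).liftQ φ h ∘ₗ (π.quotKerEquivOfSurjective hπ).symm.toLinearMap, ?_⟩
  ext x
  have h3 : (π.quotKerEquivOfSurjective hπ).symm (π x) = (LinearMap.ker π).mkQ x := by
    rw [LinearEquiv.symm_apply_eq]; rfl
  change (LinearMap.ker π).liftQ φ h ((π.quotKerEquivOfSurjective hπ).symm (π x)) = φ x
  rw [h3]
  rfl

theorem LinearMap.exists_comp_eq_of_range_le {R : Type*} [Ring R] {M N P : Type*} [AddCommGroup M]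
    [Module R M] [AddCommGroup N] [Module R N] [AddCommGroup P] [Module R P] (ι : N →ₗ[R] M)
    (hι : Function.Injective ι) (φ : P →ₗ[R] M) (h : LinearMap.range φ ≤ LinearMap.range ι) :
    ∃ ψ : P →ₗ[R] N, ι ∘ₗ ψ = φ := by
  let e := LinearEquiv.ofInjective ι hι
  refine ⟨e.symm.toLinearMap ∘ₗ φ.codRestrict _ fun x => h ⟨x, rfl⟩, LinearMap.ext fun x => ?_⟩
  have := e.apply_symm_apply (φ.codRestrict _ (fun x => h ⟨x, rfl⟩) x)
  exact congrArg Subtype.val this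

/-! ### Passing between torsion pairs on `E K n` and on the modules vanishing on Δ. -/

namespace CyclicQuiver

open PathAlgebra (vertex arrow)

section

variable (K : Type u) [Field K] {n : ℕ} [NeZero n] (Δ : Finset (CyclicQuiver n))

/-- The modules in `E n` which have no composition factors at the vertices in `Δ`. -/
def EVanishing : ObjectProperty (ModuleCat.{u} (Alg K n)) :=
  fun M => E K n M ∧ VanishesOn K Δ M

end

variable {K : Type u} [Field K] {n : ℕ} [NeZero n] {Δ : Finset (CyclicQuiver n)}

instance : (EVanishing K Δ).IsClosedUnderIsomorphisms where
  of_iso {X Y} e h := ⟨(E K n).prop_of_iso e h.1,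
    h.2.of_injective (M := Y) (N := X) e.symm.toLinearEquiv.toLinearMap
      e.symm.toLinearEquiv.injective⟩

section Sub

variable {M : Type u} [AddCommGroup M] [Module (Alg K n) M]

theorem genSub_genSub : genSub K Δ (genSub K Δ M) = ⊤ := by
  refine Eq.trans ?_ (Submodule.span_span_coe_preimage
    (s := {x : M | ∃ v ∈ Δ, vertex K v • x = x}) (R := Alg K n))
  exact congrArg (Submodule.span _) (Set.ext fun x =>
    exists_congr fun v => and_congr_right fun _ => Subtype.ext_iff)

/-- An element e_v b x that lies in `annSub` is killed by e_v, but e_v fixes it. -/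
theorem annSub_quotient_annSub : annSub K Δ (M ⧸ annSub K Δ M) = ⊥ := by
  rw [eq_bot_iff]
  intro y hy
  obtain ⟨x, rfl⟩ := Submodule.mkQ_surjective _ y
  refine (Submodule.Quotient.mk_eq_zero _).2 fun b v hv => ?_
  have h1 := hy b v hv
  rw [← map_smul, ← map_smul] at h1
  have h2 := (Submodule.Quotient.mk_eq_zero _).1 h1 1 v hv
  rwa [one_smul, ← mul_smul, PathAlgebra.vertex_mul_self] at h2

end Sub

/-! ### Enlarging a torsion class by Coray(Δ). -/

section FirstKind

variable {T' F' : ObjectProperty (ModuleCat.{u} (Alg K n))}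

/-- Going down from the top, stop just before the first vertex of Δ. The quotient cut out there has
length k + 1 because i itself is outside Δ; over Λ_Δ it is an indecomposable projective. -/
theorem exists_min_length {i : CyclicQuiver n} {l : ℕ}
    (h : ∃ k : ℕ, k < l ∧ i + (k : CyclicQuiver n) ∈ Δ) (hi : i ∉ Δ) :
    ∃ k : ℕ, k + 1 < l ∧ VanishesOn K Δ (Uni K i (k + 1)) ∧
      i + ((k + 1 : ℕ) : CyclicQuiver n) ∈ Δ := by
  classical
  have h1 := Nat.find_spec h
  have h2 := fun j => Nat.find_min h (m := j)
  generalize Nat.find h = k at h1 h2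
  cases k with
  | zero => exact absurd (by simpa using h1.2) hi
  | succ k => exact ⟨k, h1.1, Uni.vanishesOn_iff.2 fun j hj hmem => h2 j hj ⟨hj.trans h1.1, hmem⟩,
      h1.2⟩

/-- Split M into uniserials. Those with top in Δ belong to Coray(Δ). Any other one that met Δ would
have a nonzero quotient as in `hP`, hence a nonzero map to F'; so it vanishes on Δ, and then it is
in T' by orthogonality. The hypothesis `hP` says that the indecomposable projectives of Λ_Δ are in
F'. -/
theorem directSumOf_coray_of_hom_eq_zero (h : IsTorsionPair (EVanishing K Δ) T' F')
    (hP : ∀ (i : CyclicQuiver n) (l : ℕ), VanishesOn K Δ (Uni K i (l + 1)) →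
      i + ((l + 1 : ℕ) : CyclicQuiver n) ∈ Δ → F' (.of _ (Uni K i (l + 1))))
    (M : ModuleCat.{u} (Alg K n)) (hM : E K n M)
    (hom : ∀ Y, F' Y → ∀ f : M →ₗ[Alg K n] Y, f = 0) : directSumOf (Coray K Δ) T' M := by
  have := h.torsion_iso
  let P : ObjectProperty (ModuleCat.{u} (Alg K n)) := fun M =>
    (∀ Y, F' Y → ∀ f : M →ₗ[Alg K n] Y, f = 0) → directSumOf (Coray K Δ) T' M
  have : P.IsClosedUnderIsomorphisms := ⟨fun {X Y} e hX hY =>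
    (directSumOf (Coray K Δ) T').prop_of_iso e (hX fun Z hZ f => by
      have h1 := hY Z hZ (f ∘ₗ e.symm.toLinearEquiv.toLinearMap)
      ext x
      have h2 := DFunLike.congr_fun h1 (e.toLinearEquiv x)
      simpa using h2)⟩
  refine E_induction P ?_ ?_ M hM hom
  · intro M hM _
    refine ⟨M, M, coray_iff.2 ⟨E_of_subsingleton, Subsingleton.elim _ _⟩,
      h.torsion_of_subsingleton ⟨E_of_subsingleton, fun v _ m => Subsingleton.elim _ _⟩, ⟨?_⟩⟩
    exact LinearEquiv.ofBijective 0 ⟨Function.injective_of_subsingleton _,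
      fun x => ⟨0, Subsingleton.elim _ _⟩⟩
  · intro i l M _ ih hom
    have hM := ih fun Y hY f => by
      ext x
      exact DFunLike.congr_fun (hom Y hY (f ∘ₗ LinearMap.snd _ _ _)) (0, x)
    have hU : ∀ Y, F' Y → ∀ f : Uni K i (l + 1) →ₗ[Alg K n] Y, f = 0 := fun Y hY f =>
      LinearMap.ext fun x =>
        DFunLike.congr_fun (hom Y hY (f ∘ₗ LinearMap.fst (Alg K n) _ M)) (x, 0)
    by_cases hi : i ∈ Δ
    · refine directSumOf_prod_left hM fun X hX => ?_
      have hX := coray_iff.1 hX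
      exact coray_iff.2 ⟨E_prod (E_uni _ _) hX.1, genSub_prod_eq_top (Uni.genSub_eq_top hi) hX.2⟩
    · have hv : VanishesOn K Δ (Uni K i (l + 1)) := by
        rw [Uni.vanishesOn_iff]
        by_contra hne
        push Not at hne
        obtain ⟨k, hk, hvk, hkΔ⟩ := exists_min_length (K := K) hne hi
        obtain ⟨p, hp⟩ := Uni.exists_proj (K := K) (i := i) hk.le
        have hp0 := hU _ (hP i k hvk hkΔ) p
        obtain ⟨x, hx⟩ := hp (Uni.gen K i k)
        rw [hp0] at hx
        exact Uni.gen_ne_zero hx.symm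
      have hUT : T' (.of _ (Uni K i (l + 1))) := (h.torsion_iff _).2 ⟨⟨E_uni _ _, hv⟩, hU⟩
      refine directSumOf_prod_right hM fun X hX => ?_
      have hX' := h.torsion_le _ hX
      exact h.torsion_prod ⟨E_prod (E_uni _ _) hX'.1, hv.prod hX'.2⟩ hUT hX

/-- The torsion part of X is the preimage of the torsion part A of X / `genSub`. A map from it to F'
kills `genSub`, hence factors through A and is zero; the orthogonality lemma above then gives the
required splitting. -/
theorem isTorsionPair_coray (h : IsTorsionPair (EVanishing K Δ) T' F')
    (hP : ∀ (i : CyclicQuiver n) (l : ℕ), VanishesOn K Δ (Uni K i (l + 1)) →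
      i + ((l + 1 : ℕ) : CyclicQuiver n) ∈ Δ → F' (.of _ (Uni K i (l + 1)))) :
    IsTorsionPair (E K n) (directSumOf (Coray K Δ) T') F' where
  torsion_iso := inferInstance
  free_iso := h.free_iso
  torsion_le := by
    rintro X ⟨A, B, hA, hB, ⟨e⟩⟩
    exact (E K n).prop_of_linearEquiv e.symm (E_prod (coray_iff.1 hA).1 (h.torsion_le _ hB).1)
  free_le _ hX := (h.free_le _ hX).1
  hom_zero := by
    rintro X Y ⟨A, B, hA, hB, ⟨e⟩⟩ hY f
    have h1 := hom_eq_zero_of_genSub_eq_top (coray_iff.1 hA).2 (h.free_le _ hY).2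
      (f ∘ₗ e.symm.toLinearMap ∘ₗ LinearMap.inl _ A B)
    have h2 := h.hom_zero _ _ hB hY (f ∘ₗ e.symm.toLinearMap ∘ₗ LinearMap.inr _ A B)
    have h3 : f ∘ₗ e.symm.toLinearMap = 0 := LinearMap.prod_ext h1 h2
    ext x
    simpa using DFunLike.congr_fun h3 (e x)
  exists_exact := by
    intro X hX
    let G := genSub K Δ X
    obtain ⟨A, B, hA, hB, f, g, hf, hfg, hg⟩ := h.exists_exact (.of _ (X ⧸ G))
      ⟨E_of_surjective G.mkQ (Submodule.mkQ_surjective _) hX, vanishesOn_quotient_genSub⟩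
    let g' : X →ₗ[Alg K n] B := g ∘ₗ G.mkQ
    have hmem (x : X) (hx : x ∈ LinearMap.ker g') : G.mkQ x ∈ LinearMap.range f := (hfg _).1 hx
    refine ⟨.of _ (LinearMap.ker g'), B, directSumOf_coray_of_hom_eq_zero h hP _
      (E_of_injective (LinearMap.ker g').subtype Subtype.val_injective hX) ?_, hB,
      (LinearMap.ker g').subtype, g', Subtype.val_injective, ?_,
      hg.comp (Submodule.mkQ_surjective _)⟩
    · intro Y hY φ
      have hGle : G ≤ LinearMap.ker g' := fun x hx => by
        exact (congrArg g ((Submodule.Quotient.mk_eq_zero G).2 hx)).trans (map_zero g)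
      have h1 := hom_eq_zero_of_genSub_eq_top (Δ := Δ) genSub_genSub (h.free_le _ hY).2
        (φ ∘ₗ Submodule.inclusion hGle)
      -- π is the quotient map by G restricted to ker g', read as a surjection onto A.
      obtain ⟨π, hπ⟩ := LinearMap.exists_comp_eq_of_range_le f hf
        (G.mkQ ∘ₗ (LinearMap.ker g').subtype) (by
          rintro _ ⟨x, rfl⟩
          exact hmem x.1 x.2)
      have hπ' (x) : f (π x) = G.mkQ x.1 := DFunLike.congr_fun hπ x
      have hπs : Function.Surjective π := by
        intro a
        obtain ⟨x, hx⟩ := Submodule.mkQ_surjective _ (f a)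
        refine ⟨⟨x, ?_⟩, hf ?_⟩
        · rw [LinearMap.mem_ker, LinearMap.comp_apply, hx]
          exact hfg.apply_apply_eq_zero a
        · rw [hπ', hx]
      obtain ⟨ψ, hψ⟩ := LinearMap.exists_comp_eq_of_ker_le π hπs φ (by
        intro x hx
        have h2 : G.mkQ x.1 = 0 := by rw [← hπ', LinearMap.mem_ker.1 hx, map_zero]
        exact DFunLike.congr_fun h1 ⟨x.1, (Submodule.Quotient.mk_eq_zero _).1 h2⟩)
      rw [← hψ, h.hom_zero _ _ hA hY ψ, LinearMap.zero_comp]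
    · intro x
      constructor
      · intro hx
        exact ⟨⟨x, hx⟩, rfl⟩
      · rintro ⟨x, rfl⟩
        exact x.2

/-- For i outside Δ, the uniserial from i up to the step before Δ is a nonzero projective, hence
torsion-free and not torsion. Non-emptiness of Δ ensures that Δ is reached. -/
theorem torsionTops_coray (h : IsTorsionPair (EVanishing K Δ) T' F')
    (hP : ∀ (i : CyclicQuiver n) (l : ℕ), VanishesOn K Δ (Uni K i (l + 1)) →
      i + ((l + 1 : ℕ) : CyclicQuiver n) ∈ Δ → F' (.of _ (Uni K i (l + 1))))
    (hΔ : Δ.Nonempty) : torsionTops (directSumOf (Coray K Δ) T') = Δ := by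
  have htp := isTorsionPair_coray h hP
  ext i
  rw [mem_torsionTops]
  constructor
  · intro hi
    by_contra hiΔ
    obtain ⟨j, hj⟩ := hΔ
    obtain ⟨l, -, hl⟩ := exists_natCast_add_eq i j
    obtain ⟨k, -, hvk, hkΔ⟩ := exists_min_length (K := K)
      (show ∃ k, k < l + 1 ∧ i + (k : CyclicQuiver n) ∈ Δ from
        ⟨l, Nat.lt_succ_self l, hl.symm ▸ hj⟩) hiΔ
    have := htp.subsingleton_of_torsion_of_free (hi (k + 1)) (hP i k hvk hkΔ)
    exact not_subsingleton (Uni K i (k + 1)) this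
  · intro hi l
    refine ⟨.of _ (Uni K i l), .of _ PUnit, coray_iff.2 ⟨E_uni _ _, Uni.genSub_eq_top hi⟩,
      h.torsion_of_subsingleton ⟨E_of_subsingleton, fun v _ m => Subsingleton.elim _ _⟩,
      ⟨LinearEquiv.prodUnique.symm⟩⟩

theorem hasUniqueDecomposition_coray (hT : T' ≤ EVanishing K Δ) :
    HasUniqueDecomposition (Coray K Δ) T' := by
  rintro M₁ M₂ N₁ N₂ h₁ h₂ h₃ h₄ ⟨e⟩
  exact nonempty_linearEquiv_of_prod e
    (hom_eq_zero_of_genSub_eq_top (coray_iff.1 h₁).2 (hT _ h₄).2)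
    (hom_eq_zero_of_genSub_eq_top (coray_iff.1 h₃).2 (hT _ h₂).2)

end FirstKind

/-! ### Splitting Coray(Δ) off a given torsion class. -/

section FirstKindOf

variable {T F : ObjectProperty (ModuleCat.{u} (Alg K n))}

/-- An element located at a vertex v of Δ is the image of the generator of a sufficiently long
uniserial with top at v, and that uniserial is torsion. -/
theorem free_le_EVanishing (h : IsTorsionPair (E K n) T F) : F ≤ EVanishing K (torsionTops T) := by
  intro M hM
  have hE := h.free_le _ hM
  refine ⟨hE, fun v hv m => ?_⟩
  let : Module K M := Module.compHom M (algebraMap K (Alg K n))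
  have : IsScalarTower K (Alg K n) M := .of_algebraMap_smul fun _ _ => rfl
  obtain ⟨-, l, hl⟩ := E_iff.1 hE
  have h1 := h.hom_zero _ _ (mem_torsionTops.1 hv (l + 1)) hM (Uni.desc (vertex K v • m)
    (by rw [← mul_smul, PathAlgebra.vertex_mul_self])
    (by rw [pow_succ', mul_smul, hl, smul_zero]))
  have h2 := DFunLike.congr_fun h1 (Uni.gen K v l)
  rwa [Uni.desc_gen] at h2

theorem isTorsionPair_EVanishing_torsionTops (h : IsTorsionPair (E K n) T F) :
    IsTorsionPair (EVanishing K (torsionTops T)) (T ⊓ EVanishing K (torsionTops T)) F where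
  torsion_iso := by
    have := h.torsion_iso
    infer_instance
  free_iso := h.free_iso
  torsion_le := inf_le_right
  free_le := free_le_EVanishing h
  hom_zero X Y hX := h.hom_zero X Y hX.1
  exists_exact X hX := by
    obtain ⟨A, B, hA, hB, f, g, hf, hfg, hg⟩ := h.exists_exact X hX.1
    exact ⟨A, B, ⟨hA, h.torsion_le _ hA, hX.2.of_injective f hf⟩, hB, f, g, hf, hfg, hg⟩

/-- Suppose that the torsion part, with top i + k, is nonzero. It ends right before a vertex of Δ,
so the torsion uniserials starting there can be glued below it. Then uniserials with top i + k of
every length are torsion and i + k is in Δ, against `hv`. -/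
theorem uni_free_of_torsionTops (h : IsTorsionPair (E K n) T F) (i : CyclicQuiver n) (l : ℕ)
    (hv : VanishesOn K (torsionTops T) (Uni K i (l + 1)))
    (hi : i + ((l + 1 : ℕ) : CyclicQuiver n) ∈ torsionTops T) : F (.of _ (Uni K i (l + 1))) := by
  obtain ⟨k, m, hkm, hF, hT⟩ := exists_uni_split h i (l + 1)
  cases m with
  | zero =>
    obtain rfl : k = l + 1 := hkm
    exact hF
  | succ m =>
    refine absurd (mem_torsionTops.2 fun L => ?_) (Uni.vanishesOn_iff.1 hv k (by omega))
    refine uni_torsion_of_le h (Nat.le_add_left L (m + 1)) (uni_torsion_add h ?_ hT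
      (mem_torsionTops.1 hi L))
    rw [add_assoc, ← Nat.cast_add, hkm]

theorem eq_directSumOf_coray (h : IsTorsionPair (E K n) T F) :
    T = directSumOf (Coray K (torsionTops T)) (T ⊓ EVanishing K (torsionTops T)) := by
  have h' := isTorsionPair_coray (isTorsionPair_EVanishing_torsionTops h)
    (uni_free_of_torsionTops h)
  exact h.torsion_eq h'

end FirstKindOf

/-! ### Enlarging a torsion-free class by Ray(Δ). -/

section SecondKind

variable {T' F' : ObjectProperty (ModuleCat.{u} (Alg K n))}

theorem exists_max_length {i : CyclicQuiver n} {l : ℕ}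
    (h : ∃ k : ℕ, k < l + 1 ∧ i + (k : CyclicQuiver n) ∈ Δ)
    (hi : i + (l : CyclicQuiver n) ∉ Δ) :
    ∃ j ∈ Δ, ∃ k : ℕ, k + 1 < l + 1 ∧ VanishesOn K Δ (Uni K (j + 1) (k + 1)) ∧
      j + 1 + ((k + 1 : ℕ) : CyclicQuiver n) = i + ((l + 1 : ℕ) : CyclicQuiver n) := by
  classical
  -- The distance d is counted back from the socle, so its minimum picks the last vertex of Δ; the
  -- submodule beginning right after it is injective over Λ_Δ.
  have h' : ∃ d : ℕ, d ≤ l ∧ i + ((l - d : ℕ) : CyclicQuiver n) ∈ Δ := by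
    obtain ⟨k, hk, hmem⟩ := h
    refine ⟨l - k, Nat.sub_le _ _, ?_⟩
    rwa [Nat.sub_sub_self (by omega)]
  have h1 := Nat.find_spec h'
  have h2 := fun j => Nat.find_min h' (m := j)
  generalize Nat.find h' = d at h1 h2
  cases d with
  | zero => exact absurd (by simpa using h1.2) hi
  | succ d =>
    have hcast : ((l - (d + 1) : ℕ) : CyclicQuiver n) = (l : CyclicQuiver n) - ((d + 1 : ℕ)) :=
      Nat.cast_sub h1.1
    refine ⟨_, h1.2, d, by omega, Uni.vanishesOn_iff.2 fun k hk hmem => ?_, ?_⟩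
    · refine h2 (d - k) (by omega) ⟨by omega, ?_⟩
      convert hmem using 1
      rw [hcast, Nat.cast_sub (by omega), Nat.cast_sub (by omega)]
      push_cast
      ring
    · rw [hcast]
      push_cast
      ring

/-- Dual splitting: uniserials with socle in Δ belong to Ray(Δ), and any other one that met Δ would
contain a nonzero module from T' by `hI`, which says that the indecomposable injectives of Λ_Δ are
in T'. -/
theorem directSumOf_ray_of_hom_eq_zero (h : IsTorsionPair (EVanishing K Δ) T' F')
    (hI : ∀ (i : CyclicQuiver n) (l : ℕ), i ∈ Δ → VanishesOn K Δ (Uni K (i + 1) (l + 1)) →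
      T' (.of _ (Uni K (i + 1) (l + 1))))
    (M : ModuleCat.{u} (Alg K n)) (hM : E K n M)
    (hom : ∀ Y, T' Y → ∀ f : Y →ₗ[Alg K n] M, f = 0) : directSumOf F' (Ray K Δ) M := by
  have := h.free_iso
  let P : ObjectProperty (ModuleCat.{u} (Alg K n)) := fun M =>
    (∀ Y, T' Y → ∀ f : Y →ₗ[Alg K n] M, f = 0) → directSumOf F' (Ray K Δ) M
  have : P.IsClosedUnderIsomorphisms := ⟨fun {X Y} e hX hY =>
    (directSumOf F' (Ray K Δ)).prop_of_iso e (hX fun Z hZ f => by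
      have h1 := hY Z hZ (e.toLinearEquiv.toLinearMap ∘ₗ f)
      ext x
      have h2 := DFunLike.congr_fun h1 x
      exact e.toLinearEquiv.injective (h2.trans (map_zero _).symm))⟩
  refine E_induction P ?_ ?_ M hM hom
  · intro M hM _
    refine ⟨M, M, h.free_of_subsingleton ⟨E_of_subsingleton, fun v _ m => Subsingleton.elim _ _⟩,
      ray_iff.2 ⟨E_of_subsingleton, Subsingleton.elim _ _⟩, ⟨?_⟩⟩
    exact LinearEquiv.ofBijective 0 ⟨Function.injective_of_subsingleton _,
      fun x => ⟨0, Subsingleton.elim _ _⟩⟩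
  · intro i l M _ ih hom
    have hM := ih fun Y hY f => LinearMap.ext fun x =>
      congrArg Prod.snd (DFunLike.congr_fun (hom Y hY (LinearMap.inr (Alg K n) _ M ∘ₗ f)) x)
    have hU : ∀ Y, T' Y → ∀ f : Y →ₗ[Alg K n] Uni K i (l + 1), f = 0 := fun Y hY f =>
      LinearMap.ext fun x =>
        congrArg Prod.fst (DFunLike.congr_fun (hom Y hY (LinearMap.inl (Alg K n) _ M ∘ₗ f)) x)
    by_cases hi : i + (l : CyclicQuiver n) ∈ Δ
    · refine directSumOf_prod_right hM fun X hX => ?_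
      have hX := ray_iff.1 hX
      refine ray_iff.2 ⟨E_prod (E_uni _ _) hX.1, annSub_prod_eq_bot (Uni.annSub_eq_bot hi ?_) hX.2⟩
      rw [Nat.cast_succ, add_assoc]
    · have hv : VanishesOn K Δ (Uni K i (l + 1)) := by
        rw [Uni.vanishesOn_iff]
        by_contra hne
        push Not at hne
        obtain ⟨j, hj, k, hk, hvk, hjk⟩ := exists_max_length (K := K) hne hi
        obtain ⟨p, hp⟩ := Uni.exists_incl (K := K) hk.le hjk
        have hp0 := hU _ (hI j k hj hvk) p
        refine Uni.gen_ne_zero (hp (a₁ := Uni.gen K (j + 1) k) (a₂ := 0) ?_)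
        rw [hp0]
        rfl
      have hUF : F' (.of _ (Uni K i (l + 1))) := (h.free_iff _).2 ⟨⟨E_uni _ _, hv⟩, hU⟩
      refine directSumOf_prod_left hM fun X hX => ?_
      have hX' := h.free_le _ hX
      exact h.free_prod ⟨E_prod (E_uni _ _) hX'.1, hv.prod hX'.2⟩ hUF hX

/-- The torsion part of X is that of its largest submodule W vanishing on Δ, because torsion modules
vanish on Δ. -/
theorem isTorsionPair_ray (h : IsTorsionPair (EVanishing K Δ) T' F')
    (hI : ∀ (i : CyclicQuiver n) (l : ℕ), i ∈ Δ → VanishesOn K Δ (Uni K (i + 1) (l + 1)) →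
      T' (.of _ (Uni K (i + 1) (l + 1)))) :
    IsTorsionPair (E K n) T' (directSumOf F' (Ray K Δ)) where
  torsion_iso := h.torsion_iso
  free_iso := inferInstance
  torsion_le _ hX := (h.torsion_le _ hX).1
  free_le := by
    rintro X ⟨A, B, hA, hB, ⟨e⟩⟩
    exact (E K n).prop_of_linearEquiv e.symm (E_prod (h.free_le _ hA).1 (ray_iff.1 hB).1)
  hom_zero := by
    rintro X Y hX ⟨A, B, hA, hB, ⟨e⟩⟩ f
    have h1 := h.hom_zero _ _ hX hA (LinearMap.fst _ A B ∘ₗ e.toLinearMap ∘ₗ f)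
    have h2 := hom_eq_zero_of_annSub_eq_bot (h.torsion_le _ hX).2 (ray_iff.1 hB).2
      (LinearMap.snd _ A B ∘ₗ e.toLinearMap ∘ₗ f)
    ext x
    refine e.injective (Eq.trans ?_ (map_zero e).symm)
    exact Prod.ext (DFunLike.congr_fun h1 x) (DFunLike.congr_fun h2 x)
  exists_exact := by
    intro X hX
    let W := annSub K Δ X
    obtain ⟨A, B, hA, hB, f, g, hf, hfg, hg⟩ := h.exists_exact (.of _ W)
      ⟨E_of_injective W.subtype Subtype.val_injective hX, vanishesOn_annSub⟩
    let f' : A →ₗ[Alg K n] X := W.subtype ∘ₗ f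
    let Q := X ⧸ LinearMap.range f'
    let q : X →ₗ[Alg K n] Q := (LinearMap.range f').mkQ
    have hqf (a : A) : q (f' a) = 0 := (Submodule.Quotient.mk_eq_zero _).2 ⟨a, rfl⟩
    refine ⟨A, .of _ Q, hA, directSumOf_ray_of_hom_eq_zero h hI _
      (E_of_surjective q (Submodule.mkQ_surjective _) hX) ?_, f', q,
      Subtype.val_injective.comp hf, ?_, Submodule.mkQ_surjective _⟩
    · intro Z hZ φ
      -- With A the torsion part of W and B = W / A, the map β embeds B into Q = X / A, and π below
      -- is the projection X / A → X / W. A map from a torsion module to Q dies in X / W, so it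
      -- lands in the torsion-free module B.
      obtain ⟨β, hβ⟩ := LinearMap.exists_comp_eq_of_ker_le g hg (q ∘ₗ W.subtype) (by
        intro x hx
        obtain ⟨a, rfl⟩ := (hfg x).1 hx
        exact hqf a)
      have hβ' (w) : β (g w) = q w.1 := DFunLike.congr_fun hβ w
      have hβi : Function.Injective β := by
        rw [injective_iff_map_eq_zero]
        intro b hb
        obtain ⟨w, rfl⟩ := hg b
        rw [hβ'] at hb
        obtain ⟨a, ha⟩ := (Submodule.Quotient.mk_eq_zero _).1 hb
        rw [show w = f a from Subtype.ext ha.symm]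
        exact hfg.apply_apply_eq_zero a
      obtain ⟨π, hπ⟩ := LinearMap.exists_comp_eq_of_ker_le q (Submodule.mkQ_surjective _) W.mkQ (by
        intro x hx
        obtain ⟨a, rfl⟩ := (Submodule.Quotient.mk_eq_zero _).1 hx
        exact (Submodule.Quotient.mk_eq_zero _).2 (f a).2)
      have h1 := hom_eq_zero_of_annSub_eq_bot (Δ := Δ) (h.torsion_le _ hZ).2
        annSub_quotient_annSub (π ∘ₗ φ)
      obtain ⟨ψ, hψ⟩ := LinearMap.exists_comp_eq_of_range_le β hβi φ (by
        rintro _ ⟨z, rfl⟩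
        obtain ⟨x, hx⟩ := Submodule.mkQ_surjective (LinearMap.range f') (φ z)
        have h2 : π (q x) = 0 := by
          change π ((LinearMap.range f').mkQ x) = 0
          rw [hx]
          exact DFunLike.congr_fun h1 z
        have h3 : W.mkQ x = 0 := by rw [← hπ]; exact h2
        exact ⟨g ⟨x, (Submodule.Quotient.mk_eq_zero _).1 h3⟩, (hβ' _).trans hx⟩)
      rw [← hψ, h.hom_zero _ _ hZ hB ψ, LinearMap.comp_zero]
    · intro x
      exact Submodule.Quotient.mk_eq_zero _

theorem freeSocles_ray (h : IsTorsionPair (EVanishing K Δ) T' F')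
    (hI : ∀ (i : CyclicQuiver n) (l : ℕ), i ∈ Δ → VanishesOn K Δ (Uni K (i + 1) (l + 1)) →
      T' (.of _ (Uni K (i + 1) (l + 1))))
    (hΔ : Δ.Nonempty) : freeSocles (directSumOf F' (Ray K Δ)) = Δ := by
  have htp := isTorsionPair_ray h hI
  ext i
  rw [mem_freeSocles]
  constructor
  · intro hi
    by_contra hiΔ
    obtain ⟨j, hj⟩ := hΔ
    obtain ⟨l, -, hl⟩ := exists_natCast_add_eq j i
    obtain ⟨a, ha, k, -, hvk, hak⟩ := exists_max_length (K := K) (l := l)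
      (show ∃ k : ℕ, k < l + 1 ∧ j + (k : CyclicQuiver n) ∈ Δ from
        ⟨0, Nat.succ_pos l, by simpa using hj⟩) (hl.symm ▸ hiΔ)
    rw [Nat.cast_succ l, ← add_assoc j, hl] at hak
    have := htp.subsingleton_of_torsion_of_free (hI a k ha hvk) (hi (a + 1) (k + 1) hak)
    exact not_subsingleton (Uni K (a + 1) (k + 1)) this
  · intro hi j l hjl
    refine ⟨.of _ PUnit, .of _ (Uni K j l), h.free_of_subsingleton ⟨E_of_subsingleton,
      fun v _ m => Subsingleton.elim _ _⟩, ray_iff.2 ⟨E_uni _ _, Uni.annSub_eq_bot hi hjl⟩,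
      ⟨LinearEquiv.uniqueProd.symm⟩⟩

theorem hasUniqueDecomposition_ray (hF : F' ≤ EVanishing K Δ) :
    HasUniqueDecomposition F' (Ray K Δ) := by
  rintro M₁ M₂ N₁ N₂ h₁ h₂ h₃ h₄ ⟨e⟩
  exact nonempty_linearEquiv_of_prod e
    (hom_eq_zero_of_annSub_eq_bot (hF _ h₁).2 (ray_iff.1 h₄).2)
    (hom_eq_zero_of_annSub_eq_bot (hF _ h₃).2 (ray_iff.1 h₂).2)

end SecondKind

/-! ### Splitting Ray(Δ) off a given torsion-free class. -/

section SecondKindOf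

variable {T F : ObjectProperty (ModuleCat.{u} (Alg K n))}

/-- A functional on the component at v defines a map to a long uniserial with socle at v, which is
torsion-free; so the map vanishes, and with it the functional. -/
theorem torsion_le_EVanishing (h : IsTorsionPair (E K n) T F) :
    T ≤ EVanishing K (freeSocles F) := by
  intro M hM
  have hE := h.torsion_le _ hM
  refine ⟨hE, fun v hv m => ?_⟩
  let : Module K M := Module.compHom M (algebraMap K (Alg K n))
  have : IsScalarTower K (Alg K n) M := .of_algebraMap_smul fun _ _ => rfl
  obtain ⟨-, l, hl⟩ := E_iff.1 hE
  refine (Module.forall_dual_apply_eq_zero_iff K _).1 fun φ => ?_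
  -- A uniserial of length l + 1 with socle at v has its top at v - l.
  have hvl : v - (l : CyclicQuiver n) + ((l + 1 : ℕ) : CyclicQuiver n) = v + 1 := by
    push_cast
    ring
  let φ' : M →ₗ[K] K := φ ∘ₗ Algebra.lsmul K K M (vertex K v)
  have hφ' (m : M) : φ' m = φ (vertex K v • m) := rfl
  let c : M →ₗ[Alg K n] Uni K (v - (l : CyclicQuiver n)) (l + 1) :=
    Uni.colift φ' (fun w x => by
      rw [hvl, hφ', hφ', ← mul_smul]
      split_ifs with hw
      · rw [add_right_cancel hw, PathAlgebra.vertex_mul_self]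
      · rw [PathAlgebra.vertex_mul_of_ne K fun h' => hw (by rw [h']), zero_smul, map_zero])
      (fun x => by rw [pow_succ', mul_smul, hl, smul_zero, map_zero])
  have h1 : c = 0 := h.hom_zero _ _ hM (mem_freeSocles.1 hv _ _ hvl) c
  have h2 : Uni.lastCoeff (c m) = φ' m := Uni.lastCoeff_colift φ' _ _ m
  rw [h1] at h2
  exact h2.symm

theorem isTorsionPair_EVanishing_freeSocles (h : IsTorsionPair (E K n) T F) :
    IsTorsionPair (EVanishing K (freeSocles F)) T (F ⊓ EVanishing K (freeSocles F)) where
  torsion_iso := h.torsion_iso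
  free_iso := by
    have := h.free_iso
    infer_instance
  torsion_le := torsion_le_EVanishing h
  free_le := inf_le_right
  hom_zero X Y hX hY := h.hom_zero X Y hX hY.1
  exists_exact X hX := by
    obtain ⟨A, B, hA, hB, f, g, hf, hfg, hg⟩ := h.exists_exact X hX.1
    exact ⟨A, B, hA, ⟨hB, h.free_le _ hB, hX.2.of_surjective g hg⟩, f, g, hf, hfg, hg⟩

/-- If the torsion-free quotient were nonzero, the torsion-free uniserials with socle at i could be
glued on top of it, and its socle vertex would lie in `freeSocles`, against `hv`. -/
theorem uni_torsion_of_freeSocles (h : IsTorsionPair (E K n) T F) (i : CyclicQuiver n) (l : ℕ)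
    (hi : i ∈ freeSocles F) (hv : VanishesOn K (freeSocles F) (Uni K (i + 1) (l + 1))) :
    T (.of _ (Uni K (i + 1) (l + 1))) := by
  obtain ⟨k, m, hkm, hF, hT⟩ := exists_uni_split h (i + 1) (l + 1)
  cases k with
  | zero =>
    obtain rfl : m = l + 1 := by omega
    rwa [Nat.cast_zero, add_zero] at hT
  | succ k =>
    refine absurd (mem_freeSocles.2 fun a L haL => ?_) (Uni.vanishesOn_iff.1 hv k (by omega))
    have h1 : i + 1 - (L : CyclicQuiver n) + (L : CyclicQuiver n) = i + 1 := sub_add_cancel _ _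
    refine uni_free_of_le h (i := i + 1 - (L : CyclicQuiver n)) (Nat.le_add_right L (k + 1)) ?_
      (uni_free_add h h1 (mem_freeSocles.1 hi _ L h1) hF)
    rw [haL]
    push_cast
    ring

theorem eq_directSumOf_ray (h : IsTorsionPair (E K n) T F) :
    F = directSumOf (F ⊓ EVanishing K (freeSocles F)) (Ray K (freeSocles F)) := by
  have h' := isTorsionPair_ray (isTorsionPair_EVanishing_freeSocles h)
    (uni_torsion_of_freeSocles h)
  exact h.free_eq h'

end SecondKindOf

end CyclicQuiver

/-! ### Restriction of scalars along the projection to the path algebra of a full subquiver. -/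

namespace DelVertex

open PathAlgebra (vertex arrow)

section Action

variable {K : Type u} [Field K] {V : Type} [Quiver.{0} V] [Fintype V] [DecidableEq V]
  {Δ : Finset V}

/-- The path algebra of the full subquiver as a module over the path algebra of the quiver. -/
noncomputable instance : Module (PathAlgebra K V) (PathAlgebra K (DelVertex Δ)) :=
  Module.compHom _ (proj Δ K).toRingHom

theorem smul_eq (a : PathAlgebra K V) (b : PathAlgebra K (DelVertex Δ)) :
    a • b = proj Δ K a * b := rfl

instance : IsScalarTower (PathAlgebra K V) (PathAlgebra K (DelVertex Δ))
    (PathAlgebra K (DelVertex Δ)) := ⟨fun a b c => by simp only [smul_eq, smul_eq_mul, mul_assoc]⟩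

instance : IsScalarTower K (PathAlgebra K V) (PathAlgebra K (DelVertex Δ)) :=
  .of_algebraMap_smul fun c b => by rw [smul_eq, AlgHom.commutes, ← Algebra.smul_def]

theorem proj_vertex_of_notMem {v : V} (h : v ∉ Δ) :
    proj Δ K (vertex K v) = vertex K (V := DelVertex Δ) ⟨v, h⟩ := by
  rw [proj, PathAlgebra.lift_vertex, dif_pos h]

theorem proj_vertex_of_mem {v : V} (h : v ∈ Δ) : proj Δ K (vertex K v) = 0 := by
  rw [proj, PathAlgebra.lift_vertex, dif_neg (not_not.2 h)]

theorem proj_arrow (a : Quiver.Total (DelVertex Δ)) :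
    proj Δ K (arrow K (V := V) ⟨a.left.1, a.right.1, a.hom⟩) = arrow K a := by
  rw [proj, PathAlgebra.lift_arrow, dif_pos ⟨a.left.2, a.right.2⟩]
  rfl

variable (K Δ) in
theorem proj_surjective : Function.Surjective (proj Δ K) := by
  intro b
  obtain ⟨x, rfl⟩ := RingQuot.mkAlgHom_surjective K (PathAlgebra.Rel K (DelVertex Δ)) b
  change _ ∈ (proj Δ K).range
  induction x using FreeAlgebra.induction with
  | grade0 c =>
    rw [AlgHom.commutes]
    exact Subalgebra.algebraMap_mem _ c
  | grade1 x =>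
    rcases x with v | a
    · exact ⟨_, proj_vertex_of_notMem v.2⟩
    · exact ⟨_, proj_arrow a⟩
  | mul a b ha hb =>
    rw [map_mul]
    exact mul_mem ha hb
  | add a b ha hb =>
    rw [map_add]
    exact add_mem ha hb

section Tower

variable {M N : Type*} [AddCommGroup M] [Module (PathAlgebra K V) M]
  [Module (PathAlgebra K (DelVertex Δ)) M]
  [IsScalarTower (PathAlgebra K V) (PathAlgebra K (DelVertex Δ)) M]
  [AddCommGroup N] [Module (PathAlgebra K V) N] [Module (PathAlgebra K (DelVertex Δ)) N]
  [IsScalarTower (PathAlgebra K V) (PathAlgebra K (DelVertex Δ)) N]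

theorem proj_smul (a : PathAlgebra K V) (m : M) : proj Δ K a • m = a • m := by
  rw [← mul_one (proj Δ K a), ← smul_eq, smul_assoc, one_smul]

/-- Homomorphisms over the path algebra of the quiver are homomorphisms over the path algebra of
the full subquiver. -/
noncomputable def extend (f : M →ₗ[PathAlgebra K V] N) : M →ₗ[PathAlgebra K (DelVertex Δ)] N where
  toFun := f
  map_add' := f.map_add
  map_smul' b m := by
    obtain ⟨a, rfl⟩ := proj_surjective K Δ b
    rw [proj_smul, map_smul, RingHom.id_apply, proj_smul]

/-- Isomorphisms over the path algebra of the quiver are isomorphisms over the path algebra of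
the full subquiver. -/
noncomputable def extendEquiv (f : M ≃ₗ[PathAlgebra K V] N) : M ≃ₗ[PathAlgebra K (DelVertex Δ)] N :=
  { extend f.toLinearMap with
    invFun := f.symm
    left_inv := f.left_inv
    right_inv := f.right_inv }

theorem isScalarTower_of_algebraMap [Module K M]
    [IsScalarTower K (PathAlgebra K (DelVertex Δ)) M] : IsScalarTower K (PathAlgebra K V) M :=
  .of_algebraMap_smul fun c m => by
    rw [← proj_smul (Δ := Δ), AlgHom.commutes, algebraMap_smul]

theorem isScalarTower_of_algebraMap' [Module K M]
    [IsScalarTower K (PathAlgebra K V) M] : IsScalarTower K (PathAlgebra K (DelVertex Δ)) M :=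
  .of_algebraMap_smul fun c m => by
    rw [← AlgHom.commutes (proj Δ K), proj_smul, algebraMap_smul]

end Tower

variable {M : Type u} [AddCommGroup M] [Module (PathAlgebra K V) M]
  [Module (PathAlgebra K (DelVertex Δ)) M]
  [IsScalarTower (PathAlgebra K V) (PathAlgebra K (DelVertex Δ)) M]

variable (Δ M) in
theorem nonempty_restrictScalars_equiv :
    Nonempty (M ≃ₗ[PathAlgebra K V] (ModuleCat.restrictScalars (proj Δ K).toRingHom).obj
      (.of (PathAlgebra K (DelVertex Δ)) M)) :=
  ⟨{toFun := (id : M → (ModuleCat.restrictScalars (proj Δ K).toRingHom).obj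
      (.of (PathAlgebra K (DelVertex Δ)) M))
    invFun := id
    left_inv := fun _ => rfl
    right_inv := fun _ => rfl
    map_add' := fun _ _ => rfl
    map_smul' := fun a m => (proj_smul (Δ := Δ) a m).symm }⟩

/-- The projection is surjective, so for compatible actions on one group the two notions of linear
isomorphism agree, and membership needs no change of carrier. -/
theorem asKQ_iff (P : ObjectProperty (ModuleCat.{u} (PathAlgebra K (DelVertex Δ))))
    [P.IsClosedUnderIsomorphisms] : asKQ Δ P (.of _ M) ↔ P (.of _ M) := by
  constructor
  · rintro ⟨X, hX, ⟨e⟩⟩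
    let : Module (PathAlgebra K V) X := Module.compHom X (proj Δ K).toRingHom
    have : IsScalarTower (PathAlgebra K V) (PathAlgebra K (DelVertex Δ)) X :=
      ⟨fun a b x => mul_smul (proj Δ K a) b x⟩
    let e' : X ≃ₗ[PathAlgebra K V] M := e.toLinearEquiv
    exact P.prop_of_linearEquiv (extendEquiv e') hX
  · intro h
    obtain ⟨e⟩ := nonempty_restrictScalars_equiv (K := K) Δ M
    exact ⟨_, h, ⟨e.symm.toModuleIso⟩⟩

theorem inverseImage_restrictScalars_iff (P : ObjectProperty (ModuleCat.{u} (PathAlgebra K V)))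
    [P.IsClosedUnderIsomorphisms] :
    P.inverseImage (ModuleCat.restrictScalars (proj Δ K).toRingHom) (.of _ M) ↔ P (.of _ M) := by
  obtain ⟨e⟩ := nonempty_restrictScalars_equiv (K := K) Δ M
  exact ⟨fun h => P.prop_of_iso e.symm.toModuleIso h, fun h => P.prop_of_iso e.toModuleIso h⟩

instance (P : ObjectProperty (ModuleCat.{u} (PathAlgebra K (DelVertex Δ)))) :
    (asKQ Δ P).IsClosedUnderIsomorphisms :=
  inferInstanceAs (P.map _).IsClosedUnderIsomorphisms

end Action

end DelVertex

/-! ### Modules over Λ_Δ as the modules vanishing on Δ. -/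

namespace CyclicQuiver

open PathAlgebra (vertex arrow)
open DelVertex (proj asKQ)

variable {K : Type u} [Field K] {n : ℕ} [NeZero n] {Δ : Finset (CyclicQuiver n)}

variable (K Δ) in
/-- The path algebra of the full subquiver on the complement of `Δ`. -/
abbrev DelAlg : Type u := PathAlgebra K (DelVertex Δ)

variable {M : Type u} [AddCommGroup M] [Module (Alg K n) M]

theorem vanishesOn_of_isScalarTower [Module (DelAlg K Δ) M]
    [IsScalarTower (Alg K n) (DelAlg K Δ) M] : VanishesOn K Δ M := fun v hv m => by
  rw [← DelVertex.proj_smul (Δ := Δ), DelVertex.proj_vertex_of_mem hv, zero_smul]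

/-- The idempotents in Δ act as zero, so the remaining ones already sum to the identity. The
operators of the vertices and arrows outside Δ thus satisfy the relations of the subquiver, and
arrows touching Δ act as zero, as they do through the projection. -/
theorem VanishesOn.exists_module (h : VanishesOn K Δ M) :
    ∃ _ : Module (DelAlg K Δ) M, IsScalarTower (Alg K n) (DelAlg K Δ) M := by
  let : Module K M := Module.compHom M (algebraMap K (Alg K n))
  have : IsScalarTower K (Alg K n) M := .of_algebraMap_smul fun _ _ => rfl
  let ρ : Alg K n →ₐ[K] Module.End K M := Algebra.lsmul K K M
  have hρv {v : CyclicQuiver n} (hv : v ∈ Δ) : ρ (vertex K v) = 0 := LinearMap.ext (h v hv)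
  let σ : DelAlg K Δ →ₐ[K] Module.End K M := PathAlgebra.lift (fun v => ρ (vertex K v.1))
    (fun a => ρ (arrow K (V := CyclicQuiver n) ⟨a.left.1, a.right.1, a.hom⟩))
    (fun v => by rw [← map_mul, PathAlgebra.vertex_mul_self])
    (fun v w hvw => by
      rw [← map_mul, PathAlgebra.vertex_mul_of_ne K fun h' => hvw (Subtype.ext h'), map_zero])
    (by
      rw [← map_one ρ, ← PathAlgebra.sum_vertex, map_sum,
        ← Finset.sum_subset (Finset.subset_univ Δᶜ)
          (fun v _ hv => hρv (by simpa using hv))]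
      exact Finset.sum_bij (fun v _ => v.1) (fun v _ => Finset.mem_compl.2 v.2)
        (fun _ _ _ _ h => Subtype.ext h)
        (fun v hv => ⟨⟨v, Finset.mem_compl.1 hv⟩, Finset.mem_univ _, rfl⟩) fun _ _ => rfl)
    (fun a => by
      rw [← map_mul]
      exact congrArg ρ (PathAlgebra.target_mul_arrow K (V := CyclicQuiver n)
        ⟨a.left.1, a.right.1, a.hom⟩))
    (fun a => by
      rw [← map_mul]
      exact congrArg ρ (PathAlgebra.arrow_mul_source K (V := CyclicQuiver n)
        ⟨a.left.1, a.right.1, a.hom⟩))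
  have hσ : ∀ a, σ (proj Δ K a) = ρ a := by
    intro a
    induction a using alg_induction with
    | algebraMap c => rw [AlgHom.commutes, AlgHom.commutes, AlgHom.commutes]
    | vertex v =>
      by_cases hv : v ∈ Δ
      · rw [DelVertex.proj_vertex_of_mem hv, map_zero, hρv hv]
      · rw [DelVertex.proj_vertex_of_notMem hv]
        exact PathAlgebra.lift_vertex _ _ _ _ _ _ _ _
    | shift =>
      rw [shift, map_sum, map_sum, map_sum]
      refine Finset.sum_congr rfl fun v _ => ?_
      by_cases h1 : v ∉ Δ ∧ v + 1 ∉ Δ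
      · have h2 := DelVertex.proj_arrow (K := K) (Δ := Δ)
          ⟨⟨v, h1.1⟩, ⟨v + 1, h1.2⟩, (arrowFrom v).hom⟩
        refine (congrArg σ h2).trans ?_
        exact PathAlgebra.lift_arrow _ _ _ _ _ _ _ _
      · have h2 : proj Δ K (arrow K (arrowFrom v)) = 0 := by
          rw [proj, PathAlgebra.lift_arrow]
          exact dif_neg h1
        rw [h2, map_zero]
        by_cases h3 : v ∈ Δ
        · rw [← PathAlgebra.arrow_mul_source, map_mul]
          exact ((congrArg _ (hρv h3)).trans (mul_zero _)).symm
        · have h4 : v + 1 ∈ Δ := by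
            by_contra h5
            exact h1 ⟨h3, h5⟩
          rw [← PathAlgebra.target_mul_arrow, map_mul]
          exact ((congrArg (· * _) (hρv h4)).trans (zero_mul _)).symm
    | add a b ha hb => rw [map_add, map_add, map_add, ha, hb]
    | mul a b ha hb => rw [map_mul, map_mul, map_mul, ha, hb]
  let inst : Module (DelAlg K Δ) M := Module.compHom M σ.toRingHom
  refine ⟨inst, ⟨fun a b m => ?_⟩⟩
  change σ (proj Δ K a * b) m = a • σ b m
  rw [map_mul, hσ]
  rfl

theorem vanishesOn_of_asKQ {P : ObjectProperty (ModuleCat.{u} (DelAlg K Δ))}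
    (h : asKQ Δ P (.of _ M)) : VanishesOn K Δ M := by
  obtain ⟨X, -, ⟨e⟩⟩ := h
  intro v hv m
  refine e.toLinearEquiv.symm.injective ?_
  rw [map_smul, map_zero]
  have h1 : proj Δ K (vertex K v) • (show X from e.toLinearEquiv.symm m) = 0 := by
    rw [DelVertex.proj_vertex_of_mem hv, zero_smul]
  exact h1

/-- A path of length n visits every vertex, in particular one in Δ. -/
theorem VanishesOn.shift_pow_smul (h : VanishesOn K Δ M) (hΔ : Δ.Nonempty) (m : M) :
    shift K n ^ n • m = 0 := by
  rw [← sum_vertex_smul (K := K) (n := n) m, Finset.smul_sum]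
  refine Finset.sum_eq_zero fun v _ => ?_
  obtain ⟨j, hj⟩ := hΔ
  obtain ⟨l, hl, rfl⟩ := exists_natCast_add_eq v j
  obtain ⟨k, rfl⟩ := Nat.exists_eq_add_of_le' hl.le
  rw [pow_add, ← mul_smul, mul_assoc, ← vertex_mul_shift_pow, ← mul_assoc, mul_smul, mul_smul,
    h _ hj, smul_zero]

/-- The images of the paths of length less than n span: longer ones vanish, the span is stable under
the generators, and it contains 1. -/
theorem finite_delAlg (hΔ : Δ.Nonempty) : Module.Finite K (DelAlg K Δ) := by
  have hvan : VanishesOn K Δ (DelAlg K Δ) := vanishesOn_of_isScalarTower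
  let S : Submodule K (DelAlg K Δ) := Submodule.span K
    (Set.range fun p : Fin n × CyclicQuiver n =>
      proj Δ K (shift K n ^ p.1.1 * vertex K p.2))
  have hmem (k : ℕ) (v : CyclicQuiver n) : proj Δ K (shift K n ^ k * vertex K v) ∈ S := by
    rcases lt_or_ge k n with hk | hk
    · exact Submodule.subset_span ⟨(⟨k, hk⟩, v), rfl⟩
    · obtain ⟨m, rfl⟩ := Nat.exists_eq_add_of_le hk
      have h1 := hvan.shift_pow_smul hΔ (proj Δ K (shift K n ^ m * vertex K v))
      rw [DelVertex.smul_eq, ← map_mul, ← mul_assoc, ← pow_add] at h1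
      rw [h1]
      exact zero_mem S
  have hS : ∀ a : Alg K n, ∀ x ∈ S, a • x ∈ S := by
    intro a
    induction a using alg_induction with
    | algebraMap c =>
      intro x hx
      rw [algebraMap_smul]
      exact S.smul_mem c hx
    | vertex v =>
      intro x hx
      induction hx using Submodule.span_induction with
      | mem x hx =>
        obtain ⟨⟨k, w⟩, rfl⟩ := hx
        dsimp only
        rw [DelVertex.smul_eq, ← map_mul]
        obtain ⟨w', rfl⟩ : ∃ w' : CyclicQuiver n, v = w' + ((k : ℕ) : CyclicQuiver n) :=
          ⟨v - ((k : ℕ) : CyclicQuiver n), by ring⟩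
        rw [← mul_assoc, vertex_mul_shift_pow, mul_assoc]
        by_cases h : w' = w
        · rw [h, PathAlgebra.vertex_mul_self]
          exact hmem _ _
        · rw [PathAlgebra.vertex_mul_of_ne K h, mul_zero, map_zero]
          exact zero_mem S
      | zero => rw [smul_zero]; exact zero_mem S
      | add x y _ _ hx hy => rw [smul_add]; exact add_mem hx hy
      | smul c x _ hx => rw [smul_comm]; exact S.smul_mem c hx
    | shift =>
      intro x hx
      induction hx using Submodule.span_induction with
      | mem x hx =>
        obtain ⟨⟨k, w⟩, rfl⟩ := hx
        dsimp only
        rw [DelVertex.smul_eq, ← map_mul, ← mul_assoc, ← pow_succ']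
        exact hmem _ _
      | zero => rw [smul_zero]; exact zero_mem S
      | add x y _ _ hx hy => rw [smul_add]; exact add_mem hx hy
      | smul c x _ hx => rw [smul_comm]; exact S.smul_mem c hx
    | add a b ha hb =>
      intro x hx
      rw [add_smul]
      exact add_mem (ha x hx) (hb x hx)
    | mul a b ha hb =>
      intro x hx
      rw [mul_smul]
      exact ha _ (hb x hx)
  have h1 : (1 : DelAlg K Δ) ∈ S := by
    rw [← map_one (proj Δ K), ← PathAlgebra.sum_vertex, map_sum]
    refine sum_mem fun v _ => ?_
    have := hmem 0 v
    rwa [pow_zero, one_mul] at this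
  have htop : S = ⊤ := eq_top_iff.2 fun b _ => by
    obtain ⟨a, rfl⟩ := DelVertex.proj_surjective K Δ b
    have := hS a 1 h1
    rwa [DelVertex.smul_eq, mul_one] at this
  exact ⟨htop ▸ Submodule.fg_span (Set.finite_range _)⟩

theorem E_iff_finite [Module (DelAlg K Δ) M] [IsScalarTower (Alg K n) (DelAlg K Δ) M]
    (hΔ : Δ.Nonempty) : E K n (.of _ M) ↔ Module.Finite (DelAlg K Δ) M := by
  let : Module K M := Module.compHom M (algebraMap K (Alg K n))
  have : IsScalarTower K (Alg K n) M := .of_algebraMap_smul fun _ _ => rfl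
  have : IsScalarTower K (DelAlg K Δ) M := DelVertex.isScalarTower_of_algebraMap'
  have := finite_delAlg (K := K) hΔ
  rw [E_iff]
  constructor
  · rintro ⟨_, -⟩
    exact Module.Finite.of_restrictScalars_finite K _ M
  · intro h
    exact ⟨Module.Finite.trans (DelAlg K Δ) M, n,
      vanishesOn_of_isScalarTower.shift_pow_smul hΔ⟩

/-- A module over the path algebra of the full subquiver on the complement of `Δ` as a module over
the path algebra of the cyclic quiver. -/
theorem exists_module_alg (X : Type u) [AddCommGroup X] [Module (DelAlg K Δ) X] :
    ∃ _ : Module (Alg K n) X, IsScalarTower (Alg K n) (DelAlg K Δ) X :=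
  let inst : Module (Alg K n) X := Module.compHom X (proj Δ K).toRingHom
  ⟨inst, ⟨fun a b x => mul_smul (proj Δ K a) b x⟩⟩

theorem asKQ_injective {P Q : ObjectProperty (ModuleCat.{u} (DelAlg K Δ))}
    [P.IsClosedUnderIsomorphisms] [Q.IsClosedUnderIsomorphisms] (h : asKQ Δ P = asKQ Δ Q) :
    P = Q := by
  funext X
  obtain ⟨_, _⟩ := exists_module_alg (K := K) (Δ := Δ) X
  exact propext ((DelVertex.asKQ_iff (M := X) P).symm.trans
    ((iff_of_eq (congrFun h _)).trans (DelVertex.asKQ_iff Q)))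

theorem isTorsionPair_asKQ {T' F' : ObjectProperty (ModuleCat.{u} (DelAlg K Δ))}
    (hΔ : Δ.Nonempty) (h : IsTorsionPair (finGen _) T' F') :
    IsTorsionPair (EVanishing K Δ) (asKQ Δ T') (asKQ Δ F') := by
  have hTi := h.torsion_iso
  have hFi := h.free_iso
  refine ⟨inferInstance, inferInstance, fun X hX => ?_, fun X hX => ?_, fun X Y hX hY f => ?_,
    fun X hX => ?_⟩
  · have hv := vanishesOn_of_asKQ hX
    obtain ⟨_, _⟩ := hv.exists_module
    exact ⟨(E_iff_finite hΔ).2 (h.torsion_le _ ((DelVertex.asKQ_iff (M := X) _).1 hX)), hv⟩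
  · have hv := vanishesOn_of_asKQ hX
    obtain ⟨_, _⟩ := hv.exists_module
    exact ⟨(E_iff_finite hΔ).2 (h.free_le _ ((DelVertex.asKQ_iff (M := X) _).1 hX)), hv⟩
  · obtain ⟨_, _⟩ := (vanishesOn_of_asKQ hX).exists_module
    obtain ⟨_, _⟩ := (vanishesOn_of_asKQ hY).exists_module
    have := h.hom_zero _ _ ((DelVertex.asKQ_iff (M := X) _).1 hX)
      ((DelVertex.asKQ_iff (M := Y) _).1 hY) (DelVertex.extend f)
    ext x
    exact DFunLike.congr_fun this x
  · obtain ⟨_, _⟩ := hX.2.exists_module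
    obtain ⟨A, B, hA, hB, f, g, hf, hfg, hg⟩ := h.exists_exact (.of _ X) ((E_iff_finite hΔ).1 hX.1)
    obtain ⟨_, _⟩ := exists_module_alg (K := K) (Δ := Δ) A
    obtain ⟨_, _⟩ := exists_module_alg (K := K) (Δ := Δ) B
    exact ⟨.of _ A, .of _ B, (DelVertex.asKQ_iff _).2 hA, (DelVertex.asKQ_iff _).2 hB,
      f.restrictScalars (Alg K n), g.restrictScalars (Alg K n), hf, hfg, hg⟩

theorem asKQ_inverseImage {P : ObjectProperty (ModuleCat.{u} (Alg K n))}
    [P.IsClosedUnderIsomorphisms] (hP : P ≤ EVanishing K Δ) :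
    asKQ Δ (P.inverseImage (ModuleCat.restrictScalars (proj Δ K).toRingHom)) = P := by
  funext X
  refine propext ⟨fun hX => ?_, fun hX => ?_⟩
  · obtain ⟨_, _⟩ := (vanishesOn_of_asKQ hX).exists_module
    exact (DelVertex.inverseImage_restrictScalars_iff (M := X) P).1
      ((DelVertex.asKQ_iff (M := X) _).1 hX)
  · obtain ⟨_, _⟩ := (hP _ hX).2.exists_module
    exact (DelVertex.asKQ_iff (M := X) _).2
      ((DelVertex.inverseImage_restrictScalars_iff (M := X) P).2 hX)

/-- A torsion pair on the modules which vanish on `Δ` comes from a torsion pair on the finitely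
generated modules over the path algebra of the full subquiver on the complement of `Δ`. -/
theorem exists_isTorsionPair_finGen {T₀ F₀ : ObjectProperty (ModuleCat.{u} (Alg K n))}
    (hΔ : Δ.Nonempty) (h : IsTorsionPair (EVanishing K Δ) T₀ F₀) :
    ∃ T' F' : ObjectProperty (ModuleCat.{u} (DelAlg K Δ)), IsTorsionPair (finGen _) T' F' ∧
      asKQ Δ T' = T₀ ∧ asKQ Δ F' = F₀ := by
  have hTi := h.torsion_iso
  have hFi := h.free_iso
  refine ⟨_, _, ⟨?_, ?_, fun X hX => ?_, fun X hX => ?_, fun X Y hX hY f => ?_, fun X hX => ?_⟩,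
    asKQ_inverseImage h.torsion_le, asKQ_inverseImage h.free_le⟩
  · infer_instance
  · infer_instance
  · obtain ⟨_, _⟩ := exists_module_alg (K := K) (Δ := Δ) X
    exact (E_iff_finite hΔ).1 (h.torsion_le _
      ((DelVertex.inverseImage_restrictScalars_iff (M := X) _).1 hX)).1
  · obtain ⟨_, _⟩ := exists_module_alg (K := K) (Δ := Δ) X
    exact (E_iff_finite hΔ).1 (h.free_le _
      ((DelVertex.inverseImage_restrictScalars_iff (M := X) _).1 hX)).1
  · obtain ⟨_, _⟩ := exists_module_alg (K := K) (Δ := Δ) X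
    obtain ⟨_, _⟩ := exists_module_alg (K := K) (Δ := Δ) Y
    have := h.hom_zero _ _ ((DelVertex.inverseImage_restrictScalars_iff (M := X) _).1 hX)
      ((DelVertex.inverseImage_restrictScalars_iff (M := Y) _).1 hY)
      (f.restrictScalars (Alg K n))
    ext x
    exact DFunLike.congr_fun this x
  · obtain ⟨_, _⟩ := exists_module_alg (K := K) (Δ := Δ) X
    obtain ⟨A, B, hA, hB, f, g, hf, hfg, hg⟩ := h.exists_exact (.of _ X)
      ⟨(E_iff_finite hΔ).2 hX, vanishesOn_of_isScalarTower⟩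
    obtain ⟨_, _⟩ := (h.torsion_le _ hA).2.exists_module
    obtain ⟨_, _⟩ := (h.free_le _ hB).2.exists_module
    exact ⟨.of _ A, .of _ B, (DelVertex.inverseImage_restrictScalars_iff _).2 hA,
      (DelVertex.inverseImage_restrictScalars_iff _).2 hB,
      DelVertex.extend f, DelVertex.extend g, hf, hfg, hg⟩

end CyclicQuiver

/-! ### Homological dimension of products. -/

section Dimension

variable {R : Type u} [Ring R]

instance : ObjectProperty.IsClosedUnderIsomorphisms
    (fun X : ModuleCat.{u} R => HasProjectiveDimensionLE X 1) where
  of_iso e h := by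
    have := h
    exact hasProjectiveDimensionLT_of_iso e 2

instance : ObjectProperty.IsClosedUnderIsomorphisms
    (fun X : ModuleCat.{u} R => HasInjectiveDimensionLE X 1) where
  of_iso e h := by
    have := h
    exact hasInjectiveDimensionLT_of_iso e 2

theorem hasProjectiveDimensionLE_prod {X Y : ModuleCat.{u} R} {d : ℕ}
    (hX : HasProjectiveDimensionLE X d) (hY : HasProjectiveDimensionLE Y d) :
    HasProjectiveDimensionLE (ModuleCat.of R (X × Y)) d :=
  hasProjectiveDimensionLT_of_iso (ModuleCat.biprodIsoProd X Y) (d + 1)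

theorem hasInjectiveDimensionLE_prod {X Y : ModuleCat.{u} R} {d : ℕ}
    (hX : HasInjectiveDimensionLE X d) (hY : HasInjectiveDimensionLE Y d) :
    HasInjectiveDimensionLE (ModuleCat.of R (X × Y)) d :=
  hasInjectiveDimensionLT_of_iso (ModuleCat.biprodIsoProd X Y) (d + 1)

end Dimension

/-! ### Projective and injective uniserials, and homological dimension over Λ_Δ. -/

namespace CyclicQuiver

open PathAlgebra (vertex arrow)
open DelVertex (proj asKQ)

variable {K : Type u} [Field K] {n : ℕ} [NeZero n] {Δ : Finset (CyclicQuiver n)}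

section Uniserial

variable {i : CyclicQuiver n} {l : ℕ}

/-- To lift the generator, take the component at i of any preimage. The only further relation, that
its shift by the full length is zero, is automatic because that element is located in Δ. -/
theorem Uni.projective [Module (DelAlg K Δ) (Uni K i l)]
    [IsScalarTower (Alg K n) (DelAlg K Δ) (Uni K i l)] (hi : i + (l : CyclicQuiver n) ∈ Δ) :
    Module.Projective (DelAlg K Δ) (Uni K i l) := by
  cases l with
  | zero => infer_instance
  | succ l =>
  refine Module.Projective.of_lifting_property'' fun f hf => ?_
  obtain ⟨x, hx⟩ := hf (gen K i l)
  let f' := f.restrictScalars (Alg K n)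
  have hv : VanishesOn K Δ (Uni K i (l + 1) →₀ DelAlg K Δ) := vanishesOn_of_isScalarTower
  have hy : vertex K i • vertex K i • x = vertex K i • x := by
    rw [← mul_smul, PathAlgebra.vertex_mul_self]
  have hl : shift K n ^ (l + 1) • vertex K i • x = 0 := by
    rw [← mul_smul, ← vertex_mul_shift_pow, mul_smul, hv _ hi]
  refine ⟨DelVertex.extend (Uni.desc _ hy hl), ?_⟩
  have h1 : f' ∘ₗ Uni.desc _ hy hl = LinearMap.id := by
    refine Uni.hom_ext ?_
    rw [LinearMap.comp_apply, Uni.desc_gen, map_smul, LinearMap.id_apply]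
    exact (congrArg (vertex K i • ·) hx).trans vertex_smul_gen
  ext y
  exact DFunLike.congr_fun h1 y

/-- To extend g along f, compose its last coefficient with a K-linear retraction of f and the
idempotent at the socle vertex w. The full-length shift reaching w comes from the vertex i in Δ,
where Y is zero, so `colift` applies. -/
theorem Uni.injective [Module (DelAlg K Δ) (Uni K (i + 1) l)]
    [IsScalarTower (Alg K n) (DelAlg K Δ) (Uni K (i + 1) l)] (hi : i ∈ Δ) :
    Module.Injective (DelAlg K Δ) (Uni K (i + 1) l) := by
  refine ⟨fun X Y _ _ _ _ f hf g => ?_⟩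
  cases l with
  | zero => exact ⟨0, fun _ => Subsingleton.elim _ _⟩
  | succ l =>
  obtain ⟨_, _⟩ := exists_module_alg (K := K) (Δ := Δ) X
  obtain ⟨_, _⟩ := exists_module_alg (K := K) (Δ := Δ) Y
  let : Module K X := Module.compHom X (algebraMap K (Alg K n))
  have : IsScalarTower K (Alg K n) X := .of_algebraMap_smul fun _ _ => rfl
  let : Module K Y := Module.compHom Y (algebraMap K (Alg K n))
  have : IsScalarTower K (Alg K n) Y := .of_algebraMap_smul fun _ _ => rfl
  have hY : VanishesOn K Δ Y := vanishesOn_of_isScalarTower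
  let f' : X →ₗ[Alg K n] Y := f.restrictScalars (Alg K n)
  let g' : X →ₗ[Alg K n] Uni K (i + 1) (l + 1) := g.restrictScalars (Alg K n)
  obtain ⟨r, hr⟩ := (f'.restrictScalars K).exists_leftInverse_of_injective
    (LinearMap.ker_eq_bot.2 hf)
  have hr' (x : X) : r (f' x) = x := DFunLike.congr_fun hr x
  set w : CyclicQuiver n := i + 1 + (l : CyclicQuiver n) with hw
  have hw1 : i + 1 + ((l + 1 : ℕ) : CyclicQuiver n) = w + 1 := by
    rw [Nat.cast_succ, ← add_assoc]
  let φ : Y →ₗ[K] K := Uni.lastCoeff ∘ₗ g'.restrictScalars K ∘ₗ r ∘ₗ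
    Algebra.lsmul K K Y (vertex K w)
  have hφ (y : Y) : φ y = Uni.lastCoeff (g' (r (vertex K w • y))) := rfl
  let c : Y →ₗ[Alg K n] Uni K (i + 1) (l + 1) :=
    Uni.colift φ (fun v y => by
      rw [hw1, hφ, hφ, ← mul_smul]
      split_ifs with h
      · rw [add_right_cancel h, PathAlgebra.vertex_mul_self]
      · rw [PathAlgebra.vertex_mul_of_ne K fun h' => h (by rw [h']), zero_smul, map_zero,
          map_zero, map_zero])
      (fun y => by
        have hw2 : w = i + ((l + 1 : ℕ) : CyclicQuiver n) := by
          rw [hw]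
          push_cast
          ring
        rw [hφ, ← mul_smul, hw2, vertex_mul_shift_pow, mul_smul, hY _ hi, smul_zero, map_zero,
          map_zero, map_zero])
  refine ⟨DelVertex.extend c, fun x => ?_⟩
  have h1 : c ∘ₗ f' = g' := Uni.hom_ext_last fun x => by
    have h2 : Uni.lastCoeff (c (f' x)) = φ (f' x) := Uni.lastCoeff_colift φ _ _ _
    rw [LinearMap.comp_apply, h2, hφ, ← map_smul, hr', map_smul, Uni.lastCoeff_vertex_smul,
      if_pos hw1.symm]
  exact DFunLike.congr_fun h1 x

variable (K) in
-- k is the distance from i to the next vertex of Δ, the length of the projective at i; it is zero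
-- when i is in Δ.
theorem exists_length_add_mem (hΔ : Δ.Nonempty) (i : CyclicQuiver n) :
    ∃ k : ℕ, VanishesOn K Δ (Uni K i k) ∧ i + (k : CyclicQuiver n) ∈ Δ := by
  obtain ⟨j, hj⟩ := hΔ
  obtain ⟨l, -, hl⟩ := exists_natCast_add_eq i j
  have h : ∃ k : ℕ, i + (k : CyclicQuiver n) ∈ Δ := ⟨l, hl.symm ▸ hj⟩
  classical
  exact ⟨Nat.find h, Uni.vanishesOn_iff.2 fun k hk => Nat.find_min h hk, Nat.find_spec h⟩

variable (K) in
-- Dually, j is the last vertex of Δ before i, counted back from i - 1.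
theorem exists_add_length_eq (hΔ : Δ.Nonempty) (i : CyclicQuiver n) :
    ∃ j ∈ Δ, ∃ k : ℕ, VanishesOn K Δ (Uni K (j + 1) k) ∧ j + 1 + (k : CyclicQuiver n) = i := by
  obtain ⟨j, hj⟩ := hΔ
  obtain ⟨l, -, hl⟩ := exists_natCast_add_eq (j + 1) i
  have h : ∃ k : ℕ, i - 1 - (k : CyclicQuiver n) ∈ Δ := ⟨l, by
    rw [← hl, add_sub_right_comm, add_sub_cancel_right, add_sub_cancel_right]
    exact hj⟩
  classical
  refine ⟨_, Nat.find_spec h, Nat.find h, Uni.vanishesOn_iff.2 fun k hk hmem => ?_, by ring⟩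
  refine Nat.find_min h (m := Nat.find h - 1 - k) (by omega) ?_
  convert hmem using 1
  rw [Nat.cast_sub (by omega), Nat.cast_sub (by omega)]
  push_cast
  ring

end Uniserial

section HomologicalDimension

theorem asKQ_of_vanishesOn {Q : ObjectProperty (ModuleCat.{u} (DelAlg K Δ))}
    [Q.IsClosedUnderIsomorphisms] {M : Type u} [AddCommGroup M] [Module (Alg K n) M]
    (hM : VanishesOn K Δ M) (h : ∀ [Module (DelAlg K Δ) M]
      [IsScalarTower (Alg K n) (DelAlg K Δ) M], Q (.of _ M)) : asKQ Δ Q (.of _ M) := by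
  obtain ⟨_, _⟩ := hM.exists_module
  exact (DelVertex.asKQ_iff _).2 h

theorem asKQ_prod {Q : ObjectProperty (ModuleCat.{u} (DelAlg K Δ))}
    [Q.IsClosedUnderIsomorphisms] (hQ : ∀ X Y, Q X → Q Y → Q (.of _ (X × Y)))
    {M N : Type u} [AddCommGroup M] [Module (Alg K n) M] [AddCommGroup N] [Module (Alg K n) N]
    (hM : asKQ Δ Q (.of _ M)) (hN : asKQ Δ Q (.of _ N)) : asKQ Δ Q (.of _ (M × N)) := by
  obtain ⟨_, _⟩ := (vanishesOn_of_asKQ hM).exists_module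
  obtain ⟨_, _⟩ := (vanishesOn_of_asKQ hN).exists_module
  exact (DelVertex.asKQ_iff _).2
    (hQ _ _ ((DelVertex.asKQ_iff _).1 hM) ((DelVertex.asKQ_iff _).1 hN))

/-- A class of modules which is closed under direct sums and contains all uniserial modules
contains all finitely generated modules. -/
theorem prop_of_finGen {Q : ObjectProperty (ModuleCat.{u} (DelAlg K Δ))}
    [Q.IsClosedUnderIsomorphisms] (hQ : ∀ X Y, Q X → Q Y → Q (.of _ (X × Y)))
    (hu : ∀ (i : CyclicQuiver n) (l : ℕ), VanishesOn K Δ (Uni K i l) →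
      asKQ Δ Q (.of _ (Uni K i l))) (hΔ : Δ.Nonempty) (X : ModuleCat.{u} (DelAlg K Δ))
    (hX : finGen _ X) : Q X := by
  obtain ⟨_, _⟩ := exists_module_alg (K := K) (Δ := Δ) X
  let P : ObjectProperty (ModuleCat.{u} (Alg K n)) := fun M => VanishesOn K Δ M → asKQ Δ Q M
  have : P.IsClosedUnderIsomorphisms := ⟨fun {M N} e hM hN =>
    (asKQ Δ Q).prop_of_iso e (hM (hN.of_injective e.toLinearEquiv.toLinearMap
      e.toLinearEquiv.injective))⟩
  refine (DelVertex.asKQ_iff (M := X) Q).1 (E_induction P (fun M hM _ => ?_)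
    (fun i l M _ hM hv => ?_) (.of _ X) ((E_iff_finite hΔ).2 hX) vanishesOn_of_isScalarTower)
  · have e : Uni K (0 : CyclicQuiver n) 0 ≃ₗ[Alg K n] M := LinearEquiv.ofBijective 0
      ⟨Function.injective_of_subsingleton _, fun x => ⟨0, Subsingleton.elim _ _⟩⟩
    exact (asKQ Δ Q).prop_of_linearEquiv e (hu 0 0 fun v _ m => Subsingleton.elim _ _)
  · exact asKQ_prod hQ
      (hu i (l + 1) (hv.of_injective (LinearMap.inl (Alg K n) _ M) LinearMap.inl_injective))
      (hM (hv.of_injective (LinearMap.inr (Alg K n) _ M) LinearMap.inr_injective))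

/-- Prolonging a uniserial at its socle until the next step would enter Δ gives a projective cover,
whose kernel ends before the same vertex and is projective as well. -/
theorem hasProjectiveDimensionLE_one (hΔ : Δ.Nonempty) (X : ModuleCat.{u} (DelAlg K Δ))
    (hX : finGen _ X) : HasProjectiveDimensionLE X 1 := by
  refine prop_of_finGen (Q := fun X => HasProjectiveDimensionLE X 1)
    (fun _ _ => hasProjectiveDimensionLE_prod) (fun i l hv => ?_) hΔ X hX
  obtain ⟨k, hvk, hk⟩ := exists_length_add_mem K hΔ (i + (l : CyclicQuiver n))
  have hvlk := VanishesOn.of_exact _ _ (Uni.exact_incl_proj K i l k) hvk hv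
  obtain ⟨_, _⟩ := hvk.exists_module
  obtain ⟨_, _⟩ := hvlk.exists_module
  refine asKQ_of_vanishesOn hv ?_
  refine hasProjectiveDimensionLE_one_of_exact (DelVertex.extend (Uni.incl K i l k))
    (DelVertex.extend (Uni.proj K i l k)) (Uni.incl_injective K i l k)
    (Uni.exact_incl_proj K i l k) (Uni.proj_surjective K i l k) (Uni.projective hk)
    (Uni.projective ?_)
  rwa [Nat.cast_add, ← add_assoc]

/-- Prolong at the top, back to the previous vertex of Δ: the larger uniserial and the cokernel both
start right after this vertex, hence are injective. -/
theorem hasInjectiveDimensionLE_one (hΔ : Δ.Nonempty) (X : ModuleCat.{u} (DelAlg K Δ))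
    (hX : finGen _ X) : HasInjectiveDimensionLE X 1 := by
  refine prop_of_finGen (Q := fun X => HasInjectiveDimensionLE X 1)
    (fun _ _ => hasInjectiveDimensionLE_prod) (fun i l hv => ?_) hΔ X hX
  obtain ⟨j, hj, k, hvk, rfl⟩ := exists_add_length_eq K hΔ i
  have hvlk := VanishesOn.of_exact _ _ (Uni.exact_incl_proj K (j + 1) k l) hv hvk
  obtain ⟨_, _⟩ := hvk.exists_module
  obtain ⟨_, _⟩ := hvlk.exists_module
  refine asKQ_of_vanishesOn hv ?_
  exact hasInjectiveDimensionLE_one_of_exact (DelVertex.extend (Uni.incl K (j + 1) k l))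
    (DelVertex.extend (Uni.proj K (j + 1) k l)) (Uni.incl_injective K _ k l)
    (Uni.exact_incl_proj K _ k l) (Uni.proj_surjective K _ k l) (Uni.injective hj)
    (Uni.injective hj)

end HomologicalDimension

/-! ### Approximations from finitely many uniserials. -/

section Approximation

variable {T₀ F₀ : ObjectProperty (ModuleCat.{u} (Alg K n))}

theorem Uni.lt_of_vanishesOn (hΔ : Δ.Nonempty) {i : CyclicQuiver n} {l : ℕ}
    (hv : VanishesOn K Δ (Uni K i (l + 1))) : l < n := by
  by_contra h
  obtain ⟨j, hj⟩ := hΔ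
  obtain ⟨k, hk, rfl⟩ := exists_natCast_add_eq i j
  exact Uni.vanishesOn_iff.1 hv k (by omega) hj

instance finite_hom {M N : Type u} [AddCommGroup M] [Module (Alg K n) M] [AddCommGroup N]
    [Module (Alg K n) N] [Module K M] [IsScalarTower K (Alg K n) M] [Module K N]
    [IsScalarTower K (Alg K n) N] [Module.Finite K M] [Module.Finite K N] :
    Module.Finite K (M →ₗ[Alg K n] N) :=
  Module.Finite.of_injective (LinearMap.restrictScalarsₗ K (Alg K n) M N K)
    (LinearMap.restrictScalars_injective K)

/-- A nonzero uniserial vanishing on Δ has length at most n, so F₀ contains finitely many of them.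
Take one copy for each element of a basis of its maps to D; a map from a sum of uniserials is then
lifted one summand at a time. -/
theorem exists_isRightApprox (h : IsTorsionPair (EVanishing K Δ) T₀ F₀) (hΔ : Δ.Nonempty)
    (D : Type u) [AddCommGroup D] [Module (Alg K n) D] (hD : E K n (.of _ D)) :
    ∃ (U : ModuleCat.{u} (Alg K n)) (p : U →ₗ[Alg K n] D), IsRightApprox F₀ p := by
  classical
  let : Module K D := Module.compHom D (algebraMap K (Alg K n))
  have : IsScalarTower K (Alg K n) D := .of_algebraMap_smul fun _ _ => rfl
  have := (E_iff.1 hD).1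
  let b (i : CyclicQuiver n) (l : ℕ) := Module.finBasis K (Uni K i (l + 1) →ₗ[Alg K n] D)
  let ι := Σ x : {x : CyclicQuiver n × Fin n // F₀ (.of _ (Uni K x.1 (x.2.1 + 1)))},
    Fin (Module.finrank K (Uni K x.1.1 (x.1.2.1 + 1) →ₗ[Alg K n] D))
  have : Fintype ι := Fintype.ofFinite ι
  let U (y : ι) : Type u := Uni K y.1.1.1 (y.1.1.2.1 + 1)
  let p : (∀ y, U y) →ₗ[Alg K n] D := ∑ y : ι, b _ _ y.2 ∘ₗ LinearMap.proj y
  have hp (y : ι) : p ∘ₗ LinearMap.single (Alg K n) U y = b _ _ y.2 := by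
    refine LinearMap.ext fun x => ?_
    simp only [p, LinearMap.comp_apply, LinearMap.sum_apply, LinearMap.proj_apply]
    rw [Finset.sum_eq_single y]
    · rw [LinearMap.single_apply, Pi.single_eq_same]
    · intro z _ hz
      rw [LinearMap.single_apply, Pi.single_eq_of_ne hz, map_zero]
    · simp
  refine ⟨.of _ (∀ y, U y), p, h.free_pi ⟨E_pi fun y => E_uni _ _, fun v hv m => funext fun y =>
    (h.free_le _ y.1.2).2 v hv (m y)⟩ fun y => y.1.2, ?_⟩
  intro X hX
  let P : ObjectProperty (ModuleCat.{u} (Alg K n)) := fun X => F₀ X →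
    ∀ f : X →ₗ[Alg K n] D, ∃ g : X →ₗ[Alg K n] (∀ y, U y), p ∘ₗ g = f
  have := h.free_iso
  have : P.IsClosedUnderIsomorphisms := ⟨fun {X Y} e hX hY f => by
    obtain ⟨g, hg⟩ := hX (F₀.prop_of_iso e.symm hY) (f ∘ₗ e.toLinearEquiv.toLinearMap)
    refine ⟨g ∘ₗ e.symm.toLinearEquiv.toLinearMap, ?_⟩
    rw [← LinearMap.comp_assoc, hg]
    ext x
    exact congrArg f (e.toLinearEquiv.apply_symm_apply x)⟩
  refine E_induction P ?_ ?_ X (h.free_le _ hX).1 hX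
  · intro M hM _ f
    refine ⟨0, LinearMap.ext fun x => ?_⟩
    rw [Subsingleton.elim (α := M) x 0, map_zero, map_zero]
  · intro i l M hM ih hF f
    have hE := h.free_le _ hF
    have hU : F₀ (.of _ (Uni K i (l + 1))) := h.free_of_injective (LinearMap.inl _ _ M)
      LinearMap.inl_injective ⟨E_uni _ _, hE.2.of_injective (LinearMap.inl _ _ M)
        LinearMap.inl_injective⟩ hF
    have hM : F₀ M := h.free_of_injective (M := M) (LinearMap.inr _ _ M)
      LinearMap.inr_injective ⟨hM, hE.2.of_injective (LinearMap.inr _ _ M)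
        LinearMap.inr_injective⟩ hF
    obtain ⟨g₂, hg₂⟩ := ih hM (f ∘ₗ LinearMap.inr _ _ _)
    have hl : l < n := Uni.lt_of_vanishesOn hΔ (h.free_le _ hU).2
    let f₁ : Uni K i (l + 1) →ₗ[Alg K n] D := f ∘ₗ LinearMap.inl (Alg K n) _ M
    let y (k) : ι := ⟨⟨(i, ⟨l, hl⟩), hU⟩, k⟩
    let s (k) : Uni K i (l + 1) →ₗ[Alg K n] (∀ y, U y) := LinearMap.single (Alg K n) U (y k)
    let g₁ : Uni K i (l + 1) →ₗ[Alg K n] (∀ y, U y) := ∑ k, (b i l).repr f₁ k • s k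
    have hg₁ : p ∘ₗ g₁ = f₁ := by
      refine LinearMap.ext fun x => ?_
      rw [← (b i l).sum_repr f₁]
      have h0 : g₁ x = ∑ k, (b i l).repr f₁ k • s k x := LinearMap.sum_apply _ _ x
      rw [LinearMap.comp_apply, h0, map_sum p, LinearMap.sum_apply]
      refine Finset.sum_congr rfl fun k _ => ?_
      have h1 : p (s k x) = b i l k x :=
        DFunLike.congr_fun (hp (y k)) x
      rw [LinearMap.smul_apply, LinearMap.map_smul_of_tower p, h1]
    refine ⟨g₁.coprod g₂, LinearMap.prod_ext ?_ ?_⟩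
    · rw [LinearMap.comp_assoc, LinearMap.coprod_inl, hg₁]
    · rw [LinearMap.comp_assoc, LinearMap.coprod_inr, hg₂]

/-- The dual construction, with bases of the spaces of maps from D to the finitely many torsion
uniserials. -/
theorem exists_isLeftApprox (h : IsTorsionPair (EVanishing K Δ) T₀ F₀) (hΔ : Δ.Nonempty)
    (D : Type u) [AddCommGroup D] [Module (Alg K n) D] (hD : E K n (.of _ D)) :
    ∃ (U : ModuleCat.{u} (Alg K n)) (c : D →ₗ[Alg K n] U), IsLeftApprox T₀ c := by
  classical
  let : Module K D := Module.compHom D (algebraMap K (Alg K n))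
  have : IsScalarTower K (Alg K n) D := .of_algebraMap_smul fun _ _ => rfl
  have := (E_iff.1 hD).1
  let b (i : CyclicQuiver n) (l : ℕ) := Module.finBasis K (D →ₗ[Alg K n] Uni K i (l + 1))
  let ι := Σ x : {x : CyclicQuiver n × Fin n // T₀ (.of _ (Uni K x.1 (x.2.1 + 1)))},
    Fin (Module.finrank K (D →ₗ[Alg K n] Uni K x.1.1 (x.1.2.1 + 1)))
  have : Fintype ι := Fintype.ofFinite ι
  let U (y : ι) : Type u := Uni K y.1.1.1 (y.1.1.2.1 + 1)
  let c : D →ₗ[Alg K n] (∀ y, U y) := LinearMap.pi fun y : ι => b _ _ y.2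
  refine ⟨.of _ (∀ y, U y), c, h.torsion_pi ⟨E_pi fun y => E_uni _ _, fun v hv m => funext fun y =>
    (h.torsion_le _ y.1.2).2 v hv (m y)⟩ fun y => y.1.2, ?_⟩
  intro X hX
  let P : ObjectProperty (ModuleCat.{u} (Alg K n)) := fun X => T₀ X →
    ∀ f : D →ₗ[Alg K n] X, ∃ g : (∀ y, U y) →ₗ[Alg K n] X, g ∘ₗ c = f
  have := h.torsion_iso
  have : P.IsClosedUnderIsomorphisms := ⟨fun {X Y} e hX hY f => by
    obtain ⟨g, hg⟩ := hX (T₀.prop_of_iso e.symm hY) (e.symm.toLinearEquiv.toLinearMap ∘ₗ f)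
    refine ⟨e.toLinearEquiv.toLinearMap ∘ₗ g, ?_⟩
    rw [LinearMap.comp_assoc, hg]
    ext x
    exact e.toLinearEquiv.apply_symm_apply (f x)⟩
  refine E_induction P ?_ ?_ X (h.torsion_le _ hX).1 hX
  · intro M hM _ f
    exact ⟨0, LinearMap.ext fun x => Subsingleton.elim _ _⟩
  · intro i l M hM ih hT f
    have hE := h.torsion_le _ hT
    have hU : T₀ (.of _ (Uni K i (l + 1))) := h.torsion_of_surjective (LinearMap.fst _ _ M)
      LinearMap.fst_surjective ⟨E_uni _ _, hE.2.of_injective (LinearMap.inl _ _ M)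
        LinearMap.inl_injective⟩ hT
    have hM : T₀ M := h.torsion_of_surjective (N := M) (LinearMap.snd _ _ M)
      LinearMap.snd_surjective ⟨hM, hE.2.of_injective (LinearMap.inr _ _ M)
        LinearMap.inr_injective⟩ hT
    obtain ⟨g₂, hg₂⟩ := ih hM (LinearMap.snd _ _ _ ∘ₗ f)
    have hl : l < n := Uni.lt_of_vanishesOn hΔ (h.torsion_le _ hU).2
    let f₁ : D →ₗ[Alg K n] Uni K i (l + 1) := LinearMap.fst (Alg K n) _ M ∘ₗ f
    let y (k) : ι := ⟨⟨(i, ⟨l, hl⟩), hU⟩, k⟩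
    let π (k) : (∀ y, U y) →ₗ[Alg K n] Uni K i (l + 1) := LinearMap.proj (y k)
    let g₁ : (∀ y, U y) →ₗ[Alg K n] Uni K i (l + 1) := ∑ k, (b i l).repr f₁ k • π k
    have hg₁ : g₁ ∘ₗ c = f₁ := by
      have h0 := (b i l).sum_repr f₁
      refine Eq.trans ?_ h0
      ext x
      rw [LinearMap.comp_apply, LinearMap.sum_apply, LinearMap.sum_apply]
      rfl
    refine ⟨g₁.prod g₂, LinearMap.ext fun x => Prod.ext ?_ ?_⟩
    · exact DFunLike.congr_fun hg₁ x
    · exact DFunLike.congr_fun hg₂ x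

end Approximation

end CyclicQuiver

/-! ### The regular module, its dual, and the two classifications. -/

namespace CyclicQuiver

open PathAlgebra (vertex arrow)
open DelVertex (proj asKQ)

variable {K : Type u} [Field K] {n : ℕ} [NeZero n] {Δ : Finset (CyclicQuiver n)}

section Regular

variable {T₀ F₀ : ObjectProperty (ModuleCat.{u} (Alg K n))}

/-- The classes of the idempotents are images of elements of the projective uniserials at the
vertices, and they sum to 1. So a sum of torsion-free uniserials maps onto Λ; the map splits, and Λ
embeds in that sum. -/
theorem free_delAlg (h : IsTorsionPair (EVanishing K Δ) T₀ F₀) (hΔ : Δ.Nonempty)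
    (hP : ∀ (i : CyclicQuiver n) (l : ℕ), VanishesOn K Δ (Uni K i (l + 1)) →
      i + ((l + 1 : ℕ) : CyclicQuiver n) ∈ Δ → F₀ (.of _ (Uni K i (l + 1)))) :
    F₀ (.of _ (DelAlg K Δ)) := by
  have hΛ : VanishesOn K Δ (DelAlg K Δ) := vanishesOn_of_isScalarTower
  choose k hkv hk using exists_length_add_mem K hΔ
  have hU (v : CyclicQuiver n) : F₀ (.of _ (Uni K v (k v))) := by
    have h1 := hkv v
    have h2 := hk v
    generalize k v = l at h1 h2
    cases l with
    | zero => exact h.free_of_subsingleton ⟨E_uni _ _, h1⟩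
    | succ l => exact hP v l h1 h2
  have hd (v : CyclicQuiver n) : ∃ (d : Uni K v (k v) →ₗ[Alg K n] DelAlg K Δ) (x : Uni K v (k v)),
      d x = proj Δ K (vertex K v) := by
    have h2 := hk v
    generalize k v = l at h2
    have hv : vertex K v • proj Δ K (vertex K v) = proj Δ K (vertex K v) := by
      rw [DelVertex.smul_eq, ← map_mul, PathAlgebra.vertex_mul_self]
    have hl : shift K n ^ l • proj Δ K (vertex K v) = 0 := by
      rw [← hv, ← mul_smul, ← vertex_mul_shift_pow, mul_smul, hΛ _ h2]
    cases l with
    | zero => exact ⟨0, 0, by rwa [pow_zero, one_smul, eq_comm] at hl⟩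
    | succ l => exact ⟨Uni.desc _ hv hl, _, Uni.desc_gen _ _ _⟩
  choose d x hdx using hd
  let U := ∀ v, Uni K v (k v)
  have hUv : VanishesOn K Δ U := fun v hv m => funext fun w => hkv w v hv (m w)
  let π : U →ₗ[Alg K n] DelAlg K Δ := ∑ v, d v ∘ₗ LinearMap.proj v
  have hπ : Function.Surjective π := by
    have h1 : π x = 1 := by
      rw [LinearMap.sum_apply, ← map_one (proj Δ K), ← PathAlgebra.sum_vertex, map_sum]
      exact Finset.sum_congr rfl fun v _ => hdx v
    intro b
    obtain ⟨a, rfl⟩ := DelVertex.proj_surjective K Δ b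
    refine ⟨a • x, ?_⟩
    rw [map_smul, h1, DelVertex.smul_eq, mul_one]
  obtain ⟨_, _⟩ := hUv.exists_module
  obtain ⟨σ, hσ⟩ := Module.projective_lifting_property
    (DelVertex.extend (Δ := Δ) π) LinearMap.id hπ
  have := finite_delAlg (K := K) hΔ
  refine h.free_of_injective (N := U) (σ.restrictScalars (Alg K n)) ?_
    ⟨(E_iff_finite hΔ).2 inferInstance, hΛ⟩ (h.free_pi ⟨E_pi fun v => E_uni _ _, hUv⟩ hU)
  exact Function.LeftInverse.injective (g := π) fun y => DFunLike.congr_fun hσ y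

/-- Evaluation at each idempotent defines a map from DΛ to an injective uniserial, and together
these embed DΛ. The embedding splits, so DΛ is a quotient of a torsion module. -/
theorem torsion_dualRegular (h : IsTorsionPair (EVanishing K Δ) T₀ F₀) (hΔ : Δ.Nonempty)
    (hI : ∀ (i : CyclicQuiver n) (l : ℕ), i ∈ Δ → VanishesOn K Δ (Uni K (i + 1) (l + 1)) →
      T₀ (.of _ (Uni K (i + 1) (l + 1))))
    [Module (Alg K n) (DualRegular K (DelAlg K Δ))]
    [IsScalarTower (Alg K n) (DelAlg K Δ) (DualRegular K (DelAlg K Δ))] :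
    T₀ (.of _ (DualRegular K (DelAlg K Δ))) := by
  have hD : VanishesOn K Δ (DualRegular K (DelAlg K Δ)) := vanishesOn_of_isScalarTower
  have hΛ := finite_delAlg (K := K) hΔ
  have : IsScalarTower K (Alg K n) (DualRegular K (DelAlg K Δ)) :=
    DelVertex.isScalarTower_of_algebraMap (Δ := Δ)
  choose j hj k hkv hk using fun v : CyclicQuiver n => exists_add_length_eq K hΔ (v + 1)
  have hU (v : CyclicQuiver n) : T₀ (.of _ (Uni K (j v + 1) (k v))) := by
    have h1 := hkv v
    generalize k v = l at h1
    cases l with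
    | zero => exact h.torsion_of_subsingleton ⟨E_uni _ _, h1⟩
    | succ l => exact hI _ l (hj v) h1
  let φ (b : DelAlg K Δ) : DualRegular K (DelAlg K Δ) →ₗ[K] K :=
    { toFun := fun f => (show DelAlg K Δ →ₗ[K] K from f) b
      map_add' := fun _ _ => rfl
      map_smul' := fun _ _ => rfl }
  have hφ (a : Alg K n) (b : DelAlg K Δ) (f) : φ b (a • f) = φ (b * proj Δ K a) f := by
    rw [← DelVertex.proj_smul (Δ := Δ)]
    rfl
  have hφ0 (f) : φ 0 f = 0 := map_zero (show DelAlg K Δ →ₗ[K] K from f)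
  have hc (v : CyclicQuiver n) :
      ∃ c : DualRegular K (DelAlg K Δ) →ₗ[Alg K n] Uni K (j v + 1) (k v),
        ∀ f, c f = 0 → φ (proj Δ K (vertex K v)) f = 0 := by
    have h1 := hk v
    generalize k v = l at h1
    have hv (w : CyclicQuiver n) (f) : φ (proj Δ K (vertex K v)) (vertex K w • f) =
        if w + 1 = j v + 1 + (l : CyclicQuiver n) then φ (proj Δ K (vertex K v)) f else 0 := by
      rw [h1, hφ, ← map_mul]
      split_ifs with hw
      · rw [add_right_cancel hw, PathAlgebra.vertex_mul_self]
      · rw [PathAlgebra.vertex_mul_of_ne K fun h' => hw (by rw [h']), map_zero, hφ0]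
    have hl (f) : φ (proj Δ K (vertex K v)) (shift K n ^ l • f) = 0 := by
      have hvj : v = j v + (l : CyclicQuiver n) := by linear_combination -h1
      rw [hφ, ← map_mul]
      conv_lhs => rw [hvj]
      rw [vertex_mul_shift_pow, map_mul, DelVertex.proj_vertex_of_mem (hj v), mul_zero, hφ0]
    cases l with
    | zero => exact ⟨0, fun f _ => by simpa using hl f⟩
    | succ l =>
      refine ⟨Uni.colift _ hv hl, fun f hf => ?_⟩
      rw [← Uni.lastCoeff_colift _ hv hl, hf, map_zero]
  choose c hc using hc
  let U := ∀ v, Uni K (j v + 1) (k v)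
  have hUv : VanishesOn K Δ U := fun v hv m => funext fun w => hkv w v hv (m w)
  let ι : DualRegular K (DelAlg K Δ) →ₗ[Alg K n] U := LinearMap.pi c
  have hι : Function.Injective ι := by
    rw [injective_iff_map_eq_zero]
    intro f hf
    refine LinearMap.ext fun b => ?_
    obtain ⟨a, rfl⟩ := DelVertex.proj_surjective K Δ b
    have h1 (v) : φ (proj Δ K (vertex K v)) (a • f) = 0 :=
      hc v _ (congrFun (show ι (a • f) = 0 by rw [map_smul, hf, smul_zero]) v)
    have h2 : proj Δ K a = ∑ v, proj Δ K (vertex K v) * proj Δ K a := by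
      rw [← Finset.sum_mul, ← map_sum, PathAlgebra.sum_vertex, map_one, one_mul]
    rw [h2]
    refine (map_sum (show DelAlg K Δ →ₗ[K] K from f) _ _).trans ?_
    exact Finset.sum_eq_zero fun v _ => (hφ a _ f).symm.trans (h1 v)
  obtain ⟨_, _⟩ := hUv.exists_module
  obtain ⟨ρ, hρ⟩ := Module.Injective.out (DelVertex.extend (Δ := Δ) ι) hι LinearMap.id
  refine h.torsion_of_surjective (M := U) (ρ.restrictScalars (Alg K n)) (fun f => ⟨ι f, hρ f⟩)
    ⟨(E_iff_finite hΔ).2 inferInstance, hD⟩ (h.torsion_pi ⟨E_pi fun v => E_uni _ _, hUv⟩ hU)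

end Regular

/-! ### The first kind: Coray(Δ) and cotilting modules. -/

section FirstKind

theorem FirstKind.uni_free (d : FirstKind K n) (i : CyclicQuiver n) (l : ℕ)
    (hv : VanishesOn K d.Δ (Uni K i (l + 1))) (hi : i + ((l + 1 : ℕ) : CyclicQuiver n) ∈ d.Δ) :
    asKQ d.Δ d.F' (.of _ (Uni K i (l + 1))) := by
  have := d.isTorsionPair.free_iso
  have := finite_delAlg (K := K) d.nonempty
  obtain ⟨_, _⟩ := hv.exists_module
  have := (E_iff_finite (Δ := d.Δ) d.nonempty).1 (E_uni (K := K) i (l + 1))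
  exact (DelVertex.asKQ_iff _).2
    (IsCotiltingInduced.free_of_projective d.isTorsionPair d.induced _ (Uni.projective hi))

theorem FirstKind.isTorsionPair_pair (d : FirstKind K n) :
    IsTorsionPair (E K n) d.pair.1 d.pair.2 :=
  isTorsionPair_coray (isTorsionPair_asKQ d.nonempty d.isTorsionPair) d.uni_free

theorem FirstKind.hasUniqueDecomposition (d : FirstKind K n) :
    HasUniqueDecomposition (Coray K d.Δ) (asKQ d.Δ d.T') :=
  hasUniqueDecomposition_coray (isTorsionPair_asKQ d.nonempty d.isTorsionPair).torsion_le

theorem FirstKind.torsionTops_pair (d : FirstKind K n) : torsionTops d.pair.1 = d.Δ :=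
  torsionTops_coray (isTorsionPair_asKQ d.nonempty d.isTorsionPair) d.uni_free d.nonempty

/-- Δ is read off the torsion class by `torsionTops`; then F' is determined by its image in `E K n`,
and T' by F'. -/
theorem FirstKind.pair_injective :
    Function.Injective (FirstKind.pair : FirstKind K n → _) := by
  intro d e hde
  have hΔ : d.Δ = e.Δ := by rw [← d.torsionTops_pair, hde, e.torsionTops_pair]
  have hF := congrArg Prod.snd hde
  obtain ⟨⟨Δ, hne, T, F⟩, hd, hd'⟩ := d
  obtain ⟨⟨Δ', hne', T', F'⟩, he, he'⟩ := e
  obtain rfl : Δ = Δ' := hΔ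
  have := hd.free_iso
  have := he.free_iso
  obtain rfl : F = F' := asKQ_injective hF
  obtain rfl : T = T' := hd.torsion_eq he
  rfl

/-- The restriction of the pair to the vertices outside Δ = `torsionTops T` is cotilting-induced:
its torsion-free class contains Λ, it has approximations of DΛ, and injective dimensions are at most
one. -/
theorem exists_firstKind {T F : ObjectProperty (ModuleCat.{u} (Alg K n))}
    (h : IsTorsionPair (E K n) T F) (hΔ : (torsionTops T).Nonempty) :
    ∃ d : FirstKind K n, d.pair = (T, F) := by
  have h₀ := isTorsionPair_EVanishing_torsionTops h
  have hFi := h.free_iso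
  obtain ⟨T', F', h', hT', hF'⟩ := exists_isTorsionPair_finGen hΔ h₀
  have := h'.free_iso
  have := finite_delAlg (K := K) hΔ
  refine ⟨⟨⟨torsionTops T, hΔ, T', F'⟩, h', h'.isCotiltingInduced ?_ ?_
    fun X hX => hasInjectiveDimensionLE_one hΔ X hX⟩, Prod.ext ?_ hF'⟩
  · rw [← DelVertex.asKQ_iff F', hF']
    exact free_delAlg h₀ hΔ (uni_free_of_torsionTops h)
  · obtain ⟨_, _⟩ := exists_module_alg (K := K) (Δ := torsionTops T)
      (DualRegular K (DelAlg K (torsionTops T)))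
    obtain ⟨U, p, hp⟩ := exists_isRightApprox h₀ hΔ (DualRegular K (DelAlg K (torsionTops T)))
      ((E_iff_finite hΔ).2 inferInstance)
    obtain ⟨_, _⟩ := (h₀.free_le _ hp.prop).2.exists_module
    refine ⟨.of _ U, DelVertex.extend p, ?_, fun X hX g => ?_⟩
    · refine (DelVertex.asKQ_iff (M := U) F').1 ?_
      rw [hF']
      exact hp.prop
    · obtain ⟨_, _⟩ := exists_module_alg (K := K) (Δ := torsionTops T) X
      obtain ⟨f, hf⟩ := hp.exists_lift (.of _ X)
        (hF' ▸ (DelVertex.asKQ_iff (M := X) F').2 hX) (g.restrictScalars (Alg K n))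
      exact ⟨DelVertex.extend f, LinearMap.ext fun x => DFunLike.congr_fun hf x⟩
  · change directSumOf _ (asKQ _ T') = T
    rw [hT', ← eq_directSumOf_coray h]

end FirstKind

/-! ### The second kind: Ray(Δ) and tilting modules. -/

section SecondKind

theorem SecondKind.uni_torsion (d : SecondKind K n) (i : CyclicQuiver n) (l : ℕ)
    (hi : i ∈ d.Δ) (hv : VanishesOn K d.Δ (Uni K (i + 1) (l + 1))) :
    asKQ d.Δ d.T' (.of _ (Uni K (i + 1) (l + 1))) := by
  have := d.isTorsionPair.torsion_iso
  have := finite_delAlg (K := K) d.nonempty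
  obtain ⟨_, _⟩ := hv.exists_module
  have := (E_iff_finite (Δ := d.Δ) d.nonempty).1 (E_uni (K := K) (i + 1) (l + 1))
  exact (DelVertex.asKQ_iff _).2
    (IsTiltingInduced.torsion_of_injective K d.isTorsionPair d.induced _ (Uni.injective hi))

theorem SecondKind.isTorsionPair_pair (d : SecondKind K n) :
    IsTorsionPair (E K n) d.pair.1 d.pair.2 :=
  isTorsionPair_ray (isTorsionPair_asKQ d.nonempty d.isTorsionPair) d.uni_torsion

theorem SecondKind.hasUniqueDecomposition (d : SecondKind K n) :
    HasUniqueDecomposition (asKQ d.Δ d.F') (Ray K d.Δ) :=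
  hasUniqueDecomposition_ray (isTorsionPair_asKQ d.nonempty d.isTorsionPair).free_le

theorem SecondKind.freeSocles_pair (d : SecondKind K n) : freeSocles d.pair.2 = d.Δ :=
  freeSocles_ray (isTorsionPair_asKQ d.nonempty d.isTorsionPair) d.uni_torsion d.nonempty

/-- Here Δ is read off the torsion-free class by `freeSocles`, and T' determines F'. -/
theorem SecondKind.pair_injective :
    Function.Injective (SecondKind.pair : SecondKind K n → _) := by
  intro d e hde
  have hΔ : d.Δ = e.Δ := by rw [← d.freeSocles_pair, hde, e.freeSocles_pair]
  have hT := congrArg Prod.fst hde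
  obtain ⟨⟨Δ, hne, T, F⟩, hd, hd'⟩ := d
  obtain ⟨⟨Δ', hne', T', F'⟩, he, he'⟩ := e
  obtain rfl : Δ = Δ' := hΔ
  have := hd.torsion_iso
  have := he.torsion_iso
  obtain rfl : T = T' := asKQ_injective hT
  obtain rfl : F = F' := hd.free_eq he
  rfl

theorem exists_secondKind {T F : ObjectProperty (ModuleCat.{u} (Alg K n))}
    (h : IsTorsionPair (E K n) T F) (hΔ : (freeSocles F).Nonempty) :
    ∃ d : SecondKind K n, d.pair = (T, F) := by
  have h₀ := isTorsionPair_EVanishing_freeSocles h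
  have hTi := h.torsion_iso
  obtain ⟨T', F', h', hT', hF'⟩ := exists_isTorsionPair_finGen hΔ h₀
  have := h'.torsion_iso
  have := finite_delAlg (K := K) hΔ
  refine ⟨⟨⟨freeSocles F, hΔ, T', F'⟩, h', h'.isTiltingInduced K ?_ ?_
    fun X hX => hasProjectiveDimensionLE_one hΔ X hX⟩, Prod.ext hT' ?_⟩
  · obtain ⟨_, _⟩ := exists_module_alg (K := K) (Δ := freeSocles F)
      (DualRegular K (DelAlg K (freeSocles F)))
    rw [← DelVertex.asKQ_iff T', hT']
    exact torsion_dualRegular h₀ hΔ (uni_torsion_of_freeSocles h)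
  · obtain ⟨U, c, hc⟩ := exists_isLeftApprox h₀ hΔ (DelAlg K (freeSocles F))
      ((E_iff_finite hΔ).2 inferInstance)
    obtain ⟨_, _⟩ := (h₀.torsion_le _ hc.prop).2.exists_module
    refine ⟨.of _ U, DelVertex.extend c, ?_, fun X hX g => ?_⟩
    · refine (DelVertex.asKQ_iff (M := U) T').1 ?_
      rw [hT']
      exact hc.prop
    · obtain ⟨_, _⟩ := exists_module_alg (K := K) (Δ := freeSocles F) X
      obtain ⟨f, hf⟩ := hc.exists_desc (.of _ X)
        (hT' ▸ (DelVertex.asKQ_iff (M := X) T').2 hX) (g.restrictScalars (Alg K n))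
      exact ⟨DelVertex.extend f, LinearMap.ext fun x => DFunLike.congr_fun hf x⟩
  · change directSumOf (asKQ _ F') _ = F
    rw [hF', ← eq_directSumOf_ray h]

end SecondKind

/-! ### Disjointness of the two kinds and the classification. -/

theorem FirstKind.pair_ne (d : FirstKind K n) (e : SecondKind K n) : d.pair ≠ e.pair := by
  intro h
  refine not_nonempty_torsionTops_and_freeSocles d.isTorsionPair_pair ⟨?_, ?_⟩
  · rw [d.torsionTops_pair]
    exact d.nonempty
  · rw [h, e.freeSocles_pair]
    exact e.nonempty

end CyclicQuiver

theorem theorem4p14 (K : Type u) [Field K] (n : ℕ) [NeZero n] :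
    -- all pairs of the first kind are torsion pairs on `E_n`, the sum being a direct sum
    (∀ d : CyclicQuiver.FirstKind K n,
      HasUniqueDecomposition (CyclicQuiver.Coray K d.Δ) (DelVertex.asKQ d.Δ d.T') ∧
      IsTorsionPair (CyclicQuiver.E K n) d.pair.1 d.pair.2) ∧
    -- all pairs of the second kind are torsion pairs on `E_n`, the sum being a direct sum
    (∀ d : CyclicQuiver.SecondKind K n,
      HasUniqueDecomposition (DelVertex.asKQ d.Δ d.F') (CyclicQuiver.Ray K d.Δ) ∧
      IsTorsionPair (CyclicQuiver.E K n) d.pair.1 d.pair.2) ∧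
    -- every torsion pair on `E_n` arises exactly once, from exactly one of the two kinds
    (∀ T F : ObjectProperty (ModuleCat.{u} (PathAlgebra K (CyclicQuiver n))),
      IsTorsionPair (CyclicQuiver.E K n) T F →
        ∃! x : CyclicQuiver.FirstKind K n ⊕ CyclicQuiver.SecondKind K n,
          Sum.elim CyclicQuiver.FirstKind.pair CyclicQuiver.SecondKind.pair x = (T, F)) := by
  refine ⟨fun d => ⟨d.hasUniqueDecomposition, d.isTorsionPair_pair⟩,
    fun d => ⟨d.hasUniqueDecomposition, d.isTorsionPair_pair⟩, fun T F h => ?_⟩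
  have hinj : Function.Injective (Sum.elim CyclicQuiver.FirstKind.pair
      (CyclicQuiver.SecondKind.pair (K := K) (n := n))) :=
    CyclicQuiver.FirstKind.pair_injective.sumElim CyclicQuiver.SecondKind.pair_injective
      CyclicQuiver.FirstKind.pair_ne
  refine existsUnique_of_exists_of_unique ?_ fun x y hx hy => hinj (hx.trans hy.symm)
  rcases CyclicQuiver.nonempty_torsionTops_or_freeSocles h with hΔ | hΔ
  · obtain ⟨d, hd⟩ := CyclicQuiver.exists_firstKind h hΔ
    exact ⟨.inl d, hd⟩
  · obtain ⟨d, hd⟩ := CyclicQuiver.exists_secondKind h hΔ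
    exact ⟨.inr d, hd⟩
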